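/- Let $H$ be a finite-dimensional complex inner product space, $n=2l$, and let $A(\lambda)=A_0+\lambda A_1+\dots+\lambda^nA_n$ be an operator pencil on $H$ such that $\operatorname{Ker}A_n=0$, $\operatorname{Im}(A(\lambda)x,x)\le 0$ for all $x\in H$ and $\lambda\in\mathbb R$, and $0\notin\theta(A(\lambda_0))=\{(A(\lambda_0)u,u):\|u\|=1\}$ for some $\lambda_0\in\mathbb R$. **Definitions.** A chain at $\mu$ is a sequence $y^0\neq0,y^1,\dots,y^p$ with $\sum_{r=0}^{s}\frac1{r!}A^{(r)}(\mu)y^{s-r}=0$ for $0\le s\le p$. A canonical system at $\mu$ is a family of chains $w_k^0,\dots,w_k^{p_k}$ $(k=1,\dots,N)$ at $\mu$ such that $w_1^0,\dots,w_N^0$ is a basis of $\operatorname{Ker}A(\mu)$ and $\sum_k(p_k+1)$ is the largest possible. For real $\mu$, its adjoint system $z_k^0,\dots,z_k^{p_k}$ is determined by the principal part of $A(\lambda)^{-1}$ at $\mu$ being $\sum_k\sum_{s=0}^{p_k}(\lambda-\mu)^{-(p_k+1-s)}\sum_{r=0}^{s}(\cdot,z_k^{s-r})w_k^r$. The elementary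 solutions of a chain $y$ at $\mu$ are $u^h_{\mu,y}(z)=e^{i\mu z}\sum_{r=0}^h\frac{(iz)^r}{r!}y^{h-r}$, and $\widetilde y^h\in H^n$ denotes the vector with components $(-i)^j(u^h_{\mu,y})^{(j)}(0)$, $0\le j<n$. A canonical system at a real eigenvalue $c$ is called regular, with sign characteristics $\varepsilon_k$, if for every chain of odd length $p_k+1=2m+1$ we have $\varepsilon_k=\pm1$ and $\widetilde z_k^{\,m}-\varepsilon_k\widetilde w_k^{\,m}\in\operatorname{span}\{\widetilde w_j^{\,h}: 0\le h\le[(p_j-1)/2]\}$; for chains of even length put $\varepsilon_k=0$. Fix a regular canonical system at every real eigenvalue. A solution $v$ on $[0,\infty)$ of $$A\Bigl(-i\frac{d}{dz}\Bigr)v=\sum_{j=0}^n(-i)^jA_jv^{(j)}=0$$ satisfies the generalized Mandelstam radiation principle (at $+\infty$, with respect to the fixed systems) if $v=v_0+v_1$, where $v_0^{(j)}(z)\to0$ as $z\to\infty$ for $0\le j\le n-1$ and $v_1$ is a linear combination of elementary solutions $u^h_{c,w_k}$, $c$ a real eigenvalue, $0\le h\le[(p_k+\varepsilon_k)/2]$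 (none if $p_k=0$, $\varepsilon_k=-1$). Here $[\,\cdot\,]$ is the integer part (floor). **Theorem.** A regular canonical system exists at every real eigenvalue of $A(\lambda)$. For every choice of regular canonical systems at the real eigenvalues and all $\varphi_0,\dots,\varphi_{l-1}\in H$, the equation $A(-i\,d/dz)v=0$ has on $[0,\infty)$ exactly one solution $v$ with $(-i)^jv^{(j)}(0)=\varphi_j$, $0\le j\le l-1$, that satisfies the generalized Mandelstam radiation principle with respect to these systems. -/

import Mathlib

open Set Filter Topology

noncomputable section

namespace HalfRange

variable {H : Type*} [NormedAddCommGroup H] [InnerProductSpace ℂ H] {n : ℕ}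

/-- The operator pencil `A(μ) = A₀ + μ A₁ + ⋯ + μⁿ Aₙ`. -/
def pencil (A : Fin (n + 1) → H →L[ℂ] H) (μ : ℂ) : H →L[ℂ] H :=
  ∑ j : Fin (n + 1), μ ^ (j : ℕ) • A j

/-- The numerical range `θ(T) = {(Tu, u) : ‖u‖ = 1}`. The product `(x, y)` is taken linear in
the first argument, so `(Tu, u)` is `inner ℂ u (T u)`. -/
def numericalRange (T : H →L[ℂ] H) : Set ℂ :=
  {a | ∃ u : H, ‖u‖ = 1 ∧ inner ℂ u (T u) = a}

/-- The pencil is dissipative on the real axis: `Im (A(t)x, x) ≤ 0` for real `t` and all `x`. -/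
def IsDissipative (A : Fin (n + 1) → H →L[ℂ] H) : Prop :=
  ∀ (t : ℝ) (x : H), (inner ℂ x (pencil A (t : ℂ) x)).im ≤ 0

/-- `μ` is an eigenvalue of the pencil. -/
def IsEigenvalue (A : Fin (n + 1) → H →L[ℂ] H) (μ : ℂ) : Prop :=
  ∃ y : H, y ≠ 0 ∧ pencil A μ y = 0

/-- `y⁰, …, yᵖ` is a chain of an eigenvector and associated vectors at `μ`:
`y⁰ ≠ 0` and `∑_{r ≤ s} (1/r!) A⁽ʳ⁾(μ) y^{s-r} = 0` for `s = 0, …, p`.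
The values `y s` with `s > p` play no role. -/
def IsChain (A : Fin (n + 1) → H →L[ℂ] H) (μ : ℂ) (p : ℕ) (y : ℕ → H) : Prop :=
  y 0 ≠ 0 ∧ ∀ s ≤ p, ∑ r ∈ Finset.range (s + 1),
    ((r.factorial : ℂ)⁻¹ • iteratedDeriv r (pencil A) μ) (y (s - r)) = 0

/-- The data of finitely many finite sequences `w k 0, …, w k (p k)`, `k = 1, …, num`, of vectors.
Only the entries `w k h` with `h ≤ p k` are meaningful. -/
structure ChainSystem (H : Type*) where
  /-- number of sequences -/
  num : ℕ
  /-- the `k`-th sequence has length `p k + 1` -/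
  p : Fin num → ℕ
  /-- the vectors -/
  w : Fin num → ℕ → H

/-- Total number of vectors of a system. -/
def ChainSystem.total (S : ChainSystem H) : ℕ := ∑ k, (S.p k + 1)

/-- Each sequence of the system is a chain of the pencil at `μ`, and the leading vectors
`w k 0` form a basis of `Ker A(μ)`. -/
def IsKernelChainSystem (A : Fin (n + 1) → H →L[ℂ] H) (μ : ℂ) (S : ChainSystem H) : Prop :=
  (∀ k, IsChain A μ (S.p k) (S.w k)) ∧
  LinearIndependent ℂ (fun k => S.w k 0) ∧
  Submodule.span ℂ (range fun k => S.w k 0) = (pencil A μ).ker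

/-- A canonical system of eigenvectors and associated vectors at `μ`: chains over a basis of
`Ker A(μ)` with the largest possible total number of vectors. (The order in which the chains are
numbered is immaterial and is left free.) -/
def IsCanonicalSystem (A : Fin (n + 1) → H →L[ℂ] H) (μ : ℂ) (S : ChainSystem H) : Prop :=
  IsKernelChainSystem A μ S ∧
  ∀ S' : ChainSystem H, IsKernelChainSystem A μ S' → S'.total ≤ S.total

/-- `z` is the system adjoint to the canonical system `S` at `μ`: the principal part of
`A(lam)⁻¹` at `lam = μ` is
`∑ₖ ∑_{s ≤ pₖ} (lam - μ)^{-(pₖ+1-s)} ∑_{r ≤ s} (·, zₖ^{s-r}) wₖʳ`.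
Here `(·, z) w` is the operator `x ↦ (x, z) w`. -/
def IsAdjointSystem (A : Fin (n + 1) → H →L[ℂ] H) (μ : ℂ) (S : ChainSystem H)
    (z : Fin S.num → ℕ → H) : Prop :=
  ∃ R : ℂ → H →L[ℂ] H, AnalyticAt ℂ R μ ∧
    ∀ᶠ lam in 𝓝[≠] μ, IsUnit (pencil A lam) ∧
      Ring.inverse (pencil A lam) =
        (∑ k, ∑ s ∈ Finset.range (S.p k + 1),
          ((lam - μ) ^ (S.p k + 1 - s))⁻¹ •
            ∑ r ∈ Finset.range (s + 1), (innerSL ℂ (z k (s - r))).smulRight (S.w k r)) + R lam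

/-- The elementary solution
`z ↦ e^{iμz} (yʰ + (iz/1!) y^{h-1} + ⋯ + ((iz)ʰ/h!) y⁰)` built from a chain `y` at `μ`. -/
def elementarySolution (μ : ℂ) (y : ℕ → H) (h : ℕ) (z : ℝ) : H :=
  Complex.exp (Complex.I * μ * z) •
    ∑ r ∈ Finset.range (h + 1), ((Complex.I * z) ^ r / (r.factorial : ℂ)) • y (h - r)

/-- The `h`-th vector of the Keldysh derived chain of length `m` of a chain `y` at `μ`: the vector
of `Hᵐ` with components `(-i)ʳ uₕ⁽ʳ⁾(0)`, `r < m`, for the elementary solution `uₕ`. -/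
def keldysh (m : ℕ) (μ : ℂ) (y : ℕ → H) (h : ℕ) : Fin m → H :=
  fun r => (-Complex.I) ^ (r : ℕ) • iteratedDeriv (r : ℕ) (elementarySolution μ y h) 0

/-- The span in `Hⁿ` of the derived vectors of length `n` of all `wₖʰ` with
`h ≤ [(pₖ - 1)/2]`, that is `2h + 1 ≤ pₖ` (the "first halves" of the chains without the middle
vectors of the chains of odd length; nothing is taken from a chain with `pₖ = 0`). -/
def halfSpan (n : ℕ) (μ : ℂ) (S : ChainSystem H) : Submodule ℂ (Fin n → H) :=
  Submodule.span ℂ {x | ∃ (k : Fin S.num) (h : ℕ), 2 * h + 1 ≤ S.p k ∧ x = keldysh n μ (S.w k) h}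

/-- `S` is a regular canonical system at the real point `c`, with sign characteristics `ε`:
it is canonical and, with `z` its adjoint system, for every chain of odd length `pₖ + 1 = 2m + 1`
one has `εₖ = ±1` and the middle vectors satisfy `zₖᵐ = εₖ wₖᵐ + w` with `w` in the span of the
first halves. The relation is imposed on the Keldysh derived vectors of length `n` (its first
component is the relation in `H`), so that it determines `εₖ` also if `wₖᵐ = 0`.
For chains of even length `εₖ = 0`. -/
def IsRegularSystem (A : Fin (n + 1) → H →L[ℂ] H) (c : ℝ) (S : ChainSystem H)
    (ε : Fin S.num → ℤ) : Prop :=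
  IsCanonicalSystem A (c : ℂ) S ∧
  (∃ z : Fin S.num → ℕ → H, IsAdjointSystem A (c : ℂ) S z ∧
    ∀ (k : Fin S.num) (m : ℕ), S.p k = 2 * m →
      (ε k = 1 ∨ ε k = -1) ∧
      keldysh n (c : ℂ) (z k) m - (ε k : ℂ) • keldysh n (c : ℂ) (S.w k) m
        ∈ halfSpan n (c : ℂ) S) ∧
  ∀ k, Odd (S.p k) → ε k = 0

/-- A choice, for every real eigenvalue of the pencil, of a regular canonical system with its sign
characteristics. -/
def IsRegularFamily (A : Fin (n + 1) → H →L[ℂ] H) (S : ℝ → ChainSystem H)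
    (ε : (c : ℝ) → Fin (S c).num → ℤ) : Prop :=
  ∀ c : ℝ, IsEigenvalue A (c : ℂ) → IsRegularSystem A c (S c) (ε c)

/-- The elementary solutions at real eigenvalues that are admitted at `+∞`: those with
`0 ≤ h ≤ [(pₖ + εₖ)/2]`. (Division by `2` in `ℤ` is the integer part; it is `-1` for
`pₖ = 0`, `εₖ = -1`, and then nothing is admitted.) -/
def admittedSolutions (A : Fin (n + 1) → H →L[ℂ] H) (S : ℝ → ChainSystem H)
    (ε : (c : ℝ) → Fin (S c).num → ℤ) : Set (ℝ → H) :=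
  {f | ∃ c : ℝ, IsEigenvalue A (c : ℂ) ∧ ∃ (k : Fin (S c).num) (h : ℕ),
    (h : ℤ) ≤ ((S c).p k + ε c k) / 2 ∧ f = elementarySolution (c : ℂ) ((S c).w k) h}

/-- `v` is a (classical) solution of `A(-i d/dz) v = ∑ⱼ (-i)ʲ Aⱼ v⁽ʲ⁾ = 0` on the semi-axis
`[0, ∞)`; the values of `v` at negative `z` play no role. -/
def IsSolution (A : Fin (n + 1) → H →L[ℂ] H) (v : ℝ → H) : Prop :=
  ContDiffOn ℝ n v (Ici 0) ∧
  ∀ z ∈ Ici (0 : ℝ), ∑ j : Fin (n + 1),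
    (-Complex.I) ^ (j : ℕ) • A j (iteratedDerivWithin (j : ℕ) v (Ici 0) z) = 0

/-- The generalized Mandelstam radiation principle at `+∞`, with respect to the chosen regular
canonical systems: `v = v₀ + v₁`, where `v₁` is a superposition of admitted elementary solutions and
`v₀⁽ʲ⁾(z) → 0` as `z → ∞` for `j = 0, …, n - 1`. -/
def SatisfiesRadiation (A : Fin (n + 1) → H →L[ℂ] H) (S : ℝ → ChainSystem H)
    (ε : (c : ℝ) → Fin (S c).num → ℤ) (v : ℝ → H) : Prop :=
  ∃ v₀ v₁ : ℝ → H, EqOn v (v₀ + v₁) (Ici 0) ∧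
    v₁ ∈ Submodule.span ℂ (admittedSolutions A S ε) ∧
    ContDiffOn ℝ n v₀ (Ici 0) ∧
    ∀ j < n, Tendsto (iteratedDerivWithin j v₀ (Ici 0)) atTop (𝓝 0)

/-- The half-range Cauchy problem: `v` solves the equation on `[0, ∞)`, has the initial data
`(-i)ʲ v⁽ʲ⁾(0) = φⱼ`, `j < l`, and satisfies the generalized Mandelstam radiation principle. -/
def IsHalfRangeSolution {l : ℕ} (A : Fin (n + 1) → H →L[ℂ] H) (S : ℝ → ChainSystem H)
    (ε : (c : ℝ) → Fin (S c).num → ℤ) (φ : Fin l → H) (v : ℝ → H) : Prop :=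
  IsSolution A v ∧
  (∀ j : Fin l, (-Complex.I) ^ (j : ℕ) • iteratedDerivWithin (j : ℕ) v (Ici 0) 0 = φ j) ∧
  SatisfiesRadiation A S ε v

end HalfRange

end

/-! A solution is determined by its Cauchy data in `Hⁿ`, which evolve by the flow of the companion
operator. The root subspace of that operator at `μ` is the space of pole parts at `μ` that the
pencil turns into polynomials (`poleAct_eigenPole`, `poleData_eigenPole`, `poleData_injOn`); a chain
enters through its reversed sequence. The radiation principle selects a subspace of each root
subspace (`radiationSpace` with `s = 1`): everything for `Im μ > 0`, nothing for `Im μ < 0`, and the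
admitted part of the chains for real `μ`. With half-planes and signs interchanged one gets a second
selection, `s = -1`.

Counting. At a real eigenvalue the reversal `h ↦ p - h` shows that the two selections have
complementary dimensions, so the two total spaces have dimensions adding up to `n dim H = 2l dim H`.
If restriction to the first `l` Cauchy data is injective on both, each has dimension exactly `l dim
H`, and restriction is bijective. For `s = 1` this is existence and uniqueness.

Injectivity (`eq_zero_of_mem_iSup_radiationSpace`). Let `F` be the sum of the pole parts of data `x`
whose first `l` components vanish. Then `A F` is a polynomial of degree below `l`, while `F =
O(lam^{-l-1})`. For `s = 1` the function `f(lam) = (A(lam)F(lam), F(conj lam))` is thus rational,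
`O(lam⁻²)`, with poles in the closed lower half-plane and `Im f ≤ 0` on the real axis. The admission
rule makes its real poles simple with nonnegative residues: the residue is a sum of `|a|² ε` over
the middle vectors present (`exists_residue`). Such a function is zero (`polePart_sum_eq_zero`), and
`s = -1` is symmetric. Hence `(A(t)F(t), F(t)) = 0` near `t₀`, the numerical range condition gives
`F(t) = 0` there, and `x = 0`.

Local analysis. Along a chain polynomial the nonnegative form `-Im (Ay, y)`, divided by a suitable
odd power of `t`, has a limit at `0`, which can only be `0`. By Cauchy-Schwarz the first halves of
the chains then behave as for a self-adjoint pencil (`IsChainGerm.tendsto_inner`). The Gram matrix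
of the chains of length `2m + 1` is Hermitian, and up to conjugation it is inverse to the matrix
that expresses the middle adjoint vectors through the middle vectors modulo first halves
(`IsAdjointSystem.sum_mul_inner_chainImage`). Regularity therefore means that the Gram matrix is
diagonal with entries `ε`.

Existence of regular systems. A basis of `H` adapted to the filtration by chain length yields a
local Smith factorization of the pencil (`IsAdapted.exists_inverse`), hence a canonical system
together with its adjoint. The spectral theorem on each layer of the filtration diagonalizes the
Gram form, and rescaling normalizes its entries to `±1`. -/

noncomputable section

namespace HalfRange

/-! ### Pole parts and polynomials as coefficient sequences. -/

section Sequences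

set_option linter.unusedSectionVars false

variable {E : Type*} [AddCommGroup E] [Module ℂ E]

/-- The left shift of sequences. -/
def leftShift (E : Type*) [AddCommGroup E] [Module ℂ E] : Module.End ℂ (ℕ → E) :=
  LinearMap.funLeft ℂ E Nat.succ

/-- Multiplication by the spectral parameter on the pole parts at `μ`; the sequence `π` stands for
the pole part `∑ᵢ (lam - μ)^{-(i+1)} πᵢ`. -/
def poleMul (E : Type*) [AddCommGroup E] [Module ℂ E] (μ : ℂ) : Module.End ℂ (ℕ → E) :=
  μ • 1 + leftShift E

@[simp] lemma leftShift_apply (π : ℕ → E) (i : ℕ) : leftShift E π i = π (i + 1) := rfl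

lemma leftShift_pow_apply (j : ℕ) (π : ℕ → E) (i : ℕ) : (leftShift E ^ j) π i = π (i + j) := by
  induction j generalizing i with
  | zero => rfl
  | succ j ih =>
    rw [pow_succ', Module.End.mul_apply, leftShift_apply, ih]
    congr 1; ring

@[simp] lemma poleMul_apply (μ : ℂ) (π : ℕ → E) (i : ℕ) :
    poleMul E μ π i = μ • π i + π (i + 1) := rfl

lemma poleMul_pow_apply (μ : ℂ) (j : ℕ) (π : ℕ → E) (i : ℕ) :
    (poleMul E μ ^ j) π i
      = ∑ r ∈ Finset.range (j + 1), ((j.choose r : ℂ) * μ ^ (j - r)) • π (i + r) := by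
  have hc : Commute (leftShift E) (μ • (1 : Module.End ℂ (ℕ → E))) :=
    (Commute.one_right _).smul_right μ
  rw [poleMul, add_comm, hc.add_pow, LinearMap.sum_apply, Finset.sum_apply]
  refine Finset.sum_congr rfl fun r _ => ?_
  rw [smul_pow, one_pow, mul_smul_comm, mul_one, smul_mul_assoc, ← nsmul_eq_mul',
    LinearMap.smul_apply, LinearMap.smul_apply, Pi.smul_apply, Pi.smul_apply, leftShift_pow_apply,
    ← Nat.cast_smul_eq_nsmul ℂ, smul_smul, mul_comm]

/-- `π` vanishes from the index `M` on. -/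
def VanishFrom (M : ℕ) (π : ℕ → E) : Prop := ∀ i, M ≤ i → π i = 0

lemma VanishFrom.mono {M N : ℕ} {π : ℕ → E} (h : VanishFrom M π) (hMN : M ≤ N) :
    VanishFrom N π := fun i hi => h i (hMN.trans hi)

lemma VanishFrom.poleMul {M : ℕ} {π : ℕ → E} (h : VanishFrom M π) (μ : ℂ) :
    VanishFrom M (poleMul E μ π) := fun i hi => by
  rw [poleMul_apply, h i hi, h (i + 1) (by omega), smul_zero, add_zero]

lemma VanishFrom.poleMul_pow {M : ℕ} {π : ℕ → E} (h : VanishFrom M π) (μ : ℂ) (j : ℕ) :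
    VanishFrom M ((HalfRange.poleMul E μ ^ j) π) := by
  induction j with
  | zero => exact h
  | succ j ih => rw [pow_succ', Module.End.mul_apply]; exact ih.poleMul μ

lemma VanishFrom.sum {ι : Type*} {s : Finset ι} {M : ℕ} {π : ι → ℕ → E}
    (h : ∀ i ∈ s, VanishFrom M (π i)) : VanishFrom M (∑ i ∈ s, π i) := fun j hj => by
  rw [Finset.sum_apply, Finset.sum_eq_zero fun i hi => h i hi j hj]

lemma VanishFrom.smul {M : ℕ} {π : ℕ → E} (h : VanishFrom M π) (a : ℂ) :
    VanishFrom M (a • π) := fun j hj => by rw [Pi.smul_apply, h j hj, smul_zero]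

/-- The pole part `∑_{i < M} (lam - μ)^{-(i+1)} πᵢ`. -/
def polePart (M : ℕ) (μ : ℂ) (π : ℕ → E) (lam : ℂ) : E :=
  ∑ i ∈ Finset.range M, ((lam - μ) ^ (i + 1))⁻¹ • π i

lemma polePart_add (M : ℕ) (μ : ℂ) (π ρ : ℕ → E) (lam : ℂ) :
    polePart M μ (π + ρ) lam = polePart M μ π lam + polePart M μ ρ lam := by
  simp [polePart, Finset.sum_add_distrib]

lemma polePart_smul (M : ℕ) (μ a : ℂ) (π : ℕ → E) (lam : ℂ) :
    polePart M μ (a • π) lam = a • polePart M μ π lam := by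
  simp only [polePart, Finset.smul_sum, Pi.smul_apply]
  exact Finset.sum_congr rfl fun i _ => smul_comm _ _ _

lemma polePart_sub (M : ℕ) (μ : ℂ) (π ρ : ℕ → E) (lam : ℂ) :
    polePart M μ (π - ρ) lam = polePart M μ π lam - polePart M μ ρ lam := by
  simp [polePart, Finset.sum_sub_distrib, smul_sub]

lemma polePart_sum {ι : Type*} (s : Finset ι) (M : ℕ) (μ : ℂ) (π : ι → ℕ → E) (lam : ℂ) :
    polePart M μ (∑ i ∈ s, π i) lam = ∑ i ∈ s, polePart M μ (π i) lam := by
  simp only [polePart, Finset.sum_apply, Finset.smul_sum]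
  exact Finset.sum_comm

lemma polePart_of_vanishFrom {M N : ℕ} {μ : ℂ} {π : ℕ → E} (h : VanishFrom M π) (hMN : M ≤ N)
    (lam : ℂ) : polePart N μ π lam = polePart M μ π lam := by
  refine (Finset.sum_subset (Finset.range_subset_range.2 hMN) fun i _ hi => ?_).symm
  rw [h i (by simpa using hi), smul_zero]

/-- Write `lam = μ + (lam - μ)`: the second summand lowers every pole order by one, and the simple
pole becomes the constant `π 0`. -/
lemma smul_polePart {M : ℕ} {μ : ℂ} {π : ℕ → E} (h : VanishFrom M π) {lam : ℂ} (hl : lam ≠ μ) :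
    lam • polePart M μ π lam = polePart M μ (poleMul E μ π) lam + π 0 := by
  have hl' : lam - μ ≠ 0 := sub_ne_zero.2 hl
  have key : ∀ i, lam • ((lam - μ) ^ (i + 1))⁻¹ • π i
      = μ • ((lam - μ) ^ (i + 1))⁻¹ • π i + ((lam - μ) ^ i)⁻¹ • π i := fun i => by
    rw [smul_smul, smul_smul, ← add_smul]
    congr 1
    field_simp
    ring
  have h2 : ∑ i ∈ Finset.range M, ((lam - μ) ^ i)⁻¹ • π i
      = ∑ i ∈ Finset.range M, ((lam - μ) ^ (i + 1))⁻¹ • π (i + 1) + π 0 := by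
    have e1 := Finset.sum_range_succ' (fun i => ((lam - μ) ^ i)⁻¹ • π i) M
    rw [Finset.sum_range_succ, h M le_rfl, smul_zero, add_zero] at e1
    simpa using e1
  simp only [polePart, Finset.smul_sum, key, Finset.sum_add_distrib, h2, poleMul_apply, smul_add]
  rw [add_assoc]
  congr 1
  exact Finset.sum_congr rfl fun i _ => smul_comm _ _ _

/-- The constants released at each multiplication accumulate to a polynomial whose coefficients are
the Cauchy data of the pole part. -/
lemma pow_smul_polePart {M : ℕ} {μ : ℂ} {π : ℕ → E} (h : VanishFrom M π) {lam : ℂ}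
    (hl : lam ≠ μ) (j : ℕ) :
    lam ^ j • polePart M μ π lam = polePart M μ ((poleMul E μ ^ j) π) lam
      + ∑ i ∈ Finset.range j, lam ^ (j - 1 - i) • (poleMul E μ ^ i) π 0 := by
  induction j with
  | zero => simp
  | succ j ih =>
    rw [pow_succ', mul_smul, ih, smul_add, smul_polePart (h.poleMul_pow μ j) hl, Finset.sum_range_succ,
      pow_succ', Module.End.mul_apply, Finset.smul_sum]
    have : j + 1 - 1 - j = 0 := by omega
    rw [this, pow_zero, one_smul, add_assoc, add_comm (∑ _ ∈ _, _)]
    congr 2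
    refine Finset.sum_congr rfl fun i hi => ?_
    rw [smul_smul, ← pow_succ']
    congr 2
    have := Finset.mem_range.1 hi
    omega

/-- The first `h + 1` terms of a sequence in reversed order: the pole part of
`(lam - μ)^{-(h+1)} ∑ᵣ (lam - μ)ʳ yʳ`. -/
def revSeq (h : ℕ) (y : ℕ → E) (i : ℕ) : E := if i ≤ h then y (h - i) else 0

lemma revSeq_vanishFrom (h : ℕ) (y : ℕ → E) : VanishFrom (h + 1) (revSeq h y) := fun i hi => by
  rw [revSeq, if_neg (by omega)]

/-- The polynomial `∑_{r < N} tʳ yʳ`. -/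
def seqPoly (N : ℕ) (y : ℕ → E) (t : ℂ) : E := ∑ r ∈ Finset.range N, t ^ r • y r

/-- Up to a term regular at `μ`, the pole part of an initial segment may be replaced by `t^{-(h+1)}`
times the full chain polynomial, to which the pencil applies well. -/
lemma polePart_revSeq {h N : ℕ} (hN : h < N) (μ : ℂ) (y : ℕ → E) {t : ℂ} (ht : t ≠ 0) :
    polePart (h + 1) μ (revSeq h y) (μ + t)
      = (t ^ (h + 1))⁻¹ • seqPoly N y t - seqPoly (N - (h + 1)) (fun r => y (h + 1 + r)) t := by
  obtain ⟨d, rfl⟩ : ∃ d, N = h + 1 + d := ⟨N - (h + 1), by omega⟩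
  rw [seqPoly, Finset.sum_range_add, smul_add, Finset.smul_sum, Finset.smul_sum,
    Nat.add_sub_cancel_left]
  have e2 : ∑ i ∈ Finset.range d, (t ^ (h + 1))⁻¹ • t ^ (h + 1 + i) • y (h + 1 + i)
      = seqPoly d (fun r => y (h + 1 + r)) t := by
    refine Finset.sum_congr rfl fun i _ => ?_
    rw [smul_smul, pow_add t (h + 1) i, inv_mul_cancel_left₀ (pow_ne_zero _ ht)]
  rw [e2, add_sub_cancel_right, polePart, ← Finset.sum_range_reflect]
  refine Finset.sum_congr rfl fun i hi => ?_
  have hi := Finset.mem_range.1 hi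
  have : h - (h + 1 - 1 - i) = i := by omega
  rw [revSeq, if_pos (by omega), smul_smul, this, add_sub_cancel_left]
  congr 1
  have : h + 1 = (h + 1 - 1 - i + 1) + i := by omega
  conv_rhs => rw [this, pow_add]
  field_simp

/-- The Cauchy product of two truncated polynomials, cut at degree `N`: convolutions below, and a
remainder divisible by `t ^ N`. -/
lemma seqPoly_mul_aux {F G : Type*} [AddCommGroup F] [Module ℂ F] [AddCommGroup G] [Module ℂ G]
    (f : E →ₗ[ℂ] F →ₗ[ℂ] G) (a : ℕ → E) (y : ℕ → F) (N : ℕ) (t : ℂ) :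
    f (seqPoly N a t) (seqPoly N y t)
      = ∑ s ∈ Finset.range N, t ^ s • ∑ r ∈ Finset.range (s + 1), f (a (s - r)) (y r)
        + t ^ N • ∑ r ∈ Finset.range N, ∑ i ∈ Finset.range r,
            t ^ i • f (a (N - r + i)) (y r) := by
  have e1 : f (seqPoly N a t) (seqPoly N y t) = ∑ r ∈ Finset.range N, ∑ i ∈ Finset.range N,
      t ^ (r + i) • f (a i) (y r) := by
    simp only [seqPoly, map_sum, LinearMap.sum_apply, map_smul, LinearMap.smul_apply,
      smul_smul, Finset.smul_sum, ← pow_add]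
  have e2 : ∑ s ∈ Finset.range N, t ^ s • ∑ r ∈ Finset.range (s + 1), f (a (s - r)) (y r)
      = ∑ r ∈ Finset.range N, ∑ i ∈ Finset.range (N - r), t ^ (r + i) • f (a i) (y r) := by
    simp only [Finset.smul_sum]
    rw [Finset.sum_sigma', Finset.sum_sigma']
    refine Finset.sum_bij' (fun x _ => ⟨x.2, x.1 - x.2⟩) (fun x _ => ⟨x.1 + x.2, x.1⟩) ?_ ?_ ?_ ?_ ?_
    · rintro ⟨s, r⟩ h; simp only [Finset.mem_sigma, Finset.mem_range] at h ⊢; omega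
    · rintro ⟨s, r⟩ h; simp only [Finset.mem_sigma, Finset.mem_range] at h ⊢; omega
    · rintro ⟨s, r⟩ h; simp only [Finset.mem_sigma, Finset.mem_range] at h
      simp only [Sigma.mk.injEq, heq_eq_eq, and_true]; omega
    · rintro ⟨s, r⟩ h; simp
    · rintro ⟨s, r⟩ h; simp only [Finset.mem_sigma, Finset.mem_range] at h
      have : r + (s - r) = s := by omega
      simp only [this]
  rw [e1, e2, Finset.smul_sum, ← Finset.sum_add_distrib]
  refine Finset.sum_congr rfl fun r hr => ?_
  have hr := Finset.mem_range.1 hr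
  have hN : N = (N - r) + r := by omega
  conv_lhs => rw [hN, Finset.sum_range_add]
  congr 1
  rw [Finset.smul_sum]
  refine Finset.sum_congr rfl fun i _ => ?_
  rw [smul_smul, ← pow_add]
  congr 2
  omega

end Sequences

/-! ### The pencil acting on chains and on pole parts. -/

section Algebra

variable {H : Type*} [NormedAddCommGroup H] [InnerProductSpace ℂ H] {n : ℕ}

/-- The Taylor coefficients of the pencil. -/
def taylorCoeff (A : Fin (n + 1) → H →L[ℂ] H) (μ : ℂ) (r : ℕ) : H →L[ℂ] H :=
  ∑ j : Fin (n + 1), (((j : ℕ).choose r : ℂ) * μ ^ ((j : ℕ) - r)) • A j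

lemma inv_factorial_smul_iteratedDeriv_pencil (A : Fin (n + 1) → H →L[ℂ] H) (μ : ℂ) (r : ℕ) :
    (r.factorial : ℂ)⁻¹ • iteratedDeriv r (pencil A) μ = taylorCoeff A μ r := by
  have h1 : iteratedDeriv r (pencil A) μ
      = ∑ j : Fin (n + 1), ((j : ℕ).descFactorial r * μ ^ ((j : ℕ) - r) : ℂ) • A j := by
    have : pencil A = ∑ j : Fin (n + 1), fun μ => μ ^ (j : ℕ) • A j := by
      ext1 x; simp [pencil]
    rw [this, iteratedDeriv_sum (fun j _ => by fun_prop)]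
    refine Finset.sum_congr rfl fun j _ => ?_
    have := iteratedDeriv_smul_const (n := r) (x := μ) (f := fun x : ℂ => x ^ (j : ℕ))
      (by fun_prop) (A j)
    rw [this]
    congr 1
    exact iteratedDeriv_pow _ _
  rw [h1, taylorCoeff, Finset.smul_sum]
  refine Finset.sum_congr rfl fun j _ => ?_
  rw [smul_smul, ← mul_assoc, Nat.descFactorial_eq_factorial_mul_choose]
  congr 2
  push_cast
  rw [inv_mul_cancel_left₀ (by exact_mod_cast r.factorial_ne_zero)]

lemma taylorCoeff_eq_zero (A : Fin (n + 1) → H →L[ℂ] H) (μ : ℂ) {r : ℕ} (hr : n < r) :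
    taylorCoeff A μ r = 0 :=
  Finset.sum_eq_zero fun j _ => by
    rw [Nat.choose_eq_zero_of_lt (by omega)]; simp

lemma pencil_add (A : Fin (n + 1) → H →L[ℂ] H) (μ t : ℂ) {N : ℕ} (hN : n < N) :
    pencil A (μ + t) = seqPoly N (taylorCoeff A μ) t := by
  simp only [seqPoly, taylorCoeff, Finset.smul_sum, pencil]
  rw [Finset.sum_comm]
  refine Finset.sum_congr rfl fun j _ => ?_
  rw [add_comm, add_pow, Finset.sum_smul]
  refine (Finset.sum_subset (Finset.range_subset_range.2 (by omega : (j : ℕ) + 1 ≤ N))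
    fun i _ hi => ?_).trans (Finset.sum_congr rfl fun i _ => ?_)
  · rw [Nat.choose_eq_zero_of_lt (by simpa using hi)]; simp
  · rw [smul_smul]; congr 1; ring

lemma taylorCoeff_zero (A : Fin (n + 1) → H →L[ℂ] H) (μ : ℂ) :
    taylorCoeff A μ 0 = pencil A μ := by
  simp [taylorCoeff, pencil]

/-- The coefficients of `A(μ + t) ∑ tʳ yʳ`. -/
def seqAct (A : Fin (n + 1) → H →L[ℂ] H) (μ : ℂ) (y : ℕ → H) (s : ℕ) : H :=
  ∑ r ∈ Finset.range (s + 1), taylorCoeff A μ r (y (s - r))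

lemma isChain_iff (A : Fin (n + 1) → H →L[ℂ] H) (μ : ℂ) (p : ℕ) (y : ℕ → H) :
    IsChain A μ p y ↔ y 0 ≠ 0 ∧ ∀ s ≤ p, seqAct A μ y s = 0 := by
  simp only [IsChain, seqAct, inv_factorial_smul_iteratedDeriv_pencil]

/-- The pole part of the pencil times a pole part. -/
def poleAct (A : Fin (n + 1) → H →L[ℂ] H) (μ : ℂ) (π : ℕ → H) (i : ℕ) : H :=
  ∑ j : Fin (n + 1), A j ((poleMul H μ ^ (j : ℕ)) π i)

lemma poleAct_eq (A : Fin (n + 1) → H →L[ℂ] H) (μ : ℂ) (π : ℕ → H) (i : ℕ) {N : ℕ} (hN : n < N) :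
    poleAct A μ π i = ∑ r ∈ Finset.range N, taylorCoeff A μ r (π (i + r)) := by
  simp only [poleAct, poleMul_pow_apply, taylorCoeff, map_sum, map_smul,
    sum_apply, smul_apply]
  rw [Finset.sum_comm]
  refine Finset.sum_congr rfl fun j _ => ?_
  refine Finset.sum_subset (Finset.range_subset_range.2 (by omega : (j : ℕ) + 1 ≤ N))
    fun i _ hi => ?_
  rw [Nat.choose_eq_zero_of_lt (by simpa using hi)]; simp

/-- The coefficient of index `i` of the product is the left side of the chain equation of index `h -
i`. -/
lemma poleAct_revSeq {A : Fin (n + 1) → H →L[ℂ] H} {μ : ℂ} {y : ℕ → H} {h : ℕ}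
    (hy : ∀ s ≤ h, seqAct A μ y s = 0) : poleAct A μ (revSeq h y) = 0 := by
  ext i
  rw [poleAct_eq A μ _ i (N := n + 1 + (h + 1)) (by omega), Pi.zero_apply]
  by_cases hi : i ≤ h
  · rw [← hy (h - i) (by omega), seqAct]
    symm
    refine Finset.sum_subset_zero_on_sdiff (Finset.range_subset_range.2 (by omega))
      (fun r hr => ?_) fun r hr => ?_
    · simp only [Finset.mem_sdiff, Finset.mem_range] at hr
      rw [revSeq, if_neg (by omega), map_zero]
    · have hr := Finset.mem_range.1 hr
      rw [revSeq, if_pos (by omega)]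
      congr 2; omega
  · refine Finset.sum_eq_zero fun r _ => ?_
    rw [revSeq, if_neg (by omega), map_zero]

/-- The Cauchy data of a pole part. -/
def poleData (n : ℕ) (μ : ℂ) : (ℕ → H) →ₗ[ℂ] (Fin n → H) :=
  LinearMap.pi fun j => LinearMap.proj 0 ∘ₗ (poleMul H μ ^ (j : ℕ))

@[simp] lemma poleData_apply (μ : ℂ) (π : ℕ → H) (j : Fin n) :
    poleData n μ π j = (poleMul H μ ^ (j : ℕ)) π 0 := rfl

/-- The numerator `A(lam) F(lam)` of the transform `F` of the solution with Cauchy data `x`. -/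
def symbol (A : Fin (n + 1) → H →L[ℂ] H) (x : Fin n → H) (lam : ℂ) : H :=
  ∑ j : Fin (n + 1), ∑ i : Fin n,
    if (i : ℕ) < j then lam ^ ((j : ℕ) - 1 - i) • A j (x i) else 0

/-- Multiplication by the powers of `lam` leaves a pole part and a polynomial. The pole parts cancel
by hypothesis, and the polynomial depends on the Cauchy data alone. -/
lemma pencil_polePart {A : Fin (n + 1) → H →L[ℂ] H} {μ : ℂ} {M : ℕ} {π : ℕ → H}
    (hM : VanishFrom M π) (h : poleAct A μ π = 0) {lam : ℂ} (hl : lam ≠ μ) :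
    pencil A lam (polePart M μ π lam) = symbol A (poleData n μ π) lam := by
  have e1 : pencil A lam (polePart M μ π lam)
      = ∑ j : Fin (n + 1), A j (lam ^ (j : ℕ) • polePart M μ π lam) := by
    simp [pencil]
  have e2 : ∑ j : Fin (n + 1), A j (polePart M μ ((poleMul H μ ^ (j : ℕ)) π) lam) = 0 := by
    have : ∑ j : Fin (n + 1), A j (polePart M μ ((poleMul H μ ^ (j : ℕ)) π) lam)
        = polePart M μ (poleAct A μ π) lam := by
      simp only [polePart, poleAct, map_sum, map_smul, Finset.smul_sum]
      exact Finset.sum_comm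
    rw [this, h]; simp [polePart]
  rw [e1]
  simp only [pow_smul_polePart hM hl, map_add, Finset.sum_add_distrib, e2, zero_add, symbol]
  refine Finset.sum_congr rfl fun j _ => ?_
  rw [map_sum, Finset.sum_range, ← Finset.sum_filter]
  symm
  refine Finset.sum_bij' (fun i hi => ⟨i, by simpa using hi⟩)
    (fun i _ => ⟨i, by omega⟩) ?_ ?_ ?_ ?_ ?_ <;> simp

lemma symbol_add (A : Fin (n + 1) → H →L[ℂ] H) (x y : Fin n → H) (lam : ℂ) :
    symbol A (x + y) lam = symbol A x lam + symbol A y lam := by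
  simp only [symbol, ← Finset.sum_add_distrib]
  refine Finset.sum_congr rfl fun j _ => Finset.sum_congr rfl fun i _ => ?_
  split_ifs <;> simp

lemma symbol_sum {ι : Type*} (s : Finset ι) (A : Fin (n + 1) → H →L[ℂ] H) (x : ι → Fin n → H)
    (lam : ℂ) : symbol A (∑ i ∈ s, x i) lam = ∑ i ∈ s, symbol A (x i) lam := by
  classical
  induction s using Finset.induction_on with
  | empty => simp [symbol]
  | insert i s hi ih => rw [Finset.sum_insert hi, Finset.sum_insert hi, symbol_add, ih]

end Algebra

/-! ### Rational functions with nonpositive imaginary part on the real axis. -/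

section

/-- Multiplication by the highest power of `t` isolates the top coefficient, which must vanish; then
the pole order decreases by one. -/
lemma eq_zero_of_tendsto_sum_inv_pow {E : Type*} [NormedAddCommGroup E] [NormedSpace ℂ E]
    (c : ℕ → E) (M : ℕ) (L : E)
    (h : Tendsto (fun t : ℝ => ∑ i ∈ Finset.range M, ((t : ℂ) ^ (i + 1))⁻¹ • c i) (𝓝[≠] 0) (𝓝 L)) :
    ∀ i < M, c i = 0 := by
  induction M with
  | zero => intro i hi; omega
  | succ M ih =>
    have hM : c M = 0 := by
      have h1 : Tendsto (fun t : ℝ => (t : ℂ) ^ (M + 1) •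
          ∑ i ∈ Finset.range (M + 1), ((t : ℂ) ^ (i + 1))⁻¹ • c i) (𝓝[≠] 0) (𝓝 ((0 : ℂ) • L)) := by
        refine Tendsto.smul ?_ h
        have : Continuous fun t : ℝ => (t : ℂ) ^ (M + 1) := by fun_prop
        exact (this.tendsto' 0 0 (by simp)).mono_left nhdsWithin_le_nhds
      have h2 : Tendsto (fun t : ℝ => ∑ i ∈ Finset.range (M + 1), ((t : ℂ) ^ (M - i)) • c i)
          (𝓝[≠] 0) (𝓝 (c M)) := by
        have : Continuous fun t : ℝ => ∑ i ∈ Finset.range (M + 1), ((t : ℂ) ^ (M - i)) • c i := by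
          fun_prop
        refine (this.tendsto' 0 _ ?_).mono_left nhdsWithin_le_nhds
        rw [Finset.sum_range_succ, Finset.sum_eq_zero]
        · simp
        · intro i hi
          have := Finset.mem_range.1 hi
          rw [Complex.ofReal_zero, zero_pow (by omega), zero_smul]
      rw [zero_smul] at h1
      refine tendsto_nhds_unique h2 (h1.congr' ?_)
      filter_upwards [self_mem_nhdsWithin] with t ht
      have ht : (t : ℂ) ≠ 0 := by exact_mod_cast ht
      rw [Finset.smul_sum]
      refine Finset.sum_congr rfl fun i hi => ?_
      have := Finset.mem_range.1 hi
      rw [smul_smul]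
      congr 1
      have e : M + 1 = (M - i) + (i + 1) := by omega
      rw [e, pow_add]
      field_simp
    have h' := ih (by simpa only [Finset.sum_range_succ, hM, smul_zero, add_zero] using h)
    intro i hi
    rcases Nat.lt_succ_iff_lt_or_eq.1 hi with hi | rfl
    · exact h' i hi
    · exact hM

lemma continuousAt_polePart {E : Type*} [NormedAddCommGroup E] [NormedSpace ℂ E] (M : ℕ)
    (π : ℕ → E) {a b : ℂ} (hb : b ≠ a) :
    ContinuousAt (fun t : ℝ => polePart M b π (a + t)) 0 := by
  refine tendsto_finsetSum _ fun i _ => ?_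
  have h1 : ContinuousAt (fun t : ℝ => (a + t - b) ^ (i + 1)) 0 := by fun_prop
  have h2 : ContinuousAt (fun t : ℝ => ((a + t - b) ^ (i + 1))⁻¹) 0 := by
    refine h1.inv₀ ?_
    simp only [Complex.ofReal_zero, add_zero]
    exact pow_ne_zero _ (sub_ne_zero.2 hb.symm)
  exact h2.smul continuousAt_const

/-- `exp(-i g)` has modulus `exp(Im g)`, so after a rotation the Phragmén-Lindelöf principle for the
right half-plane bounds it by `1`. -/
lemma im_nonpos_of_im_nonpos_on_real (g : ℂ → ℂ) (hd : ∀ z : ℂ, 0 ≤ z.im → DifferentiableAt ℂ g z)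
    (hb : ∃ C, ∀ z : ℂ, 0 ≤ z.im → ‖g z‖ ≤ C) (hr : ∀ t : ℝ, (g t).im ≤ 0) {z : ℂ}
    (hz : 0 ≤ z.im) : (g z).im ≤ 0 := by
  obtain ⟨C, hC⟩ := hb
  set F : ℂ → ℂ := fun w => Complex.exp (-Complex.I * g (Complex.I * w)) with hF
  have hnorm : ∀ w, ‖F w‖ = Real.exp (g (Complex.I * w)).im := fun w => by
    rw [hF, Complex.norm_exp]; simp
  have hdF : ∀ w : ℂ, 0 ≤ w.re → DifferentiableAt ℂ F w := fun w hw => by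
    have h1 : DifferentiableAt ℂ g (Complex.I * w) := hd _ (by simpa using hw)
    have h2 : DifferentiableAt ℂ (fun w => g (Complex.I * w)) w :=
      DifferentiableAt.comp w h1 (by fun_prop)
    exact ((h2.const_mul _)).cexp
  have hbd : ∀ w : ℂ, 0 ≤ w.re → ‖F w‖ ≤ Real.exp C := fun w hw => by
    rw [hnorm]
    exact Real.exp_le_exp.2 ((Complex.abs_im_le_norm _ |>.trans (hC _ (by simpa using hw))).trans'
      (le_abs_self _))
  have key := PhragmenLindelof.right_half_plane_of_bounded_on_real (f := F) (C := 1)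
    (z := -Complex.I * z) ?_ ?_ ?_ ?_ (by simpa using hz)
  · rw [hnorm] at key
    have e : Complex.I * (-Complex.I * z) = z := by
      rw [← mul_assoc, mul_neg, Complex.I_mul_I, neg_neg, one_mul]
    rw [e] at key
    simpa using key
  · have hcl : closure {w : ℂ | 0 < w.re} = {w : ℂ | 0 ≤ w.re} := Complex.closure_setOfPred_lt_re 0
    refine ⟨fun w hw => (hdF w (le_of_lt hw)).differentiableWithinAt, fun w hw => ?_⟩
    rw [hcl] at hw
    exact (hdF w hw).continuousAt.continuousWithinAt
  · refine ⟨1, by norm_num, 0, ?_⟩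
    refine Asymptotics.IsBigO.of_bound (Real.exp C) ?_
    refine eventually_inf_principal.2 (Eventually.of_forall fun w hw => ?_)
    simpa using hbd w (le_of_lt hw)
  · refine ⟨Real.exp C, ?_⟩
    rw [eventually_map]
    filter_upwards [eventually_ge_atTop 0] with x hx
    exact hbd x (by simpa using hx)
  · intro x
    rw [hnorm]
    have e : Complex.I * ((x : ℂ) * Complex.I) = ((-x : ℝ) : ℂ) := by
      rw [mul_comm, mul_assoc, Complex.I_mul_I]; push_cast; ring
    rw [e]
    simpa using hr (-x)

lemma polePart_inv (M : ℕ) (a : ℂ) (Γ : ℕ → ℂ) {ζ : ℂ} (hζ : ζ ≠ 0) :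
    polePart M a Γ ζ⁻¹
      = ζ * ∑ i ∈ Finset.range M, ζ ^ i * ((1 - a * ζ) ^ (i + 1))⁻¹ * Γ i := by
  rw [polePart, Finset.mul_sum]
  refine Finset.sum_congr rfl fun i _ => ?_
  have e : ζ⁻¹ - a = ζ⁻¹ * (1 - a * ζ) := by field_simp
  rw [e, mul_pow, mul_inv, inv_pow, inv_inv, smul_eq_mul]
  ring

/-- A proper rational function with poles in the closed lower half-plane, whose imaginary part
is nonpositive in the closed upper half-plane and which is `O(lam⁻²)` at infinity, vanishes. -/
lemma eventually_zero_of_im_nonpos (G : ℂ → ℂ) (hG : AnalyticAt ℂ G 0) (hG0 : G 0 = 0)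
    (him : ∀ᶠ ζ in 𝓝 (0 : ℂ), ζ.im ≤ 0 → (ζ * G ζ).im ≤ 0) : ∀ᶠ ζ in 𝓝 (0 : ℂ), G ζ = 0 := by
  by_contra hne
  obtain ⟨k, u, hu, hu0, hGu⟩ := hG.exists_eventuallyEq_pow_smul_nonzero_iff.2 hne
  have hk : k ≠ 0 := by
    rintro rfl
    apply hu0
    have := hGu.self_of_nhds
    rw [hG0] at this
    simpa using this.symm
  -- If `G` has a zero of exact order `k ≥ 1`, then `ζ G(ζ)` behaves like `ζ^{k+1} u(0)`. On the ray
  -- of argument `-θ` in the closed lower half-plane, division by the positive `τ^{k+1}` keeps the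
  -- sign in the limit.
  have ray : ∀ θ : ℝ, 0 ≤ θ → θ ≤ Real.pi →
      (Complex.exp (-(((k + 1 : ℕ) : ℂ) * θ * Complex.I)) * u 0).im ≤ 0 := by
    intro θ h0 hπ
    set e := Complex.exp (-(θ * Complex.I)) with he
    have hlim : Tendsto (fun τ : ℝ => (τ : ℂ) * e) (𝓝[>] 0) (𝓝 0) := by
      have : Continuous fun τ : ℝ => (τ : ℂ) * e := by fun_prop
      exact (this.tendsto' 0 0 (by simp)).mono_left nhdsWithin_le_nhds
    have hlim2 : Tendsto (fun τ : ℝ => (e ^ (k + 1) * u (τ * e)).im) (𝓝[>] 0)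
        (𝓝 (e ^ (k + 1) * u 0).im) :=
      (Complex.continuous_im.tendsto _).comp
        (tendsto_const_nhds.mul (hu.continuousAt.tendsto.comp hlim))
    have hee : e ^ (k + 1) = Complex.exp (-(((k + 1 : ℕ) : ℂ) * θ * Complex.I)) := by
      rw [he, ← Complex.exp_nat_mul]; congr 1; ring
    rw [← hee]
    refine le_of_tendsto hlim2 ?_
    filter_upwards [hlim.eventually him, hlim.eventually hGu, self_mem_nhdsWithin] with τ h1 h2 hτ
    have hτ : (0 : ℝ) < τ := hτ
    have him' : ((τ : ℂ) * e).im ≤ 0 := by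
      have : e.im ≤ 0 := by
        have : e = Complex.exp (((-θ : ℝ) : ℂ) * Complex.I) := by rw [he]; push_cast; ring_nf
        rw [this, Complex.exp_ofReal_mul_I_im, Real.sin_neg]
        have := Real.sin_nonneg_of_nonneg_of_le_pi h0 hπ
        linarith
      rw [Complex.re_ofReal_mul |> fun _ => Complex.im_ofReal_mul]
      exact mul_nonpos_of_nonneg_of_nonpos hτ.le this
    have h3 := h1 him'
    rw [h2, sub_zero, smul_eq_mul] at h3
    have : (τ : ℂ) * e * (((τ : ℂ) * e) ^ k * u (τ * e))
        = ((τ ^ (k + 1) : ℝ) : ℂ) * (e ^ (k + 1) * u (τ * e)) := by push_cast; ring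
    rw [this, Complex.im_ofReal_mul] at h3
    exact nonpos_of_mul_nonpos_right h3 (by positivity)
  have hk1 : ((k + 1 : ℕ) : ℝ) ≠ 0 := by positivity
  have hk2 : (2 : ℝ) ≤ ((k + 1 : ℕ) : ℝ) := by
    exact_mod_cast (by omega : 2 ≤ k + 1)
  -- Since `k + 1 ≥ 2`, the angles `(k + 1) θ` fill a whole circle; four directions at right angles
  -- then force `u 0 = 0`.
  have hdiv : ∀ α : ℝ, 0 ≤ α → α ≤ 2 * Real.pi →
      (Complex.exp (-(α * Complex.I)) * u 0).im ≤ 0 := by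
    intro α h0 h1
    have := ray (α / ((k + 1 : ℕ) : ℝ)) (by positivity) (by
      rw [div_le_iff₀ (by positivity)]
      nlinarith [Real.pi_pos])
    rw [← Complex.ofReal_natCast, ← Complex.ofReal_mul, mul_div_cancel₀ _ hk1] at this
    exact this
  have p := Real.pi_pos
  have r0 := hdiv 0 le_rfl (by linarith)
  have r1 := hdiv (Real.pi / 2) (by linarith) (by linarith)
  have r2 := hdiv Real.pi p.le (by linarith)
  have r3 := hdiv (Real.pi / 2 + Real.pi) (by linarith) (by linarith)
  have e1 : Complex.exp (-(((Real.pi / 2 : ℝ) : ℂ) * Complex.I)) = -Complex.I := by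
    rw [Complex.exp_neg]; push_cast; rw [Complex.exp_pi_div_two_mul_I]; simp
  have e2 : Complex.exp (-((Real.pi : ℂ) * Complex.I)) = -1 := by
    rw [Complex.exp_neg, Complex.exp_pi_mul_I]; norm_num
  have e3 : Complex.exp (-(((Real.pi / 2 + Real.pi : ℝ) : ℂ) * Complex.I)) = Complex.I := by
    rw [Complex.ofReal_add, add_mul, neg_add, Complex.exp_add, e1, e2]; simp
  rw [e1] at r1
  rw [e2] at r2
  rw [e3] at r3
  simp at r0 r1 r2 r3
  exact hu0 (Complex.ext (by simp; linarith) (by simp; linarith))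

/-- The simple real poles have real residues and do not affect `Im f` on the axis, so the nonreal
part `g` has `Im g ≤ 0` in the closed upper half-plane. Its coefficient at infinity then has
nonnegative real part. As the real residues are nonnegative too and everything sums to zero, all of
them vanish, and `g = O(lam⁻²)` is excluded by the local argument at infinity unless `g = 0`. -/
theorem polePart_sum_eq_zero {Q : Finset ℂ} {M : ℕ} {Γ : ℂ → ℕ → ℂ} {f : ℂ → ℂ}
    (hf : ∀ z, f z = ∑ a ∈ Q, polePart M a (Γ a) z) (h0 : ∑ a ∈ Q, Γ a 0 = 0)
    (hlow : ∀ a ∈ Q, a.im ≤ 0)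
    (hres : ∀ c : ℝ, (c : ℂ) ∈ Q → ∃ r : ℝ, 0 ≤ r ∧
      Tendsto (fun t : ℝ => (t : ℂ) * f (c + t)) (𝓝[≠] 0) (𝓝 r))
    (him : ∀ t : ℝ, (t : ℂ) ∉ Q → (f t).im ≤ 0) (t : ℝ) (ht : (t : ℂ) ∉ Q) : f t = 0 := by
  classical
  rcases Nat.eq_zero_or_pos M with rfl | hM
  · simp [hf, polePart]
  have hnt : ∀ {a : ℂ}, a.im = 0 → ((a.re : ℝ) : ℂ) = a := fun h => Complex.ext rfl (by simp [h])
  -- the poles on the real axis are simple with nonnegative residues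
  have hreal : ∀ a ∈ Q, a.im = 0 → (∀ i, 1 ≤ i → i < M → Γ a i = 0) ∧
      0 ≤ (Γ a 0).re ∧ (Γ a 0).im = 0 := by
    intro a ha ha0
    obtain ⟨r, hr, hlim⟩ := hres a.re (by rwa [hnt ha0])
    rw [hnt ha0] at hlim
    have hother : Tendsto (fun t : ℝ => (t : ℂ) * ∑ b ∈ Q.erase a, polePart M b (Γ b) (a + t))
        (𝓝[≠] 0) (𝓝 0) := by
      have hc : ContinuousAt (fun t : ℝ => (t : ℂ) * ∑ b ∈ Q.erase a,
          polePart M b (Γ b) (a + t)) 0 := by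
        refine ContinuousAt.mul (by fun_prop) ?_
        exact tendsto_finsetSum _ fun b hb =>
          continuousAt_polePart M (Γ b) (Finset.ne_of_mem_erase hb)
      have := hc.tendsto
      simp only [Complex.ofReal_zero, zero_mul] at this
      exact this.mono_left nhdsWithin_le_nhds
    obtain ⟨M', rfl⟩ : ∃ M', M = M' + 1 := ⟨M - 1, by omega⟩
    have hmain : Tendsto (fun t : ℝ => ∑ i ∈ Finset.range M', ((t : ℂ) ^ (i + 1))⁻¹ • Γ a (i + 1))
        (𝓝[≠] 0) (𝓝 (r - 0 - Γ a 0)) := by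
      refine ((hlim.sub hother).sub_const (Γ a 0)).congr' ?_
      filter_upwards [self_mem_nhdsWithin] with t ht
      have ht : (t : ℂ) ≠ 0 := by exact_mod_cast ht
      rw [hf, ← Finset.add_sum_erase Q _ ha, mul_add, add_sub_cancel_right, polePart,
        Finset.sum_range_succ', mul_add, Finset.mul_sum]
      have e0 : (t : ℂ) * ((a + t - a) ^ (0 + 1))⁻¹ • Γ a 0 = Γ a 0 := by
        rw [add_sub_cancel_left, zero_add, pow_one, smul_eq_mul, mul_inv_cancel_left₀ ht]
      rw [e0, add_sub_cancel_right]
      refine Finset.sum_congr rfl fun i _ => ?_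
      rw [add_sub_cancel_left, smul_eq_mul, smul_eq_mul, ← mul_assoc]
      congr 1
      rw [pow_succ _ (i + 1)]
      field_simp
    have hz := eq_zero_of_tendsto_sum_inv_pow _ _ _ hmain
    have hr0 : Γ a 0 = r := by
      have h0 : Tendsto (fun t : ℝ => ∑ i ∈ Finset.range M',
          ((t : ℂ) ^ (i + 1))⁻¹ • Γ a (i + 1)) (𝓝[≠] 0) (𝓝 0) := by
        refine tendsto_const_nhds.congr fun t => ?_
        rw [Finset.sum_eq_zero]
        intro i hi
        rw [hz i (Finset.mem_range.1 hi), smul_zero]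
      have := tendsto_nhds_unique hmain h0
      rw [sub_zero, sub_eq_zero] at this
      exact this.symm
    refine ⟨fun i hi hiM => ?_, by simpa [hr0] using hr, by simp [hr0]⟩
    obtain ⟨i, rfl⟩ : ∃ i', i = i' + 1 := ⟨i - 1, by omega⟩
    exact hz i (by omega)
  set Q' := Q.filter fun a => a.im ≠ 0 with hQ'
  set g : ℂ → ℂ := fun z => ∑ a ∈ Q', polePart M a (Γ a) z with hg
  have hfg : ∀ z, f z = g z + ∑ a ∈ Q.filter (fun a => a.im = 0), (z - a)⁻¹ * Γ a 0 := by
    intro z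
    rw [hf, ← Finset.sum_filter_add_sum_filter_not Q (fun a => a.im ≠ 0)]
    congr 1
    simp only [not_not]
    refine Finset.sum_congr rfl fun a ha => ?_
    rw [Finset.mem_filter] at ha
    rw [polePart, Finset.sum_eq_single_of_mem 0 (Finset.mem_range.2 hM)]
    · simp
    · intro i hi hi0
      rw [(hreal a ha.1 ha.2).1 i (by omega) (Finset.mem_range.1 hi), smul_zero]
  have hneg : ∀ a ∈ Q', a.im < 0 := fun a ha => by
    rw [hQ', Finset.mem_filter] at ha
    exact lt_of_le_of_ne (hlow a ha.1) ha.2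
  have hdiff : ∀ z : ℂ, (∀ a ∈ Q', a.im < z.im) → DifferentiableAt ℂ g z := by
    intro z hz
    refine DifferentiableAt.fun_sum fun a ha => DifferentiableAt.fun_sum fun i _ => ?_
    refine DifferentiableAt.smul_const (DifferentiableAt.inv (by fun_prop) ?_) _
    refine pow_ne_zero _ (sub_ne_zero.2 ?_)
    rintro rfl
    exact lt_irrefl _ (hz _ ha)
  have hd : ∀ z : ℂ, 0 ≤ z.im → DifferentiableAt ℂ g z := fun z hz =>
    hdiff z fun a ha => (hneg a ha).trans_le hz
  have hb : ∃ C, ∀ z : ℂ, 0 ≤ z.im → ‖g z‖ ≤ C := by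
    refine ⟨∑ a ∈ Q', ∑ i ∈ Finset.range M, (|a.im| ^ (i + 1))⁻¹ * ‖Γ a i‖, fun z hz => ?_⟩
    refine norm_sum_le_of_le _ fun a ha => norm_sum_le_of_le _ fun i _ => ?_
    rw [norm_smul, norm_inv, norm_pow]
    have h1 : |a.im| ≤ ‖z - a‖ := by
      refine le_trans ?_ (Complex.abs_im_le_norm _)
      rw [Complex.sub_im, abs_of_neg (hneg a ha)]
      exact le_trans (by linarith) (le_abs_self _)
    have h2 : 0 < |a.im| := abs_pos.2 (hneg a ha).ne
    gcongr
  have hgr : ∀ t : ℝ, (g t).im ≤ 0 := by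
    have h1 : ∀ t : ℝ, (t : ℂ) ∉ Q → (g t).im ≤ 0 := by
      intro t ht
      have := him t ht
      rw [hfg, Complex.add_im, Complex.im_sum (Q.filter fun a => a.im = 0), Finset.sum_eq_zero,
        add_zero] at this
      · exact this
      · intro a ha
        rw [Finset.mem_filter] at ha
        rw [Complex.mul_im, Complex.inv_im, (hreal a ha.1 ha.2).2.2]
        simp [ha.2]
    intro t
    -- The bound extends by continuity to real points of `Q`, where `g` itself is regular.
    have hc : Tendsto (fun s : ℝ => (g s).im) (𝓝[≠] t) (𝓝 (g t).im) := by
      have : ContinuousAt (fun s : ℝ => (g s).im) t :=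
        Complex.continuous_im.continuousAt.comp
          (ContinuousAt.comp (f := fun s : ℝ => (s : ℂ)) (hd t (by simp)).continuousAt
            Complex.continuous_ofReal.continuousAt)
      exact this.tendsto.mono_left nhdsWithin_le_nhds
    refine le_of_tendsto hc ?_
    have hfin : (((↑) : ℝ → ℂ) ⁻¹' (Q : Set ℂ)).Finite :=
      Set.Finite.preimage Complex.ofReal_injective.injOn Q.finite_toSet
    have : ∀ᶠ s in 𝓝[≠] t, s ∉ (((↑) : ℝ → ℂ) ⁻¹' (Q : Set ℂ)) \ {t} :=
      nhdsWithin_le_nhds ((hfin.subset sdiff_subset).isClosed.isOpen_compl.mem_nhds (by simp))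
    filter_upwards [this, self_mem_nhdsWithin] with s hs hst
    exact h1 s fun h => hs ⟨h, hst⟩
  have hup : ∀ z : ℂ, 0 ≤ z.im → (g z).im ≤ 0 := fun z hz =>
    im_nonpos_of_im_nonpos_on_real g hd hb hgr hz
  -- The coordinate `ζ = lam⁻¹` at infinity, with `g = ζ G(ζ)`; `G 0` is the sum of the residues at
  -- the nonreal poles.
  set G : ℂ → ℂ := fun ζ => ∑ a ∈ Q', ∑ i ∈ Finset.range M,
    ζ ^ i * ((1 - a * ζ) ^ (i + 1))⁻¹ * Γ a i with hGdef
  have hgG : ∀ ζ : ℂ, ζ ≠ 0 → g ζ⁻¹ = ζ * G ζ := fun ζ hζ => by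
    simp only [hg, hGdef, Finset.mul_sum (s := Q')]
    exact Finset.sum_congr rfl fun a _ => polePart_inv M a (Γ a) hζ
  have hGan : AnalyticAt ℂ G 0 := by
    refine Finset.analyticAt_fun_sum _ fun a _ => Finset.analyticAt_fun_sum _ fun i _ => ?_
    refine AnalyticAt.mul (AnalyticAt.mul (by fun_prop) (AnalyticAt.inv (by fun_prop) (by simp)))
      (by fun_prop)
  have hG0 : G 0 = ∑ a ∈ Q', Γ a 0 := by
    refine Finset.sum_congr rfl fun a _ => ?_
    rw [Finset.sum_eq_single_of_mem 0 (Finset.mem_range.2 hM)]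
    · simp
    · intro i _ hi; simp [hi]
  have hGim : ∀ ζ : ℂ, ζ.im ≤ 0 → (ζ * G ζ).im ≤ 0 := by
    intro ζ hζ
    rcases eq_or_ne ζ 0 with rfl | h
    · simp
    · rw [← hgG ζ h]
      refine hup _ ?_
      rw [Complex.inv_im]
      exact div_nonneg (by linarith) (Complex.normSq_nonneg _)
  -- On the ray `ζ = -iτ`, where `lam = i/τ` lies in the upper half-plane, `Im (ζ G(ζ)) = -τ Re
  -- G(ζ)`.
  have hGre : 0 ≤ (G 0).re := by
    have hlim : Tendsto (fun τ : ℝ => (G (τ * -Complex.I)).re) (𝓝[>] 0) (𝓝 (G 0).re) := by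
      have h1 : Tendsto (fun τ : ℝ => (τ : ℂ) * -Complex.I) (𝓝[>] 0) (𝓝 0) := by
        have : Continuous fun τ : ℝ => (τ : ℂ) * -Complex.I := by fun_prop
        exact (this.tendsto' 0 0 (by simp)).mono_left nhdsWithin_le_nhds
      exact (Complex.continuous_re.tendsto _).comp (hGan.continuousAt.tendsto.comp h1)
    refine ge_of_tendsto hlim ?_
    filter_upwards [self_mem_nhdsWithin] with τ hτ
    have hτ : (0 : ℝ) < τ := hτ
    have := hGim (τ * -Complex.I) (by simpa using hτ.le)
    rw [mul_assoc, Complex.im_ofReal_mul, neg_mul, Complex.neg_im, Complex.I_mul_im] at this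
    exact nonneg_of_mul_nonneg_right (by linarith) hτ
  have hsplit : ∑ a ∈ Q', Γ a 0 + ∑ a ∈ Q.filter (fun a => a.im = 0), Γ a 0 = 0 := by
    rw [← h0, ← Finset.sum_filter_add_sum_filter_not Q (fun a => a.im ≠ 0)]
    simp only [not_not, hQ']
  have hrzero : ∀ a ∈ Q.filter (fun a => a.im = 0), Γ a 0 = 0 := by
    have h1 : ∑ a ∈ Q.filter (fun a => a.im = 0), (Γ a 0).re = 0 := by
      have := congrArg Complex.re hsplit
      rw [Complex.add_re, ← hG0, Complex.re_sum (Q.filter fun a => a.im = 0), Complex.zero_re] at this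
      refine le_antisymm (by linarith) (Finset.sum_nonneg fun a ha => ?_)
      rw [Finset.mem_filter] at ha
      exact (hreal a ha.1 ha.2).2.1
    rw [Finset.sum_eq_zero_iff_of_nonneg] at h1
    · intro a ha
      have h2 := h1 a ha
      rw [Finset.mem_filter] at ha
      exact Complex.ext h2 (hreal a ha.1 ha.2).2.2
    · intro a ha
      rw [Finset.mem_filter] at ha
      exact (hreal a ha.1 ha.2).2.1
  have hG00 : G 0 = 0 := by
    rw [hG0]
    rwa [Finset.sum_eq_zero hrzero, add_zero] at hsplit
  have hGz := eventually_zero_of_im_nonpos G hGan hG00 (Eventually.of_forall hGim)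
  have hgt : g t = 0 := by
    -- A convex domain above all nonreal poles that contains the real axis; vanishing near one point
    -- `i/τ` propagates to `t`.
    set U : Set ℂ := {z | ∀ a ∈ Q', a.im < z.im} with hU
    have hUc : Convex ℝ U := by
      have : U = ⋂ a ∈ Q', {z : ℂ | a.im < z.im} := by ext; simp [hU]
      rw [this]
      exact convex_iInter₂ fun a _ => convex_halfSpace_im_gt _
    have hUo : IsOpen U := by
      have : U = ⋂ a ∈ Q', {z : ℂ | a.im < z.im} := by ext; simp [hU]
      rw [this]
      exact isOpen_biInter_finset fun a _ => isOpen_lt continuous_const Complex.continuous_im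
    have han : AnalyticOnNhd ℂ g U :=
      DifferentiableOn.analyticOnNhd (fun z hz => (hdiff z hz).differentiableWithinAt) hUo
    have hlim : Tendsto (fun τ : ℝ => (τ : ℂ) * -Complex.I) (𝓝[>] 0) (𝓝 0) := by
      have : Continuous fun τ : ℝ => (τ : ℂ) * -Complex.I := by fun_prop
      exact (this.tendsto' 0 0 (by simp)).mono_left nhdsWithin_le_nhds
    obtain ⟨τ, hτ1, hτ⟩ := ((hlim.eventually hGz.eventually_nhds).and self_mem_nhdsWithin).exists
    have hτ : (0 : ℝ) < τ := hτ
    have hζ0 : (τ : ℂ) * -Complex.I ≠ 0 := by simp [hτ.ne']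
    have hmem : ((τ : ℂ) * -Complex.I)⁻¹ ∈ U := by
      intro a ha
      refine (hneg a ha).trans_le ?_
      rw [Complex.inv_im]
      exact div_nonneg (by simp [hτ.le]) (Complex.normSq_nonneg _)
    refine han.eqOn_zero_of_preconnected_of_eventuallyEq_zero hUc.isPreconnected hmem ?_
      (fun a ha => by simpa using hneg a ha)
    have h1 : Tendsto (fun z : ℂ => z⁻¹) (𝓝 ((τ : ℂ) * -Complex.I)⁻¹)
        (𝓝 ((τ : ℂ) * -Complex.I)) := by
      have := (continuousAt_inv₀ (inv_ne_zero hζ0)).tendsto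
      rwa [inv_inv] at this
    filter_upwards [h1.eventually hτ1, (isOpen_compl_singleton.mem_nhds
      (inv_ne_zero hζ0) : ({0}ᶜ : Set ℂ) ∈ _)] with z hz hz0
    have := hgG z⁻¹ (inv_ne_zero hz0)
    rw [inv_inv, hz, mul_zero] at this
    exact this
  rw [hfg, hgt, zero_add]
  exact Finset.sum_eq_zero fun a ha => by rw [hrzero a ha, mul_zero]

/-- The two-sided version: `s = 1` for poles in the closed lower half-plane, `s = -1` for poles in
the closed upper half-plane. -/
theorem polePart_sum_eq_zero_of_sign {s : ℝ} (hs : s = 1 ∨ s = -1) {Q : Finset ℂ} {M : ℕ}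
    {Γ : ℂ → ℕ → ℂ} {f : ℂ → ℂ}
    (hf : ∀ z, f z = ∑ a ∈ Q, polePart M a (Γ a) z) (h0 : ∑ a ∈ Q, Γ a 0 = 0)
    (hlow : ∀ a ∈ Q, s * a.im ≤ 0)
    (hres : ∀ c : ℝ, (c : ℂ) ∈ Q → ∃ r : ℝ, 0 ≤ s * r ∧
      Tendsto (fun t : ℝ => (t : ℂ) * f (c + t)) (𝓝[≠] 0) (𝓝 r))
    (him : ∀ t : ℝ, (t : ℂ) ∉ Q → (f t).im ≤ 0) (t : ℝ) (ht : (t : ℂ) ∉ Q) : f t = 0 := by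
  classical
  rcases hs with rfl | rfl
  · exact polePart_sum_eq_zero hf h0 (by simpa using hlow) (by simpa using hres) him t ht
  -- The substitution `lam ↦ -lam` exchanges the half-planes and negates the residues, but keeps the
  -- sign of `Im f` on the axis.
  · have key := polePart_sum_eq_zero (Q := Q.image fun a => -a) (M := M)
      (Γ := fun a i => (-1) ^ (i + 1) * Γ (-a) i) (f := fun z => f (-z)) ?_ ?_ ?_ ?_ ?_ (-t) ?_
    · simpa using key
    · intro z
      rw [hf, Finset.sum_image (fun a _ b _ h => neg_injective h)]
      refine Finset.sum_congr rfl fun a _ => Finset.sum_congr rfl fun i _ => ?_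
      simp only [neg_neg, smul_eq_mul]
      have : -z - a = -1 * (z - -a) := by ring
      rw [this, mul_pow, mul_inv, ← mul_assoc, mul_comm (((z - -a) ^ (i + 1))⁻¹)]
      congr 2
      rw [← inv_pow]; norm_num
    · rw [Finset.sum_image (fun a _ b _ h => neg_injective h)]
      simp [h0]
    · intro a ha
      obtain ⟨b, hb, rfl⟩ := Finset.mem_image.1 ha
      have := hlow b hb
      simp; linarith
    · intro c hc
      obtain ⟨b, hb, hbc⟩ := Finset.mem_image.1 hc
      have hb' : ((-c : ℝ) : ℂ) ∈ Q := by
        rw [Complex.ofReal_neg, ← hbc, neg_neg]; exact hb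
      obtain ⟨r, hr, hlim⟩ := hres _ hb'
      refine ⟨-r, by linarith, ?_⟩
      have hn : Tendsto (fun t : ℝ => -t) (𝓝[≠] 0) (𝓝[≠] 0) := by
        refine tendsto_nhdsWithin_iff.2 ⟨?_, ?_⟩
        · exact (continuous_neg.tendsto' (0 : ℝ) 0 (by simp)).mono_left nhdsWithin_le_nhds
        · filter_upwards [self_mem_nhdsWithin] with t ht
          simpa using ht
      have := (hlim.comp hn).neg
      rw [Complex.ofReal_neg]
      refine this.congr fun t => ?_
      simp only [Function.comp_apply, Complex.ofReal_neg]
      rw [← neg_add, neg_mul, neg_neg]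
    · intro t ht
      have := him (-t) fun h => ht (Finset.mem_image.2 ⟨_, h, by simp⟩)
      simpa using this
    · intro h
      obtain ⟨b, hb, hbc⟩ := Finset.mem_image.1 h
      apply ht
      have : b = t := by rw [← neg_inj, hbc]; simp
      rwa [← this]

end

/-! ### The companion operator: its root subspaces as spaces of pole parts. -/

section Companion

variable {H : Type*} [NormedAddCommGroup H] [InnerProductSpace ℂ H] {n : ℕ}

/-- The companion operator of the pencil. -/
def companion (A : Fin (n + 1) → H →L[ℂ] H) : Module.End ℂ (Fin n → H) :=
  LinearMap.pi fun j => if h : (j : ℕ) + 1 < n then LinearMap.proj ⟨j + 1, h⟩ else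
    -((Ring.inverse (A (Fin.last n)) : H →L[ℂ] H).toLinearMap ∘ₗ
      ∑ i : Fin n, (A i.castSucc).toLinearMap ∘ₗ LinearMap.proj i)

lemma companion_apply_of_lt (A : Fin (n + 1) → H →L[ℂ] H) (x : Fin n → H) {j : Fin n}
    (h : (j : ℕ) + 1 < n) : companion A x j = x ⟨j + 1, h⟩ := by
  simp [companion, h]

lemma companion_apply_of_not_lt (A : Fin (n + 1) → H →L[ℂ] H) (x : Fin n → H) {j : Fin n}
    (h : ¬ (j : ℕ) + 1 < n) : companion A x j
      = -Ring.inverse (A (Fin.last n)) (∑ i : Fin n, A i.castSucc (x i)) := by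
  simp [companion, h]

variable [NeZero n]

lemma companion_pow_apply (A : Fin (n + 1) → H →L[ℂ] H) (x : Fin n → H) (j : ℕ) (h : j < n) :
    ((companion A ^ j) x) 0 = x ⟨j, h⟩ := by
  induction j generalizing x with
  | zero => rfl
  | succ j ih =>
    rw [pow_succ, Module.End.mul_apply, ih _ (by omega), companion_apply_of_lt]

omit [NeZero n] in
lemma companion_eq_of {A : Fin (n + 1) → H →L[ℂ] H} (hA : IsUnit (A (Fin.last n)))
    {x y : Fin n → H} (h1 : ∀ (j : Fin n) (h : (j : ℕ) + 1 < n), y j = x ⟨j + 1, h⟩)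
    {j₀ : Fin n} (hj₀ : (j₀ : ℕ) + 1 = n)
    (h2 : ∑ i : Fin n, A i.castSucc (x i) + A (Fin.last n) (y j₀) = 0) : companion A x = y := by
  ext j
  by_cases h : (j : ℕ) + 1 < n
  · rw [companion_apply_of_lt A x h, h1 j h]
  · have hj : j = j₀ := Fin.ext (by omega)
    rw [companion_apply_of_not_lt A x h, hj, eq_neg_of_add_eq_zero_left h2, map_neg, neg_neg,
      ← mul_apply_eq_comp, Ring.inverse_mul_cancel _ hA]
    rfl

lemma sum_companion_pow {A : Fin (n + 1) → H →L[ℂ] H} (hA : IsUnit (A (Fin.last n)))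
    (x : Fin n → H) : ∑ j : Fin (n + 1), A j (((companion A ^ (j : ℕ)) x) 0) = 0 := by
  have hn : n - 1 < n := Nat.sub_lt (NeZero.pos n) one_pos
  rw [Fin.sum_univ_castSucc]
  have h1 : ∀ i : Fin n, ((companion A ^ ((i.castSucc : Fin (n + 1)) : ℕ)) x) 0 = x i := fun i =>
    companion_pow_apply A x i i.2
  have h2 : ((companion A ^ ((Fin.last n : Fin (n + 1)) : ℕ)) x) 0
      = companion A x ⟨n - 1, hn⟩ := by
    have : ((Fin.last n : Fin (n + 1)) : ℕ) = (n - 1) + 1 := by simp; omega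
    rw [this, pow_succ, Module.End.mul_apply, companion_pow_apply A _ _ hn]
  simp only [h1]
  rw [h2, companion_apply_of_not_lt A x (by simp; omega), map_neg,
    ← mul_apply_eq_comp, Ring.mul_inverse_cancel _ hA]
  simp

/-- On the data of annihilated pole parts the companion operator is multiplication by the spectral
parameter; the last row is the simple-pole coefficient of `poleAct A μ π = 0`. -/
lemma companion_poleData {A : Fin (n + 1) → H →L[ℂ] H} (hA : IsUnit (A (Fin.last n))) {μ : ℂ}
    {π : ℕ → H} (h : poleAct A μ π = 0) :
    companion A (poleData n μ π) = poleData n μ (poleMul H μ π) := by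
  have hn : n - 1 < n := Nat.sub_lt (NeZero.pos n) one_pos
  refine companion_eq_of hA (fun j hj => ?_) (j₀ := ⟨n - 1, hn⟩) (by simp; omega) ?_
  · simp only [poleData_apply]
    rw [pow_succ, Module.End.mul_apply]
  · have h0 := congrFun h 0
    rw [poleAct, Fin.sum_univ_castSucc] at h0
    simp only [poleData_apply]
    rw [← Module.End.mul_apply, ← pow_succ]
    have : n - 1 + 1 = n := by omega
    simpa [this] using h0

lemma companion_sub_pow_poleData {A : Fin (n + 1) → H →L[ℂ] H} (hA : IsUnit (A (Fin.last n)))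
    {μ : ℂ} {π : ℕ → H} (h : poleAct A μ π = 0) (i : ℕ) :
    ((companion A - algebraMap ℂ _ μ) ^ i) (poleData n μ π)
      = poleData n μ ((leftShift H ^ i) π) := by
  have hs : ∀ π : ℕ → H, leftShift H π = poleMul H μ π - μ • π := fun π => by ext; simp
  have hz : ∀ π : ℕ → H, poleAct A μ π = 0 → poleAct A μ (leftShift H π) = 0 := by
    intro π h
    ext i
    have := congrFun h (i + 1)
    rw [poleAct_eq A μ _ _ (Nat.lt_succ_self n)] at this ⊢
    simpa [add_right_comm] using this
  induction i generalizing π with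
  | zero => rfl
  | succ i ih =>
    rw [pow_succ, Module.End.mul_apply, pow_succ, Module.End.mul_apply, ← ih (hz π h)]
    congr 1
    rw [hs, map_sub, map_smul, ← companion_poleData hA h]
    rfl

/-- Recovers the pole part from its Cauchy data, and thereby shows that no information is lost in
passing to the data. -/
lemma companion_sub_pow_poleData_zero {A : Fin (n + 1) → H →L[ℂ] H}
    (hA : IsUnit (A (Fin.last n))) {μ : ℂ} {π : ℕ → H} (h : poleAct A μ π = 0) (i : ℕ) :
    ((companion A - algebraMap ℂ _ μ) ^ i) (poleData n μ π) 0 = π i := by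
  rw [companion_sub_pow_poleData hA h, poleData_apply]
  simp [leftShift_pow_apply]

lemma poleData_injOn {A : Fin (n + 1) → H →L[ℂ] H} (hA : IsUnit (A (Fin.last n))) {μ : ℂ}
    {π : ℕ → H} (h : poleAct A μ π = 0) (h0 : poleData n μ π = 0) : π = 0 := by
  ext i
  rw [← companion_sub_pow_poleData_zero hA h i, h0, map_zero]
  rfl

/-- The pole part at `μ` of a generalized eigenvector of the companion operator. -/
def eigenPole (A : Fin (n + 1) → H →L[ℂ] H) (μ : ℂ) (x : Fin n → H) (i : ℕ) : H :=
  ((companion A - algebraMap ℂ _ μ) ^ i) x 0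

lemma poleMul_pow_eigenPole (A : Fin (n + 1) → H →L[ℂ] H) (μ : ℂ) (x : Fin n → H) (j i : ℕ) :
    (poleMul H μ ^ j) (eigenPole A μ x) i
      = ((companion A ^ j) (((companion A - algebraMap ℂ _ μ) ^ i) x)) 0 := by
  induction j generalizing x i with
  | zero => rfl
  | succ j ih =>
    have : poleMul H μ (eigenPole A μ x) = eigenPole A μ (companion A x) := by
      ext i
      have hc : Commute (companion A) ((companion A - algebraMap ℂ _ μ) ^ i) :=
        ((Commute.refl _).sub_right (Algebra.commutes μ (companion A)).symm).pow_right i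
      simp only [poleMul_apply, eigenPole]
      rw [← Module.End.mul_apply _ (companion A), ← hc.eq, pow_succ', Module.End.mul_apply,
        Module.End.mul_apply, LinearMap.sub_apply, Module.algebraMap_end_apply]
      simp
    rw [pow_succ, Module.End.mul_apply, this, ih, pow_succ, Module.End.mul_apply]
    have hc : Commute (companion A) ((companion A - algebraMap ℂ _ μ) ^ i) :=
      ((Commute.refl _).sub_right (Algebra.commutes μ (companion A)).symm).pow_right i
    rw [← Module.End.mul_apply (companion A), hc.eq, Module.End.mul_apply]

lemma poleAct_eigenPole {A : Fin (n + 1) → H →L[ℂ] H} (hA : IsUnit (A (Fin.last n))) (μ : ℂ)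
    (x : Fin n → H) : poleAct A μ (eigenPole A μ x) = 0 := by
  ext i
  simp only [poleAct, poleMul_pow_eigenPole]
  exact sum_companion_pow hA _

/-- Together with `poleAct_eigenPole` and `poleData_injOn` this identifies root vectors with
annihilated pole parts. -/
lemma poleData_eigenPole (A : Fin (n + 1) → H →L[ℂ] H) (μ : ℂ) (x : Fin n → H) :
    poleData n μ (eigenPole A μ x) = x := by
  ext j
  rw [poleData_apply, poleMul_pow_eigenPole, pow_zero, Module.End.one_apply,
    companion_pow_apply A x j j.2]

lemma eigenPole_vanishFrom [FiniteDimensional ℂ H] {A : Fin (n + 1) → H →L[ℂ] H} {μ : ℂ}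
    {x : Fin n → H} (hx : x ∈ (companion A).maxGenEigenspace μ) :
    VanishFrom (Module.finrank ℂ (Fin n → H)) (eigenPole A μ x) := by
  intro i hi
  rw [Module.End.maxGenEigenspace_eq_genEigenspace_finrank, Module.End.mem_genEigenspace_nat] at hx
  obtain ⟨d, rfl⟩ := Nat.exists_eq_add_of_le hi
  rw [eigenPole, add_comm, pow_add, Module.End.mul_apply]
  have h0 : ((companion A - algebraMap ℂ _ μ) ^ Module.finrank ℂ (Fin n → H)) x = 0 := hx
  rw [h0, map_zero]
  rfl

lemma poleData_mem_maxGenEigenspace {A : Fin (n + 1) → H →L[ℂ] H} (hA : IsUnit (A (Fin.last n)))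
    {μ : ℂ} {π : ℕ → H} (h : poleAct A μ π = 0) {M : ℕ} (hM : VanishFrom M π) :
    poleData n μ π ∈ (companion A).maxGenEigenspace μ := by
  rw [Module.End.mem_maxGenEigenspace]
  refine ⟨M, ?_⟩
  have := companion_sub_pow_poleData hA h M
  have h0 : (leftShift H ^ M) π = 0 := by
    ext i; rw [leftShift_pow_apply, hM _ (by omega)]; rfl
  rw [h0, map_zero] at this
  exact this

/-- The length of a chain is bounded. -/
lemma lt_finrank_of_seqAct [FiniteDimensional ℂ H] {A : Fin (n + 1) → H →L[ℂ] H}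
    (hA : IsUnit (A (Fin.last n))) {μ : ℂ} {y : ℕ → H} (hy0 : y 0 ≠ 0) {p : ℕ}
    (hy : ∀ s ≤ p, seqAct A μ y s = 0) : p < Module.finrank ℂ (Fin n → H) := by
  by_contra hp
  have hz := poleAct_revSeq hy
  have h1 := poleData_mem_maxGenEigenspace hA hz (revSeq_vanishFrom p y)
  -- The entry of index `p` of the reversed chain is `y 0`.
  have h2 := eigenPole_vanishFrom h1 p (by omega)
  rw [eigenPole, companion_sub_pow_poleData_zero hA hz, revSeq, if_pos le_rfl, Nat.sub_self] at h2
  exact hy0 h2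

end Companion

/-! ### Elementary solutions and their derivatives. -/

section Flow

variable {H : Type*} [NormedAddCommGroup H] [InnerProductSpace ℂ H] {n : ℕ}

/-- The elementary function `e^{iμz} ∑_{i < M} (iz)ⁱ/i! πᵢ`. -/
def elemSol (M : ℕ) (μ : ℂ) (π : ℕ → H) (z : ℝ) : H :=
  Complex.exp (Complex.I * μ * z) •
    ∑ i ∈ Finset.range M, ((Complex.I * z) ^ i / (i.factorial : ℂ)) • π i

lemma elementarySolution_eq (μ : ℂ) (y : ℕ → H) (h : ℕ) :
    elementarySolution μ y h = elemSol (h + 1) μ (revSeq h y) := by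
  ext z
  rw [elementarySolution, elemSol]
  congr 1
  refine Finset.sum_congr rfl fun r hr => ?_
  rw [revSeq, if_pos (Nat.lt_succ_iff.1 (Finset.mem_range.1 hr))]

lemma elemSol_zero {M : ℕ} (hM : 0 < M) (μ : ℂ) (π : ℕ → H) : elemSol M μ π 0 = π 0 := by
  rw [elemSol, Finset.sum_eq_single_of_mem 0 (Finset.mem_range.2 hM)]
  · simp
  · intro i _ hi; simp [hi]

/-- Under the correspondence of pole parts with functions of `z`, differentiation is `i` times
multiplication by the spectral parameter. -/
lemma hasDerivAt_elemSol {M : ℕ} {μ : ℂ} {π : ℕ → H} (hπ : VanishFrom M π) (z : ℝ) :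
    HasDerivAt (elemSol M μ π) (Complex.I • elemSol M μ (poleMul H μ π) z) z := by
  have h1 : HasDerivAt (fun z : ℝ => Complex.exp (Complex.I * μ * z))
      (Complex.exp (Complex.I * μ * z) * (Complex.I * μ)) z := by
    have : HasDerivAt (fun w : ℂ => Complex.exp (Complex.I * μ * w))
        (Complex.exp (Complex.I * μ * z) * (Complex.I * μ * 1)) (z : ℂ) :=
      ((hasDerivAt_id (z : ℂ)).const_mul _).cexp
    simpa using this.comp_ofReal
  have h2 : ∀ i : ℕ, HasDerivAt (fun z : ℝ => ((Complex.I * z) ^ i / (i.factorial : ℂ)) • π i)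
      (((i : ℂ) * (Complex.I * z) ^ (i - 1) * Complex.I / (i.factorial : ℂ)) • π i) z := by
    intro i
    have : HasDerivAt (fun w : ℂ => (Complex.I * w) ^ i / (i.factorial : ℂ))
        ((i : ℂ) * (Complex.I * z) ^ (i - 1) * (Complex.I * 1) / (i.factorial : ℂ)) (z : ℂ) :=
      (((hasDerivAt_id (z : ℂ)).const_mul _).pow i).div_const _
    rw [mul_one] at this
    exact this.comp_ofReal.smul_const (π i)
  have h3 := h1.smul (HasDerivAt.fun_sum (u := Finset.range M) fun i _ => h2 i)
  convert! h3 using 1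
  have e : ∑ i ∈ Finset.range M,
        ((i : ℂ) * (Complex.I * z) ^ (i - 1) * Complex.I / (i.factorial : ℂ)) • π i
      = Complex.I • ∑ i ∈ Finset.range M,
        ((Complex.I * z) ^ i / (i.factorial : ℂ)) • π (i + 1) := by
    have e1 := Finset.sum_range_succ' (fun i : ℕ =>
      ((i : ℂ) * (Complex.I * z) ^ (i - 1) * Complex.I / (i.factorial : ℂ)) • π i) M
    rw [Finset.sum_range_succ, hπ M le_rfl, smul_zero, add_zero] at e1
    rw [e1, Finset.smul_sum]
    simp only [Nat.cast_zero, zero_mul, zero_div, zero_smul, add_zero]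
    refine Finset.sum_congr rfl fun i _ => ?_
    rw [smul_smul, Nat.add_sub_cancel, Nat.factorial_succ]
    congr 1
    have h1 : ((i + 1 : ℕ) : ℂ) ≠ 0 := by exact_mod_cast Nat.succ_ne_zero i
    have h2 : (i.factorial : ℂ) ≠ 0 := by exact_mod_cast i.factorial_ne_zero
    push_cast at h1 ⊢
    field_simp
  rw [e]
  simp only [elemSol, poleMul_apply, smul_add, Finset.sum_add_distrib, Finset.smul_sum, smul_smul]
  rw [add_comm]
  congr 1 <;> refine Finset.sum_congr rfl fun i _ => ?_ <;> congr 1 <;> ring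

lemma tendsto_elemSol {M : ℕ} {μ : ℂ} (hμ : 0 < μ.im) (π : ℕ → H) :
    Tendsto (elemSol M μ π) atTop (𝓝 0) := by
  have h : ∀ i : ℕ, Tendsto (fun z : ℝ => (Complex.exp (Complex.I * μ * z) *
      ((Complex.I * z) ^ i / (i.factorial : ℂ))) • π i) atTop (𝓝 ((0 : ℂ) • π i)) := by
    intro i
    refine Tendsto.smul_const ?_ _
    rw [tendsto_zero_iff_norm_tendsto_zero]
    have h1 := (Real.tendsto_pow_mul_exp_neg_atTop_nhds_zero i).comp
      (tendsto_id.const_mul_atTop hμ)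
    have h2 := h1.const_mul ((μ.im ^ i)⁻¹ * (i.factorial : ℝ)⁻¹)
    rw [mul_zero] at h2
    refine h2.congr' ?_
    filter_upwards [eventually_ge_atTop 0] with z hz
    simp only [Function.comp_apply, id_eq]
    rw [norm_mul, norm_div, norm_pow, norm_mul, Complex.norm_I, one_mul, Complex.norm_exp,
      Complex.norm_natCast, Complex.norm_real, Real.norm_of_nonneg hz]
    have : (Complex.I * μ * z).re = -(μ.im * z) := by simp
    rw [this, mul_pow]
    have := hμ.ne'
    field_simp
  have h2 := tendsto_finsetSum (Finset.range M) fun i _ => h i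
  simp only [zero_smul, Finset.sum_const_zero] at h2
  refine h2.congr fun z => ?_
  rw [elemSol, Finset.smul_sum]
  exact Finset.sum_congr rfl fun i _ => mul_smul _ _ _

lemma iteratedDeriv_elemSol {M : ℕ} {μ : ℂ} {π : ℕ → H} (hπ : VanishFrom M π) (r : ℕ) :
    iteratedDeriv r (elemSol M μ π) = fun z => Complex.I ^ r • elemSol M μ ((poleMul H μ ^ r) π) z := by
  induction r with
  | zero => simp
  | succ r ih =>
    rw [iteratedDeriv_succ, ih]
    ext z
    have := (hasDerivAt_elemSol (μ := μ) (hπ.poleMul_pow μ r) z).const_smul (Complex.I ^ r)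
    refine this.deriv.trans ?_
    rw [smul_smul, ← pow_succ, pow_succ' (poleMul H μ), Module.End.mul_apply]

/-- Turns derived vectors into Cauchy data of pole parts, so that the spectral arguments need no
derivatives. -/
lemma keldysh_eq (n : ℕ) (μ : ℂ) (y : ℕ → H) (h : ℕ) :
    keldysh n μ y h = poleData n μ (revSeq h y) := by
  ext r
  rw [keldysh, elementarySolution_eq, iteratedDeriv_elemSol (revSeq_vanishFrom h y)]
  beta_reduce
  rw [elemSol_zero (Nat.succ_pos h), smul_smul, ← mul_pow, neg_mul, Complex.I_mul_I, neg_neg,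
    one_pow, one_smul, poleData_apply]

end Flow

/-! ### Linear flows in finite dimension and their decaying orbits. -/

section Exponential

variable {V : Type*} [NormedAddCommGroup V] [NormedSpace ℂ V]

/-- The solution of `U' = i T U` with initial value `x`. -/
def opFlow (T : V →L[ℂ] V) (x : V) (z : ℝ) : V := NormedSpace.exp (z • (Complex.I • T)) x

lemma opFlow_zero (T : V →L[ℂ] V) (x : V) : opFlow T x 0 = x := by
  simp [opFlow]

lemma opFlow_add (T : V →L[ℂ] V) (x y : V) (z : ℝ) :
    opFlow T (x + y) z = opFlow T x z + opFlow T y z := by simp [opFlow]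

lemma opFlow_smul (T : V →L[ℂ] V) (a : ℂ) (x : V) (z : ℝ) :
    opFlow T (a • x) z = a • opFlow T x z := by simp [opFlow]

lemma opFlow_sub (T : V →L[ℂ] V) (x y : V) (z : ℝ) :
    opFlow T (x - y) z = opFlow T x z - opFlow T y z := by simp [opFlow]

lemma apply_opFlow [CompleteSpace V] (T : V →L[ℂ] V) (x : V) (z : ℝ) :
    T (opFlow T x z) = opFlow T (T x) z := by
  have hc : Commute T (z • (Complex.I • T)) :=
    ((Commute.refl T).smul_right Complex.I).smul_right z
  exact congrArg (fun S : V →L[ℂ] V => S x) hc.exp_right.eq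

lemma hasDerivAt_opFlow [CompleteSpace V] (T : V →L[ℂ] V) (x : V) (z : ℝ) :
    HasDerivAt (opFlow T x) (Complex.I • opFlow T (T x) z) z := by
  have h := hasDerivAt_exp_smul_const (𝕂 := ℝ) (Complex.I • T) z
  have h2 := ((ContinuousLinearMap.apply ℂ V x).restrictScalars ℝ).hasFDerivAt.comp_hasDerivAt z h
  convert! h2 using 1
  simp [opFlow]

lemma opFlow_unique [CompleteSpace V] {T : V →L[ℂ] V} {U : ℝ → V}
    (hU : ∀ z ∈ Ici (0 : ℝ), HasDerivWithinAt U (Complex.I • T (U z)) (Ici 0) z)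
    {z : ℝ} (hz : 0 ≤ z) : U z = opFlow T (U 0) z := by
  have := ODE_solution_unique (v := fun _ x => Complex.I • T x) (f := U)
    (g := opFlow T (U 0)) (a := 0) (b := z) (K := ‖Complex.I • T‖₊)
    (fun _ => (Complex.I • T).lipschitz)
    (fun s hs => ((hU s hs.1).mono Icc_subset_Ici_self).continuousWithinAt)
    (fun s hs => (hU s hs.1).mono (Ici_subset_Ici.2 hs.1))
    (fun s _ => (hasDerivAt_opFlow T _ s).continuousAt.continuousWithinAt)
    (fun s _ => by
      rw [apply_opFlow]
      exact (hasDerivAt_opFlow T _ s).hasDerivWithinAt)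
    (opFlow_zero T _).symm
  exact this ⟨hz, le_rfl⟩

/-- The initial values of the decaying solutions lie in the sum of the generalized eigenspaces of
the open upper half-plane. -/
lemma mem_iSup_of_tendsto_opFlow [FiniteDimensional ℂ V] {T : V →L[ℂ] V} {x : V}
    (hx : Tendsto (opFlow T x) atTop (𝓝 0)) :
    x ∈ ⨆ (μ : ℂ) (_ : 0 < μ.im), Module.End.maxGenEigenspace (T : Module.End ℂ V) μ := by
  have : CompleteSpace V := FiniteDimensional.complete ℂ V
  let Z : Submodule ℂ V :=
    { carrier := {x | Tendsto (opFlow T x) atTop (𝓝 0)}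
      zero_mem' := by
        have : opFlow T (0 : V) = fun _ => 0 := by ext z; simp [opFlow]
        simp [this]
      add_mem' := fun {a b} ha hb => by
        have : opFlow T (a + b) = fun z => opFlow T a z + opFlow T b z := by
          ext z; exact opFlow_add T a b z
        simpa [this] using Tendsto.add ha hb
      smul_mem' := fun c a ha => by
        have : opFlow T (c • a) = fun z => c • opFlow T a z := by
          ext z; exact opFlow_smul T c a z
        simpa [this] using Tendsto.const_smul ha c }
  have hmem : ∀ y, y ∈ Z ↔ Tendsto (opFlow T y) atTop (𝓝 0) := fun y => Iff.rfl
  set f : Module.End ℂ V := (T : Module.End ℂ V) with hf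
  have hinv : ∀ y ∈ Z, f y ∈ Z := fun y hy => by
    rw [hmem] at hy ⊢
    have h1 : opFlow T (f y) = fun z => T (opFlow T y z) := by
      ext z; exact (apply_opFlow T y z).symm
    rw [h1]
    have h2 := (T.continuous.tendsto 0).comp hy
    rwa [map_zero] at h2
  -- The decaying data form an invariant subspace, hence the sum of its intersections with the root
  -- subspaces. A nonzero intersection contains an eigenvector, whose orbit `e^{iμz} e` decays only
  -- if `Im μ > 0`.
  have hdec := Submodule.eq_iSup_inf_genEigenspace (f := f) (p := Z) ⊤ hinv
    (Module.End.iSup_maxGenEigenspace_eq_top f)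
  have hxZ : x ∈ Z := hx
  rw [hdec] at hxZ
  refine (iSup_le fun μ => ?_ : (⨆ μ, Z ⊓ f.genEigenspace μ ⊤) ≤ _) hxZ
  intro y hy
  rcases eq_or_ne y 0 with rfl | hy0
  · exact zero_mem _
  have hμ : 0 < μ.im := by
    obtain ⟨hyZ, hyg⟩ := hy
    obtain ⟨k, hk⟩ := (Module.End.mem_maxGenEigenspace f μ y).1 hyg
    set N := f - μ • (1 : Module.End ℂ V) with hN
    have hex : ∃ k, (N ^ k) y = 0 := ⟨k, hk⟩
    classical
    have hk0 : Nat.find hex ≠ 0 := fun h => hy0 (by have := Nat.find_spec hex; rwa [h] at this)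
    obtain ⟨m, hm⟩ := Nat.exists_eq_succ_of_ne_zero hk0
    -- The last nonzero power of the nilpotent part gives the eigenvector.
    set e := (N ^ m) y with he
    have he0 : e ≠ 0 := Nat.find_min hex (by omega)
    have hNe : f e = μ • e := by
      have h1 : N e = 0 := by
        have := Nat.find_spec hex
        rwa [hm, pow_succ', Module.End.mul_apply] at this
      rw [hN, LinearMap.sub_apply, sub_eq_zero] at h1
      simpa using h1
    have hNinv : ∀ j, (N ^ j) y ∈ Z := by
      intro j
      induction j with
      | zero => exact hyZ
      | succ j ih =>
        rw [pow_succ', Module.End.mul_apply, hN, LinearMap.sub_apply]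
        exact sub_mem (hinv _ ih) (Z.smul_mem _ ih)
    have heZ : Tendsto (opFlow T e) atTop (𝓝 0) := hNinv m
    have hsol : ∀ z : ℝ, 0 ≤ z → Complex.exp (Complex.I * μ * z) • e = opFlow T e z := by
      intro z hz
      have := opFlow_unique (T := T) (U := fun z : ℝ => Complex.exp (Complex.I * μ * z) • e)
        (fun s _ => by
          have h1 : HasDerivAt (fun w : ℂ => Complex.exp (Complex.I * μ * w))
              (Complex.exp (Complex.I * μ * s) * (Complex.I * μ * 1)) (s : ℂ) :=
            ((hasDerivAt_id (s : ℂ)).const_mul _).cexp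
          have h2 := (h1.comp_ofReal.smul_const e).hasDerivWithinAt (s := Ici 0)
          convert! h2 using 1
          have : T e = μ • e := hNe
          rw [map_smul, this, smul_smul, smul_smul]
          congr 1; ring) hz
      simpa using this
    by_contra hμ
    push Not at hμ
    have h1 := heZ.norm
    rw [norm_zero] at h1
    have h2 : ‖e‖ ≤ 0 := by
      refine ge_of_tendsto h1 ?_
      filter_upwards [eventually_ge_atTop 0] with z hz
      rw [← hsol z hz, norm_smul, Complex.norm_exp]
      refine le_mul_of_one_le_left (norm_nonneg _) (Real.one_le_exp ?_)
      have : (Complex.I * μ * z).re = -(μ.im * z) := by simp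
      rw [this]
      nlinarith
    exact he0 (norm_le_zero_iff.1 h2)
  exact Submodule.mem_iSup_of_mem μ (Submodule.mem_iSup_of_mem hμ hy.2)

end Exponential

/-! ### Solutions of the differential equation as companion flows. -/

section

variable {H : Type*} [NormedAddCommGroup H] [InnerProductSpace ℂ H] [FiniteDimensional ℂ H] {n : ℕ}

/-- The companion operator as a continuous operator. -/
def companionL (A : Fin (n + 1) → H →L[ℂ] H) : (Fin n → H) →L[ℂ] (Fin n → H) :=
  LinearMap.toContinuousLinearMap (companion A)

@[simp] lemma companionL_apply (A : Fin (n + 1) → H →L[ℂ] H) (x : Fin n → H) :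
    companionL A x = companion A x := rfl

@[simp] lemma coe_companionL (A : Fin (n + 1) → H →L[ℂ] H) :
    (companionL A : Module.End ℂ (Fin n → H)) = companion A := rfl

lemma isUnit_of_ker_eq_bot {T : H →L[ℂ] H} (h : T.ker = ⊥) : IsUnit T := by
  rw [ContinuousLinearMap.isUnit_iff_bijective]
  have hi : Function.Injective T := LinearMap.ker_eq_bot.1 h
  exact ⟨hi, LinearMap.surjective_of_injective (f := (T : H →ₗ[ℂ] H)) hi⟩

variable [NeZero n]

omit [NeZero n] in
lemma opFlow_poleData {A : Fin (n + 1) → H →L[ℂ] H} (hA : IsUnit (A (Fin.last n)))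
    {μ : ℂ} {M : ℕ} {π : ℕ → H} (hM : VanishFrom M π) (hMpos : 0 < M) (hπ : poleAct A μ π = 0)
    {z : ℝ} (hz : 0 ≤ z) (j : Fin n) :
    opFlow (companionL A) (poleData n μ π) z j = elemSol M μ ((poleMul H μ ^ (j : ℕ)) π) z := by
  have hn : n - 1 < n := Nat.sub_lt (Nat.lt_of_le_of_lt (Nat.zero_le _) j.2) one_pos
  have key := opFlow_unique (T := companionL A)
    (U := fun z (j : Fin n) => elemSol M μ ((poleMul H μ ^ (j : ℕ)) π) z) (fun s _ => ?_) hz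
  · have h0 : (fun j : Fin n => elemSol M μ ((poleMul H μ ^ (j : ℕ)) π) 0) = poleData n μ π := by
      ext j; rw [elemSol_zero hMpos]; rfl
    rw [h0] at key
    exact (congrFun key j).symm
  · have hC : companion A (fun j : Fin n => elemSol M μ ((poleMul H μ ^ (j : ℕ)) π) s)
        = fun j : Fin n => elemSol M μ (poleMul H μ ((poleMul H μ ^ (j : ℕ)) π)) s := by
      refine companion_eq_of hA (fun i hi => ?_) (j₀ := ⟨n - 1, hn⟩) (by simp; omega) ?_
      · rw [← Module.End.mul_apply, ← pow_succ']
      · have h1 : n - 1 + 1 = n := by omega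
        rw [← Module.End.mul_apply, ← pow_succ']
        simp only [h1]
        have h2 : ∑ j : Fin (n + 1), A j (elemSol M μ ((poleMul H μ ^ (j : ℕ)) π) s)
            = elemSol M μ (poleAct A μ π) s := by
          simp only [elemSol, poleAct, map_smul, map_sum, Finset.smul_sum]
          exact Finset.sum_comm
        rw [hπ, Fin.sum_univ_castSucc] at h2
        simpa [elemSol] using h2
    have hd : HasDerivAt (fun z (j : Fin n) => elemSol M μ ((poleMul H μ ^ (j : ℕ)) π) z)
        (fun j : Fin n => Complex.I • elemSol M μ (poleMul H μ ((poleMul H μ ^ (j : ℕ)) π)) s) s :=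
      hasDerivAt_pi.2 fun j => hasDerivAt_elemSol (hM.poleMul_pow μ j) s
    convert! hd.hasDerivWithinAt (s := Ici 0) using 1
    rw [companionL_apply, hC]
    rfl

lemma tendsto_opFlow_of_mem {A : Fin (n + 1) → H →L[ℂ] H} (hA : IsUnit (A (Fin.last n)))
    {μ : ℂ} (hμ : 0 < μ.im) {x : Fin n → H} (hx : x ∈ (companion A).maxGenEigenspace μ) :
    Tendsto (opFlow (companionL A) x) atTop (𝓝 0) := by
  have hM := (eigenPole_vanishFrom hx).mono (Nat.le_succ _)
  rw [tendsto_pi_nhds]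
  intro j
  refine (tendsto_elemSol (M := (Module.finrank ℂ (Fin n → H)).succ) hμ ((poleMul H μ ^ (j : ℕ)) (eigenPole A μ x))).congr' ?_
  filter_upwards [eventually_ge_atTop 0] with z hz
  rw [← opFlow_poleData hA hM (Nat.succ_pos _) (poleAct_eigenPole hA μ x) hz j, poleData_eigenPole]

lemma iteratedDeriv_opFlow_zero (A : Fin (n + 1) → H →L[ℂ] H) (x : Fin n → H) (j : ℕ) :
    iteratedDeriv j (fun z => opFlow (companionL A) x z 0)
      = fun z => Complex.I ^ j • opFlow (companionL A) ((companion A ^ j) x) z 0 := by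
  induction j with
  | zero => simp
  | succ j ih =>
    rw [iteratedDeriv_succ, ih]
    ext z
    have h1 := hasDerivAt_pi.1 (hasDerivAt_opFlow (companionL A) ((companion A ^ j) x) z) 0
    have h2 := h1.const_smul (Complex.I ^ j)
    refine h2.deriv.trans ?_
    rw [pow_succ' (companion A), Module.End.mul_apply, Pi.smul_apply, smul_smul, ← pow_succ]
    rfl

lemma contDiff_opFlow_zero (A : Fin (n + 1) → H →L[ℂ] H) (x : Fin n → H) (N : ℕ) :
    ContDiff ℝ N (fun z => opFlow (companionL A) x z 0) := by
  refine contDiff_of_differentiable_iteratedDeriv fun m _ => ?_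
  rw [iteratedDeriv_opFlow_zero]
  intro z
  have h1 := hasDerivAt_pi.1 (hasDerivAt_opFlow (companionL A) ((companion A ^ m) x) z) 0
  exact (h1.const_smul (Complex.I ^ m)).differentiableAt

lemma iteratedDerivWithin_of_eqOn {A : Fin (n + 1) → H →L[ℂ] H} {x : Fin n → H} {v : ℝ → H}
    (hv : EqOn v (fun z => opFlow (companionL A) x z 0) (Ici 0)) (j : ℕ) {z : ℝ} (hz : 0 ≤ z) :
    iteratedDerivWithin j v (Ici 0) z
      = Complex.I ^ j • (companion A ^ j) (opFlow (companionL A) x z) 0 := by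
  rw [iteratedDerivWithin_congr hv hz, iteratedDerivWithin_eq_iteratedDeriv (uniqueDiffOn_Ici 0)
    ((contDiff_opFlow_zero A x j).contDiffAt) hz, iteratedDeriv_opFlow_zero]
  beta_reduce
  congr 1
  suffices h : opFlow (companionL A) ((companion A ^ j) x) z
      = (companion A ^ j) (opFlow (companionL A) x z) by rw [h]
  clear hv
  induction j generalizing x with
  | zero => rfl
  | succ j ih =>
    rw [pow_succ, Module.End.mul_apply, Module.End.mul_apply, ih, ← companionL_apply,
      ← apply_opFlow]
    rfl

omit [FiniteDimensional ℂ H] in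
lemma neg_I_pow_smul_I_pow_smul (j : ℕ) (x : H) :
    (-Complex.I) ^ j • Complex.I ^ j • x = x := by
  rw [smul_smul, ← mul_pow, neg_mul, Complex.I_mul_I, neg_neg, one_pow, one_smul]

lemma cauchyData_of_eqOn {A : Fin (n + 1) → H →L[ℂ] H} {x : Fin n → H} {v : ℝ → H}
    (hv : EqOn v (fun z => opFlow (companionL A) x z 0) (Ici 0)) (j : Fin n) {z : ℝ} (hz : 0 ≤ z) :
    (-Complex.I) ^ (j : ℕ) • iteratedDerivWithin j v (Ici 0) z = opFlow (companionL A) x z j := by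
  rw [iteratedDerivWithin_of_eqOn hv j hz, neg_I_pow_smul_I_pow_smul, companion_pow_apply A _ j j.2]

lemma contDiffOn_of_eqOn {A : Fin (n + 1) → H →L[ℂ] H} {x : Fin n → H} {v : ℝ → H}
    (hv : EqOn v (fun z => opFlow (companionL A) x z 0) (Ici 0)) (N : ℕ) :
    ContDiffOn ℝ N v (Ici 0) :=
  (contDiff_opFlow_zero A x N).contDiffOn.congr hv

lemma isSolution_of_eqOn {A : Fin (n + 1) → H →L[ℂ] H} (hA : IsUnit (A (Fin.last n)))
    {x : Fin n → H} {v : ℝ → H}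
    (hv : EqOn v (fun z => opFlow (companionL A) x z 0) (Ici 0)) : IsSolution A v := by
  refine ⟨contDiffOn_of_eqOn hv n, fun z hz => ?_⟩
  rw [← sum_companion_pow hA (opFlow (companionL A) x z)]
  refine Finset.sum_congr rfl fun j _ => ?_
  rw [iteratedDerivWithin_of_eqOn hv j hz, map_smul, neg_I_pow_smul_I_pow_smul]

/-- The vector of the `(-i)ʲ v⁽ʲ⁾` solves the first-order system; invertibility of the leading
coefficient provides the last row. -/
lemma IsSolution.exists_eqOn {A : Fin (n + 1) → H →L[ℂ] H} (hA : IsUnit (A (Fin.last n)))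
    {v : ℝ → H} (hv : IsSolution A v) :
    ∃ x, EqOn v (fun z => opFlow (companionL A) x z 0) (Ici 0) := by
  have hn : n - 1 < n := Nat.sub_lt (NeZero.pos n) one_pos
  set U : ℝ → Fin n → H := fun z j => (-Complex.I) ^ (j : ℕ) • iteratedDerivWithin j v (Ici 0) z
  refine ⟨U 0, fun z hz => ?_⟩
  have key := opFlow_unique (T := companionL A) (U := U) (fun s hs => ?_) hz
  · beta_reduce
    rw [← key]
    simp [U]
  · have hd : ∀ j : Fin n, HasDerivWithinAt (iteratedDerivWithin j v (Ici 0))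
        (iteratedDerivWithin (j + 1) v (Ici 0) s) (Ici 0) s := fun j => by
      rw [iteratedDerivWithin_succ]
      refine DifferentiableWithinAt.hasDerivWithinAt ?_
      exact (hv.1.differentiableOn_iteratedDerivWithin (by exact_mod_cast j.2)
        (uniqueDiffOn_Ici 0)) s hs
    have hC : companion A (U s)
        = fun j : Fin n => (-Complex.I) ^ ((j : ℕ) + 1) • iteratedDerivWithin (j + 1) v (Ici 0) s := by
      refine companion_eq_of hA (fun i hi => rfl) (j₀ := ⟨n - 1, hn⟩) (by simp; omega) ?_
      have h1 : n - 1 + 1 = n := by omega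
      have h2 := hv.2 s hs
      rw [Fin.sum_univ_castSucc] at h2
      simp only [h1]
      simpa [U] using h2
    have hd2 : HasDerivWithinAt U (fun j : Fin n => (-Complex.I) ^ (j : ℕ) •
        iteratedDerivWithin (j + 1) v (Ici 0) s) (Ici 0) s :=
      hasDerivWithinAt_pi.2 fun j => (hd j).const_smul _
    convert! hd2 using 1
    rw [companionL_apply, hC]
    ext j
    rw [Pi.smul_apply, smul_smul, pow_succ', ← mul_assoc, mul_neg, Complex.I_mul_I, neg_neg,
      one_mul]

end

/-! ### Dissipativity: estimates of the imaginary part along chains. -/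

section ImaginaryPart

variable {H : Type*} [NormedAddCommGroup H] [InnerProductSpace ℂ H]

/-- The form of the operator `-Im T`. -/
def imForm (T : H →L[ℂ] H) (y w : H) : ℂ :=
  (Complex.I / 2) * (inner ℂ w (T y) - inner ℂ (T w) y)

lemma imForm_self_re (T : H →L[ℂ] H) (y : H) :
    (imForm T y y).re = -(inner ℂ y (T y)).im := by
  have h : inner ℂ (T y) y = (starRingEnd ℂ) (inner ℂ y (T y)) := (inner_conj_symm _ _).symm
  rw [imForm, h]
  generalize inner ℂ y (T y) = c
  simp [Complex.mul_re]
  ring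

lemma inner_apply_eq (T : H →L[ℂ] H) (y w : H) :
    inner ℂ w (T y) = inner ℂ (T w) y - 2 * Complex.I * imForm T y w := by
  have : 2 * Complex.I * imForm T y w
      = Complex.I * Complex.I * (inner ℂ w (T y) - inner ℂ (T w) y) := by rw [imForm]; ring
  rw [this, Complex.I_mul_I]; ring

/-- Dissipativity makes `imForm` a semi-inner product, so this is its Cauchy-Schwarz inequality. -/
lemma norm_imForm_sq_le {T : H →L[ℂ] H} (hT : ∀ x, (inner ℂ x (T x)).im ≤ 0) (y w : H) :
    ‖imForm T y w‖ ^ 2 ≤ (imForm T y y).re * (imForm T w w).re := by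
  let c : PreInnerProductSpace.Core ℂ H :=
    { inner := fun x y => imForm T y x
      conj_inner_symm := fun x y => by
        simp only [imForm, map_mul, map_sub, inner_conj_symm, map_div₀, Complex.conj_I, map_ofNat]
        ring
      re_inner_nonneg := fun x => by
        have := hT x
        change 0 ≤ (imForm T x x).re
        rw [imForm_self_re]; linarith
      add_left := fun x y z => by
        simp only [imForm, inner_add_left, map_add]; ring
      smul_left := fun x y r => by
        simp only [imForm, inner_smul_left, map_smul]; ring }
  have h1 := @InnerProductSpace.Core.inner_mul_inner_self_le ℂ H _ _ _ c w y
  have h2 : ‖imForm T w y‖ = ‖imForm T y w‖ := by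
    have := c.conj_inner_symm w y
    change (starRingEnd ℂ) (imForm T w y) = imForm T y w at this
    rw [← this, RCLike.norm_conj]
  change ‖imForm T y w‖ * ‖imForm T w y‖ ≤ (imForm T w w).re * (imForm T y y).re at h1
  rw [h2] at h1
  nlinarith

/-- `y` and `g` have limits `y₀` and `g₀` at `0`, and `X y = t^{p+1} g`. -/
structure IsChainGerm (X : ℝ → H →L[ℂ] H) (p : ℕ) (y g : ℝ → H) (y₀ g₀ : H) : Prop where
  lim_left : Tendsto y (𝓝[≠] 0) (𝓝 y₀)
  lim_right : Tendsto g (𝓝[≠] 0) (𝓝 g₀)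
  apply_eq : ∀ᶠ t : ℝ in 𝓝[≠] 0, X t (y t) = (t : ℂ) ^ (p + 1) • g t

lemma tendsto_ofReal_pow (k : ℕ) :
    Tendsto (fun t : ℝ => (t : ℂ) ^ k) (𝓝[≠] 0) (𝓝 (0 ^ k)) := by
  have : Continuous fun t : ℝ => (t : ℂ) ^ k := by fun_prop
  exact (this.tendsto' 0 _ (by simp)).mono_left nhdsWithin_le_nhds

lemma inv_pow_mul_pow {t : ℂ} (ht : t ≠ 0) {a b : ℕ} (hab : a ≤ b) :
    (t ^ a)⁻¹ * t ^ b = t ^ (b - a) := by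
  obtain ⟨d, rfl⟩ := Nat.exists_eq_add_of_le hab
  rw [pow_add, inv_mul_cancel_left₀ (pow_ne_zero _ ht), Nat.add_sub_cancel_left]

lemma tendsto_zero_of_norm_sq_le {α : Type*} {l : Filter α} {f : α → ℂ} {g : α → ℝ}
    (h : ∀ᶠ a in l, ‖f a‖ ^ 2 ≤ g a) (hg : Tendsto g l (𝓝 0)) : Tendsto f l (𝓝 0) := by
  rw [tendsto_zero_iff_norm_tendsto_zero]
  have hs : Tendsto (fun a => Real.sqrt (g a)) l (𝓝 0) := by
    simpa using hg.sqrt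
  refine squeeze_zero' (Eventually.of_forall fun _ => norm_nonneg _) ?_ hs
  filter_upwards [h] with a ha
  exact Real.le_sqrt_of_sq_le ha

variable {X : ℝ → H →L[ℂ] H} (hX : ∀ t x, (inner ℂ x (X t x)).im ≤ 0)
include hX

/-- The form is `O(t^{p+1})` with a leading coefficient, so the quotient has a two-sided limit. The
form is nonnegative while `t^{2h+1}` changes sign, so that limit is both nonnegative and
nonpositive. -/
lemma IsChainGerm.tendsto_imForm_self {p : ℕ} {y g : ℝ → H} {y₀ g₀ : H}
    (hy : IsChainGerm X p y g y₀ g₀) {h : ℕ} (hh : 2 * h ≤ p) :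
    Tendsto (fun t : ℝ => (t ^ (2 * h + 1))⁻¹ * (imForm (X t) (y t) (y t)).re) (𝓝[≠] 0) (𝓝 0) := by
  have hlim : Tendsto (fun t : ℝ => ((t : ℂ) ^ (p - 2 * h) * -inner ℂ (y t) (g t)).im) (𝓝[≠] 0)
      (𝓝 (0 ^ (p - 2 * h) * -inner ℂ y₀ g₀ : ℂ).im) :=
    (Complex.continuous_im.tendsto _).comp
      ((tendsto_ofReal_pow _).mul (hy.lim_left.inner hy.lim_right).neg)
  have heq : ∀ᶠ t : ℝ in 𝓝[≠] 0, ((t : ℂ) ^ (p - 2 * h) * -inner ℂ (y t) (g t)).im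
      = (t ^ (2 * h + 1))⁻¹ * (imForm (X t) (y t) (y t)).re := by
    filter_upwards [hy.apply_eq, self_mem_nhdsWithin] with t h1 ht
    have ht : (t : ℂ) ≠ 0 := by exact_mod_cast ht
    rw [imForm_self_re, h1, inner_smul_right, ← Complex.neg_im, ← Complex.im_ofReal_mul]
    congr 1
    have : p - 2 * h = p + 1 - (2 * h + 1) := by omega
    rw [this, ← inv_pow_mul_pow ht (by omega : 2 * h + 1 ≤ p + 1)]
    push_cast
    ring
  have hlim' := hlim.congr' heq
  have hnn : ∀ t, 0 ≤ (imForm (X t) (y t) (y t)).re := fun t => by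
    rw [imForm_self_re]; linarith [hX t (y t)]
  have h1 : 0 ≤ (0 ^ (p - 2 * h) * -inner ℂ y₀ g₀ : ℂ).im := by
    refine ge_of_tendsto (hlim'.mono_left (nhdsWithin_mono _ (fun t ht => ne_of_gt ht) :
      𝓝[>] (0 : ℝ) ≤ 𝓝[≠] 0)) ?_
    filter_upwards [self_mem_nhdsWithin] with t ht
    have ht : 0 < t := ht
    exact mul_nonneg (by positivity) (hnn t)
  have h2 : (0 ^ (p - 2 * h) * -inner ℂ y₀ g₀ : ℂ).im ≤ 0 := by
    refine le_of_tendsto (hlim'.mono_left (nhdsWithin_mono _ (fun t ht => ne_of_lt ht) :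
      𝓝[<] (0 : ℝ) ≤ 𝓝[≠] 0)) ?_
    filter_upwards [self_mem_nhdsWithin] with t ht
    refine mul_nonpos_of_nonpos_of_nonneg (inv_nonpos.2 ?_) (hnn t)
    exact ((Odd.pow_neg_iff ⟨h, rfl⟩).2 ht).le
  rwa [le_antisymm h2 h1] at hlim'

lemma IsChainGerm.tendsto_imForm {p q : ℕ} {y g w k : ℝ → H} {y₀ g₀ w₀ k₀ : H}
    (hy : IsChainGerm X p y g y₀ g₀) (hw : IsChainGerm X q w k w₀ k₀) {h h' : ℕ}
    (hh : 2 * h ≤ p) (hh' : 2 * h' ≤ q) :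
    Tendsto (fun t : ℝ => ((t : ℂ) ^ (h + h' + 1))⁻¹ * imForm (X t) (y t) (w t)) (𝓝[≠] 0)
      (𝓝 0) := by
  have h1 := (hy.tendsto_imForm_self hX hh).mul (hw.tendsto_imForm_self hX hh')
  rw [mul_zero] at h1
  refine tendsto_zero_of_norm_sq_le ?_ h1
  filter_upwards [self_mem_nhdsWithin] with t ht
  have ht : t ≠ 0 := ht
  rw [norm_mul, mul_pow, norm_inv, norm_pow, Complex.norm_real, Real.norm_eq_abs, inv_pow, ← pow_mul,
    mul_comm (h + h' + 1) 2, pow_mul, sq_abs, ← pow_mul]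
  have e : (t ^ (2 * (h + h' + 1)))⁻¹ = (t ^ (2 * h + 1))⁻¹ * (t ^ (2 * h' + 1))⁻¹ := by
    rw [← mul_inv, ← pow_add]; congr 2; ring
  calc (t ^ (2 * (h + h' + 1)))⁻¹ * ‖imForm (X t) (y t) (w t)‖ ^ 2
      ≤ (t ^ (2 * (h + h' + 1)))⁻¹ *
        ((imForm (X t) (y t) (y t)).re * (imForm (X t) (w t) (w t)).re) := by
        refine mul_le_mul_of_nonneg_left (norm_imForm_sq_le (hX t) _ _) ?_
        rw [pow_mul]; positivity
    _ = _ := by rw [e]; ring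

/-- Either the first chain is long enough for a direct estimate, or the second one is, after `X` has
been moved across at the cost of an `imForm` term that Cauchy-Schwarz makes small. Neither works
exactly for two middle vectors of chains of the same odd length, the case excluded by `hne`. -/
lemma IsChainGerm.tendsto_inner {p q : ℕ} {y g w k : ℝ → H} {y₀ g₀ w₀ k₀ : H}
    (hy : IsChainGerm X p y g y₀ g₀) (hw : IsChainGerm X q w k w₀ k₀) {h h' : ℕ}
    (hh : 2 * h ≤ p) (hh' : 2 * h' ≤ q) (hne : ¬ (p = 2 * h ∧ q = 2 * h' ∧ h = h')) :
    Tendsto (fun t : ℝ => ((t : ℂ) ^ (h + h' + 1))⁻¹ * inner ℂ (w t) (X t (y t))) (𝓝[≠] 0)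
      (𝓝 0) := by
  rcases le_or_gt (h + h' + 1) p with hp | hp
  · have h1 := (tendsto_ofReal_pow (p - (h + h'))).mul (hw.lim_left.inner hy.lim_right (𝕜 := ℂ))
    rw [zero_pow (by omega), zero_mul] at h1
    refine h1.congr' ?_
    filter_upwards [hy.apply_eq, self_mem_nhdsWithin] with t e ht
    have ht : (t : ℂ) ≠ 0 := by exact_mod_cast ht
    rw [e, inner_smul_right, ← mul_assoc, inv_pow_mul_pow ht (by omega)]
    congr 2; omega
  · have hq : h + h' + 1 ≤ q := by omega
    have h1 := (tendsto_ofReal_pow (q - (h + h'))).mul (hw.lim_right.inner hy.lim_left (𝕜 := ℂ))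
    rw [zero_pow (by omega), zero_mul] at h1
    have h2 := (hy.tendsto_imForm hX hw hh hh').const_mul (2 * Complex.I)
    have h3 := h1.sub h2
    rw [mul_zero, sub_zero] at h3
    refine h3.congr' ?_
    filter_upwards [hw.apply_eq, self_mem_nhdsWithin] with t e ht
    have ht : (t : ℂ) ≠ 0 := by exact_mod_cast ht
    rw [inner_apply_eq, e, inner_smul_left, map_pow, Complex.conj_ofReal]
    have : q - (h + h') = q + 1 - (h + h' + 1) := by omega
    rw [this, ← inv_pow_mul_pow ht (by omega : h + h' + 1 ≤ q + 1)]
    ring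

/-- Moving `X` onto the chain costs an `imForm` term bounded by `o(t^{2h+1})` on one side only; half
of that exponent still beats `t ^ h`. -/
lemma IsChainGerm.tendsto_inner_right {q : ℕ} {u w k : ℝ → H} {u₀ w₀ k₀ : H} {X₀ : H →L[ℂ] H}
    (hX₀ : Tendsto X (𝓝[≠] 0) (𝓝 X₀)) (hu : Tendsto u (𝓝[≠] 0) (𝓝 u₀))
    (hw : IsChainGerm X q w k w₀ k₀) {h : ℕ} (hh : 2 * h ≤ q) :
    Tendsto (fun t : ℝ => ((t : ℂ) ^ h)⁻¹ * inner ℂ (w t) (X t (u t))) (𝓝[≠] 0) (𝓝 0) := by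
  have h1 := (tendsto_ofReal_pow (q + 1 - h)).mul (hw.lim_right.inner hu (𝕜 := ℂ))
  rw [zero_pow (by omega), zero_mul] at h1
  have hXu : Tendsto (fun t => X t (u t)) (𝓝[≠] 0) (𝓝 (X₀ u₀)) :=
    (isBoundedBilinearMap_apply.continuous.tendsto (X₀, u₀)).comp (hX₀.prodMk_nhds hu)
  have hbu : Tendsto (fun t => (imForm (X t) (u t) (u t)).re) (𝓝[≠] 0)
      (𝓝 (imForm X₀ u₀ u₀).re) :=
    (Complex.continuous_re.tendsto _).comp (((hu.inner hXu).sub (hXu.inner hu)).const_mul _)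
  have ht0 : Tendsto (fun t : ℝ => t) (𝓝[≠] 0) (𝓝 0) := nhdsWithin_le_nhds
  have hb := (hbu.mul ht0).mul (hw.tendsto_imForm_self hX hh)
  rw [mul_zero] at hb
  have h2 : Tendsto (fun t : ℝ => ((t : ℂ) ^ h)⁻¹ * imForm (X t) (u t) (w t)) (𝓝[≠] 0) (𝓝 0) := by
    refine tendsto_zero_of_norm_sq_le ?_ hb
    filter_upwards [self_mem_nhdsWithin] with t ht
    have ht : t ≠ 0 := ht
    rw [norm_mul, mul_pow, norm_inv, norm_pow, Complex.norm_real, Real.norm_eq_abs, inv_pow,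
      ← pow_mul, mul_comm h 2, pow_mul, sq_abs, ← pow_mul]
    have e : (t ^ (2 * h))⁻¹ = t * (t ^ (2 * h + 1))⁻¹ := by
      rw [pow_succ]; field_simp
    calc (t ^ (2 * h))⁻¹ * ‖imForm (X t) (u t) (w t)‖ ^ 2
        ≤ (t ^ (2 * h))⁻¹ *
          ((imForm (X t) (u t) (u t)).re * (imForm (X t) (w t) (w t)).re) := by
          refine mul_le_mul_of_nonneg_left (norm_imForm_sq_le (hX t) _ _) ?_
          rw [pow_mul]; positivity
      _ = _ := by rw [e]; ring
  have h3 := h1.sub (h2.const_mul (2 * Complex.I))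
  rw [mul_zero, sub_zero] at h3
  refine h3.congr' ?_
  filter_upwards [hw.apply_eq, self_mem_nhdsWithin] with t e ht
  have ht : (t : ℂ) ≠ 0 := by exact_mod_cast ht
  rw [inner_apply_eq, e, inner_smul_left, map_pow, Complex.conj_ofReal,
    ← inv_pow_mul_pow ht (by omega : h ≤ q + 1)]
  ring

/-- The imaginary part is of higher order than `t^{2m+1}`, hence the leading form on chains of
length `2m + 1` is Hermitian. -/
lemma IsChainGerm.inner_symm {m : ℕ} {y g w k : ℝ → H} {y₀ g₀ w₀ k₀ : H}
    (hy : IsChainGerm X (2 * m) y g y₀ g₀) (hw : IsChainGerm X (2 * m) w k w₀ k₀) :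
    inner ℂ w₀ g₀ = inner ℂ k₀ y₀ := by
  have h1 := (hy.tendsto_imForm hX hw le_rfl le_rfl).const_mul (2 * Complex.I)
  rw [mul_zero] at h1
  have h2 := (hw.lim_right.inner hy.lim_left (𝕜 := ℂ)).sub (hw.lim_left.inner hy.lim_right (𝕜 := ℂ))
  have h3 := tendsto_nhds_unique h1 (h2.congr' ?_)
  · exact (sub_eq_zero.1 h3.symm).symm
  filter_upwards [hy.apply_eq, hw.apply_eq, self_mem_nhdsWithin] with t e1 e2 ht
  have ht : (t : ℂ) ≠ 0 := by exact_mod_cast ht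
  have := inner_apply_eq (X t) (y t) (w t)
  rw [e1, e2, inner_smul_left, inner_smul_right, map_pow, Complex.conj_ofReal] at this
  have e3 : m + m + 1 = 2 * m + 1 := by ring
  rw [e3]
  have h4 : (t : ℂ) ^ (2 * m + 1) ≠ 0 := pow_ne_zero _ ht
  field_simp
  linear_combination -this

end ImaginaryPart

/-! ### Chain polynomials as germs at a point; the adjoint pencil. -/

section Germs

lemma seqPoly_shift {E : Type*} [AddCommGroup E] [Module ℂ E] {a : ℕ → E} {s : ℕ}
    (ha : ∀ r < s, a r = 0) (M : ℕ) (t : ℂ) :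
    seqPoly (s + M) a t = t ^ s • seqPoly M (fun i => a (s + i)) t := by
  rw [seqPoly, Finset.sum_range_add, Finset.sum_eq_zero, zero_add, seqPoly, Finset.smul_sum]
  · exact Finset.sum_congr rfl fun i _ => by rw [smul_smul, ← pow_add]
  · intro i hi
    rw [ha i (Finset.mem_range.1 hi), smul_zero]

variable {E : Type*} [NormedAddCommGroup E] [NormedSpace ℂ E]

lemma tendsto_seqPoly {M : ℕ} (hM : 0 < M) (a : ℕ → E) :
    Tendsto (fun t : ℝ => seqPoly M a t) (𝓝[≠] 0) (𝓝 (a 0)) := by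
  have : Continuous fun t : ℝ => seqPoly M a t := by
    unfold seqPoly; fun_prop
  refine (this.tendsto' 0 _ ?_).mono_left nhdsWithin_le_nhds
  rw [seqPoly, Finset.sum_eq_single_of_mem 0 (Finset.mem_range.2 hM)]
  · simp
  · intro i _ hi; simp [hi]

lemma continuous_seqPoly (M : ℕ) (a : ℕ → E) : Continuous fun t : ℝ => seqPoly M a t := by
  unfold seqPoly; fun_prop

lemma eq_zero_of_tendsto_seqPoly {M e : ℕ} {a : ℕ → E}
    (h : Tendsto (fun t : ℝ => ((t : ℂ) ^ e)⁻¹ • seqPoly M a t) (𝓝[≠] 0) (𝓝 0)) {s : ℕ}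
    (hs : s ≤ e) (hsM : s < M) : a s = 0 := by
  induction s using Nat.strong_induction_on with
  | _ s ih =>
    obtain ⟨d, rfl⟩ := Nat.exists_eq_add_of_lt hsM
    rw [add_assoc] at h
    have h1 := tendsto_seqPoly (Nat.succ_pos d) fun i => a (s + i)
    have h2 := (tendsto_ofReal_pow (e - s)).smul h
    rw [smul_zero] at h2
    refine tendsto_nhds_unique h1 (h2.congr' ?_)
    filter_upwards [self_mem_nhdsWithin] with t ht
    have ht : (t : ℂ) ≠ 0 := by exact_mod_cast ht
    rw [seqPoly_shift (fun r hr => ih r hr (by omega) (by omega)), smul_smul, smul_smul]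
    have : (t : ℂ) ^ (e - s) * ((t : ℂ) ^ e)⁻¹ * (t : ℂ) ^ s = 1 := by
      have e1 : (t : ℂ) ^ e = (t : ℂ) ^ (e - s) * (t : ℂ) ^ s := by rw [← pow_add]; congr 1; omega
      rw [e1]
      have := pow_ne_zero (e - s) ht
      have := pow_ne_zero s ht
      field_simp
    rw [this, one_smul]

/-- Iterating the difference quotient `dslope` at `0` yields an analytic remainder, not merely an
error bound. -/
lemma exists_taylor {f : ℂ → E} (hf : AnalyticAt ℂ f 0) (N : ℕ) :
    ∃ (a : ℕ → E) (ρ : ℂ → E), AnalyticAt ℂ ρ 0 ∧ ∀ t, f t = seqPoly N a t + t ^ N • ρ t := by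
  induction N generalizing f with
  | zero => exact ⟨0, f, hf, fun t => by simp [seqPoly]⟩
  | succ N ih =>
    obtain ⟨p, hp⟩ := hf
    obtain ⟨a, ρ, hρ, h⟩ := ih ⟨_, hp.has_fpower_series_dslope_fslope⟩
    refine ⟨fun i => Nat.casesOn i (f 0) a, ρ, hρ, fun t => ?_⟩
    have h1 : f t = f 0 + t • dslope f 0 t := by
      have := sub_smul_dslope f 0 t
      rw [sub_zero] at this
      rw [this]; abel
    rw [h1, h t, seqPoly, seqPoly, Finset.sum_range_succ', smul_add, Finset.smul_sum]
    simp only [smul_smul, ← pow_succ', pow_zero, one_smul]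
    change _ = (∑ x ∈ Finset.range N, t ^ (x + 1) • a x) + f 0 + t ^ (N + 1) • ρ t
    abel

/-- The sequence cut off at `N`. -/
def truncSeq {F : Type*} [Zero F] (N : ℕ) (y : ℕ → F) (i : ℕ) : F := if i < N then y i else 0

lemma seqPoly_truncSeq {F : Type*} [AddCommGroup F] [Module ℂ F] {N M : ℕ} (h : N ≤ M)
    (y : ℕ → F) (t : ℂ) : seqPoly M (truncSeq N y) t = seqPoly N y t := by
  obtain ⟨d, rfl⟩ := Nat.exists_eq_add_of_le h
  rw [seqPoly, Finset.sum_range_add, seqPoly]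
  have : ∑ x ∈ Finset.range d, t ^ (N + x) • truncSeq N y (N + x) = 0 :=
    Finset.sum_eq_zero fun i _ => by rw [truncSeq, if_neg (by omega), smul_zero]
  rw [this, add_zero]
  exact Finset.sum_congr rfl fun i hi => by rw [truncSeq, if_pos (Finset.mem_range.1 hi)]

variable {H : Type*} [NormedAddCommGroup H] [InnerProductSpace ℂ H] {n : ℕ}

lemma seqAct_truncSeq (A : Fin (n + 1) → H →L[ℂ] H) (μ : ℂ) (y : ℕ → H) {N s : ℕ} (h : s < N) :
    seqAct A μ (truncSeq N y) s = seqAct A μ y s :=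
  Finset.sum_congr rfl fun r _ => by rw [truncSeq, if_pos (by omega)]

/-- The product has degree at most `N - 1 + n`, so the cut at `N + n + 1` loses nothing. -/
lemma pencil_seqPoly (A : Fin (n + 1) → H →L[ℂ] H) (μ : ℂ) (y : ℕ → H) (N : ℕ) (t : ℂ) :
    pencil A (μ + t) (seqPoly N y t)
      = seqPoly (N + (n + 1)) (seqAct A μ (truncSeq N y)) t := by
  let f : (H →L[ℂ] H) →ₗ[ℂ] H →ₗ[ℂ] H := ContinuousLinearMap.coeLM ℂ
  have key := seqPoly_mul_aux f (taylorCoeff A μ) (truncSeq N y) (N + (n + 1)) t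
  rw [seqPoly_truncSeq (by omega), ← pencil_add A μ t (by omega : n < N + (n + 1))] at key
  refine key.trans ?_
  rw [Finset.sum_eq_zero (s := Finset.range (N + (n + 1)))
    (f := fun r => ∑ i ∈ Finset.range r, t ^ i •
      f (taylorCoeff A μ (N + (n + 1) - r + i)) (truncSeq N y r)), smul_zero, add_zero]
  · refine Finset.sum_congr rfl fun s _ => ?_
    congr 1
    rw [seqAct, ← Finset.sum_range_reflect]
    refine Finset.sum_congr rfl fun r hr => ?_
    have hr := Finset.mem_range.1 hr
    have e1 : s - (s + 1 - 1 - r) = r := by omega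
    have e2 : s + 1 - 1 - r = s - r := by omega
    rw [e1, e2]
    rfl
  · intro r hr
    refine Finset.sum_eq_zero fun i _ => ?_
    by_cases h : r < N
    · rw [taylorCoeff_eq_zero A μ (by omega), map_zero, LinearMap.zero_apply, smul_zero]
    · rw [truncSeq, if_neg h, map_zero, smul_zero]

/-- The polynomial `t^{-(p+1)} A(μ + t) ∑_{r ≤ p} tʳ yʳ` of a chain. -/
def chainImage (A : Fin (n + 1) → H →L[ℂ] H) (μ : ℂ) (p : ℕ) (y : ℕ → H) (i : ℕ) : H :=
  seqAct A μ (truncSeq (p + 1) y) (p + 1 + i)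

lemma pencil_seqPoly_of_chain {A : Fin (n + 1) → H →L[ℂ] H} {μ : ℂ} {y : ℕ → H} {p : ℕ}
    (hy : ∀ s ≤ p, seqAct A μ y s = 0) (t : ℂ) :
    pencil A (μ + t) (seqPoly (p + 1) y t)
      = t ^ (p + 1) • seqPoly (n + 1) (chainImage A μ p y) t := by
  rw [pencil_seqPoly, seqPoly_shift]
  · rfl
  · intro r hr
    rw [seqAct_truncSeq _ _ _ hr]
    exact hy r (by omega)

lemma isChainGerm_of_chain {A : Fin (n + 1) → H →L[ℂ] H} {μ : ℂ} {y : ℕ → H} {p : ℕ}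
    (hy : ∀ s ≤ p, seqAct A μ y s = 0) :
    IsChainGerm (fun t : ℝ => pencil A (μ + t)) p (fun t => seqPoly (p + 1) y t)
      (fun t => seqPoly (n + 1) (chainImage A μ p y) t) (y 0) (chainImage A μ p y 0) where
  lim_left := tendsto_seqPoly (Nat.succ_pos p) y
  lim_right := tendsto_seqPoly (Nat.succ_pos n) _
  apply_eq := Eventually.of_forall fun t => pencil_seqPoly_of_chain hy t

lemma continuous_pencil (A : Fin (n + 1) → H →L[ℂ] H) : Continuous (pencil A) := by
  unfold pencil; fun_prop

lemma continuous_pencil_add (A : Fin (n + 1) → H →L[ℂ] H) (μ : ℂ) :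
    Continuous fun t : ℝ => pencil A (μ + t) :=
  (continuous_pencil A).comp (by fun_prop)

lemma tendsto_pencil_add (A : Fin (n + 1) → H →L[ℂ] H) (μ : ℂ) :
    Tendsto (fun t : ℝ => pencil A (μ + t)) (𝓝[≠] 0) (𝓝 (pencil A μ)) :=
  ((continuous_pencil_add A μ).tendsto' 0 _ (by simp)).mono_left nhdsWithin_le_nhds

/-- The pencil of the negative adjoint operators. -/
def negAdjoint [CompleteSpace H] (A : Fin (n + 1) → H →L[ℂ] H) (j : Fin (n + 1)) : H →L[ℂ] H :=
  -ContinuousLinearMap.adjoint (A j)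

lemma pencil_negAdjoint [CompleteSpace H] (A : Fin (n + 1) → H →L[ℂ] H) (t : ℝ) :
    pencil (negAdjoint A) t = -ContinuousLinearMap.adjoint (pencil A t) := by
  simp only [pencil, negAdjoint, map_sum, smul_neg, Finset.sum_neg_distrib, map_smulₛₗ, map_pow,
    Complex.conj_ofReal]

lemma inner_pencil_negAdjoint [CompleteSpace H] (A : Fin (n + 1) → H →L[ℂ] H) (t : ℝ) (x y : H) :
    inner ℂ x (pencil (negAdjoint A) t y) = -inner ℂ (pencil A t x) y := by
  rw [pencil_negAdjoint]
  simp [ContinuousLinearMap.adjoint_inner_right]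

lemma inner_pencil_negAdjoint_left [CompleteSpace H] (A : Fin (n + 1) → H →L[ℂ] H) (t : ℝ)
    (x y : H) : inner ℂ (pencil (negAdjoint A) t x) y = -inner ℂ x (pencil A t y) := by
  rw [pencil_negAdjoint]
  simp [ContinuousLinearMap.adjoint_inner_left]

/-- Passing to the adjoint reverses the sign of the imaginary part and the minus sign restores it,
so all chain estimates also apply to adjoint chains. -/
lemma IsDissipative.negAdjoint [CompleteSpace H] {A : Fin (n + 1) → H →L[ℂ] H}
    (hA : IsDissipative A) : IsDissipative (negAdjoint A) := fun t x => by
  rw [inner_pencil_negAdjoint, ← inner_conj_symm]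
  have := hA t x
  rw [Complex.neg_im, Complex.conj_im, neg_neg]
  exact this

lemma inner_seqPoly_left (M : ℕ) (a : ℕ → H) (t : ℝ) (x : H) :
    inner ℂ (seqPoly M a t) x = seqPoly M (fun s => inner ℂ (a s) x) t := by
  simp only [seqPoly, sum_inner, inner_smul_left, map_pow, Complex.conj_ofReal, smul_eq_mul]

end Germs

/-! ### Uniform linear independence under small perturbations. -/

section UniformIndependence

variable {H : Type*} [NormedAddCommGroup H] [InnerProductSpace ℂ H] {ι : Type*} [Fintype ι]

/-- An injective map from a finite-dimensional space is bounded below, and a small perturbation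
keeps half of the bound. It converts boundedness of a singular-looking combination into boundedness
of each coefficient. -/
lemma isBounded_coeff_of_linearIndependent {w : ι → H} (hw : LinearIndependent ℂ w)
    {f : ι → ℝ → H} (hf : ∀ k, Tendsto (f k) (𝓝[≠] 0) (𝓝 (w k))) {β : ι → ℝ → ℂ} {r : ℝ → H}
    {r₀ : H} (hr : Tendsto r (𝓝[≠] 0) (𝓝 r₀))
    (h : ∀ᶠ t in 𝓝[≠] (0 : ℝ), ∑ k, β k t • f k t = r t) :
    ∃ C, ∀ᶠ t in 𝓝[≠] (0 : ℝ), ∀ k, ‖β k t‖ ≤ C := by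
  obtain ⟨K, hK, hL⟩ := (Fintype.linearCombination ℂ w).exists_antilipschitzWith
    (LinearMap.ker_eq_bot.2 hw.fintypeLinearCombination_injective)
  have hbound : ∀ b : ι → ℂ, ‖b‖ ≤ K * ‖∑ k, b k • w k‖ := fun b => by
    simpa [Fintype.linearCombination_apply] using hL.le_mul_dist b 0
  have hsmall : Tendsto (fun t => ∑ k, ‖f k t - w k‖) (𝓝[≠] 0) (𝓝 0) := by
    have := tendsto_finsetSum (Finset.univ : Finset ι)
      fun k _ => ((hf k).sub_const (w k)).norm
    simpa using this
  have hK' : (0 : ℝ) < K := hK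
  have hs2 : ∀ᶠ t in 𝓝[≠] (0 : ℝ), ∑ k, ‖f k t - w k‖ < (2 * (K : ℝ))⁻¹ :=
    hsmall.eventually (gt_mem_nhds (by positivity : 0 < (2 * (K : ℝ))⁻¹))
  have hr2 : ∀ᶠ t in 𝓝[≠] (0 : ℝ), ‖r t‖ < ‖r₀‖ + 1 :=
    hr.norm.eventually (gt_mem_nhds (by linarith))
  refine ⟨2 * K * (‖r₀‖ + 1), ?_⟩
  filter_upwards [h, hs2, hr2] with t h1 h2 h3 k
  set b : ι → ℂ := fun k => β k t
  have e1 : ∑ k, b k • w k = r t - ∑ k, b k • (f k t - w k) := by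
    rw [← h1, ← Finset.sum_sub_distrib]
    exact Finset.sum_congr rfl fun k _ => by rw [smul_sub, sub_sub_cancel]
  have e2 : ‖∑ k, b k • (f k t - w k)‖ ≤ ‖b‖ * (2 * (K : ℝ))⁻¹ := by
    calc ‖∑ k, b k • (f k t - w k)‖ ≤ ∑ k, ‖b‖ * ‖f k t - w k‖ := by
          refine norm_sum_le_of_le _ fun k _ => ?_
          rw [norm_smul]
          exact mul_le_mul_of_nonneg_right (norm_le_pi_norm b k) (norm_nonneg _)
      _ = ‖b‖ * ∑ k, ‖f k t - w k‖ := by rw [Finset.mul_sum]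
      _ ≤ _ := mul_le_mul_of_nonneg_left h2.le (norm_nonneg _)
  have e3 : ‖b‖ ≤ K * (‖r₀‖ + 1 + ‖b‖ * (2 * (K : ℝ))⁻¹) := by
    refine (hbound b).trans (mul_le_mul_of_nonneg_left ?_ hK'.le)
    rw [e1]
    exact (norm_sub_le _ _).trans (add_le_add h3.le e2)
  have e4 : K * (‖b‖ * (2 * (K : ℝ))⁻¹) = ‖b‖ / 2 := by field_simp
  rw [mul_add, e4] at e3
  have := norm_le_pi_norm b k
  change ‖b k‖ ≤ _
  nlinarith

lemma tendsto_zero_of_mul_bounded {β : ℝ → ℂ} {C : ℝ} (h : ∀ᶠ t in 𝓝[≠] (0 : ℝ), ‖β t‖ ≤ C)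
    {k : ℕ} (hk : k ≠ 0) : Tendsto (fun t : ℝ => (t : ℂ) ^ k * β t) (𝓝[≠] 0) (𝓝 0) := by
  have h1 := tendsto_ofReal_pow k
  rw [zero_pow hk] at h1
  exact h1.zero_mul_isBoundedUnder_le ⟨C, by simpa [eventually_map] using h⟩

end UniformIndependence

/-! ### The adjoint system: biorthogonality and adjoint chains. -/

section

variable {H : Type*} [NormedAddCommGroup H] [InnerProductSpace ℂ H] {n : ℕ}

lemma tendsto_ofReal_add (c : ℂ) :
    Tendsto (fun t : ℝ => c + t) (𝓝[≠] 0) (𝓝[≠] c) := by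
  refine tendsto_nhdsWithin_iff.2 ⟨?_, ?_⟩
  · have : Continuous fun t : ℝ => c + t := by fun_prop
    exact (this.tendsto' 0 c (by simp)).mono_left nhdsWithin_le_nhds
  · filter_upwards [self_mem_nhdsWithin] with t ht
    have ht : (t : ℂ) ≠ 0 := by exact_mod_cast ht
    simpa using ht

lemma inv_pow_mul_seqPoly_smul (b : ℕ → ℂ) (w : ℕ → H) (N : ℕ) {t : ℂ} (ht : t ≠ 0) :
    ((t ^ N)⁻¹ * seqPoly N b t) • seqPoly N w t
      = ∑ s ∈ Finset.range N, (t ^ (N - s))⁻¹ • ∑ r ∈ Finset.range (s + 1), b (s - r) • w r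
        + ∑ r ∈ Finset.range N, ∑ i ∈ Finset.range r, t ^ i • b (N - r + i) • w r := by
  have key := seqPoly_mul_aux (LinearMap.lsmul ℂ H) b w N t
  have key : seqPoly N b t • seqPoly N w t = _ := key
  rw [mul_smul, key, smul_add, smul_smul, inv_mul_cancel₀ (pow_ne_zero _ ht), one_smul,
    Finset.smul_sum]
  congr 1
  refine Finset.sum_congr rfl fun s hs => ?_
  have hs := Finset.mem_range.1 hs
  rw [smul_smul]
  congr 1
  have : t ^ N = t ^ (N - s) * t ^ s := by rw [← pow_add]; congr 1; omega
  rw [this, mul_inv, mul_assoc, inv_mul_cancel₀ (pow_ne_zero _ ht), mul_one]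

/-- Completing each triangular sum of the principal part to a product of the polynomials of `z k`
and `w k` changes it by a polynomial `D`, absorbed in the regular part. Real `t` is essential
because `z k` enters conjugate-linearly. -/
lemma IsAdjointSystem.exists_eq {A : Fin (n + 1) → H →L[ℂ] H} {c : ℂ} {S : ChainSystem H}
    {z : Fin S.num → ℕ → H} (h : IsAdjointSystem A c S z) :
    ∃ (R : ℝ → H →L[ℂ] H) (R₀ : H →L[ℂ] H), Tendsto R (𝓝[≠] 0) (𝓝 R₀) ∧
      ∀ᶠ t : ℝ in 𝓝[≠] 0, ∀ x, x = ∑ k, (((t : ℂ) ^ (S.p k + 1))⁻¹ *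
        inner ℂ (seqPoly (S.p k + 1) (z k) t) (pencil A (c + t) x)) •
          seqPoly (S.p k + 1) (S.w k) t + R t (pencil A (c + t) x) := by
  obtain ⟨R, hR, hev⟩ := h
  set D : ℝ → H →L[ℂ] H := fun t => ∑ k, ∑ r ∈ Finset.range (S.p k + 1), ∑ i ∈ Finset.range r,
    (t : ℂ) ^ i • (innerSL ℂ (z k (S.p k + 1 - r + i))).smulRight (S.w k r) with hD
  have hDc : Continuous D := by rw [hD]; fun_prop
  have hRc : Tendsto (fun t : ℝ => R (c + t)) (𝓝[≠] 0) (𝓝 (R c)) :=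
    (hR.continuousAt.tendsto.mono_left nhdsWithin_le_nhds).comp (tendsto_ofReal_add c)
  refine ⟨fun t => R (c + t) - D t, R c - D 0,
    hRc.sub (hDc.continuousAt.tendsto.mono_left nhdsWithin_le_nhds), ?_⟩
  filter_upwards [(tendsto_ofReal_add c).eventually hev, self_mem_nhdsWithin] with t ht ht0 x
  have ht0 : (t : ℂ) ≠ 0 := by exact_mod_cast ht0
  set y := pencil A (c + t) x with hy
  have hx : x = Ring.inverse (pencil A (c + t)) y := by
    rw [hy, ← mul_apply_eq_comp, Ring.inverse_mul_cancel _ ht.1]; rfl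
  conv_lhs => rw [hx, ht.2]
  rw [add_apply, sum_apply, sub_apply, hD]
  simp only [sum_apply]
  rw [add_sub_left_comm, add_comm]
  congr 1
  rw [← Finset.sum_sub_distrib]
  refine Finset.sum_congr rfl fun k _ => ?_
  rw [inner_seqPoly_left, inv_pow_mul_seqPoly_smul _ _ _ ht0, add_sub_cancel_left c (t : ℂ)]
  have e2 : ∑ r ∈ Finset.range (S.p k + 1), ∑ i ∈ Finset.range r,
        (t : ℂ) ^ i • inner ℂ (z k (S.p k + 1 - r + i)) y • S.w k r
      - ∑ r ∈ Finset.range (S.p k + 1), ∑ i ∈ Finset.range r,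
        ((t : ℂ) ^ i • (innerSL ℂ (z k (S.p k + 1 - r + i))).smulRight (S.w k r)) y = 0 := by
    rw [sub_eq_zero]
    rfl
  rw [add_sub_assoc, e2, add_zero]
  refine Finset.sum_congr rfl fun s _ => ?_
  rw [smul_apply, sum_apply]
  rfl

variable {A : Fin (n + 1) → H →L[ℂ] H} {c : ℝ} {S : ChainSystem H} {z : Fin S.num → ℕ → H}

/-- Inserting the chain polynomial of `w k` into the inversion formula shows that `t^{-(pⱼ+1)}`
times the defect from biorthogonality stays bounded; hence the defect tends to `0`. -/
lemma IsAdjointSystem.inner_chainImage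
    (hch : ∀ k, ∀ s ≤ S.p k, seqAct A c (S.w k) s = 0)
    (hli : LinearIndependent ℂ fun k => S.w k 0) (hadj : IsAdjointSystem A c S z)
    (j k : Fin S.num) :
    inner ℂ (z j 0) (chainImage A c (S.p k) (S.w k) 0) = if j = k then 1 else 0 := by
  obtain ⟨R, R₀, hR, hev⟩ := hadj.exists_eq
  set N := fun j => S.p j + 1
  set g : ℝ → H := fun t => seqPoly (n + 1) (chainImage A c (S.p k) (S.w k)) t with hg
  have hglim : Tendsto g (𝓝[≠] 0) (𝓝 (chainImage A c (S.p k) (S.w k) 0)) :=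
    tendsto_seqPoly (Nat.succ_pos n) _
  set β : Fin S.num → ℝ → ℂ := fun j t => ((t : ℂ) ^ N j)⁻¹ *
    (inner ℂ (seqPoly (N j) (z j) t) (g t) - if j = k then 1 else 0) with hβ
  have hRg : Tendsto (fun t => -R t (g t)) (𝓝[≠] 0)
      (𝓝 (-R₀ (chainImage A c (S.p k) (S.w k) 0))) :=
    ((isBoundedBilinearMap_apply.continuous.tendsto (R₀, _)).comp (hR.prodMk_nhds hglim)).neg
  obtain ⟨C, hC⟩ := isBounded_coeff_of_linearIndependent hli
    (f := fun j t => seqPoly (N j) (S.w j) t) (fun j => tendsto_seqPoly (Nat.succ_pos _) _)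
    (β := β) hRg (by
      filter_upwards [hev, self_mem_nhdsWithin] with t ht ht0
      have ht0 : (t : ℂ) ≠ 0 := by exact_mod_cast ht0
      have h1 := ht (seqPoly (N k) (S.w k) t)
      rw [pencil_seqPoly_of_chain (hch k)] at h1
      have h2 : ∀ a : ℂ, a ≠ 0 → ∀ x y v : H, x = y + a • v → -v = a⁻¹ • (y - x) := by
        rintro a ha x y v rfl
        rw [sub_add_cancel_left, smul_neg, smul_smul, inv_mul_cancel₀ ha, one_smul]
      rw [map_smul] at h1
      rw [h2 _ (pow_ne_zero _ ht0) _ _ _ h1]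
      have h3 : seqPoly (N k) (S.w k) (t : ℂ) = ∑ j, (if j = k then (1 : ℂ) else 0) •
          seqPoly (N j) (S.w j) (t : ℂ) := by simp
      rw [h3, ← Finset.sum_sub_distrib, Finset.smul_sum]
      refine Finset.sum_congr rfl fun j _ => ?_
      rw [← sub_smul, smul_smul, inner_smul_right]
      congr 1
      rw [hβ]
      by_cases hjk : j = k
      · subst hjk
        have := pow_ne_zero (S.p j + 1) ht0
        simp only [if_true, N]
        field_simp
        rfl
      · simp only [hjk, if_false, sub_zero]
        have := pow_ne_zero (S.p j + 1) ht0
        have := pow_ne_zero (S.p k + 1) ht0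
        simp only [N]
        field_simp
        rfl)
  have h1 := tendsto_zero_of_mul_bounded (hC.mono fun t h => h j) (Nat.succ_ne_zero (S.p j))
  have h2 : Tendsto (fun t : ℝ => inner ℂ (seqPoly (N j) (z j) t) (g t) - if j = k then (1 : ℂ) else 0)
      (𝓝[≠] 0) (𝓝 (inner ℂ (z j 0) (chainImage A c (S.p k) (S.w k) 0)
        - if j = k then (1 : ℂ) else 0)) :=
    ((tendsto_seqPoly (Nat.succ_pos _) _).inner hglim).sub_const _
  refine sub_eq_zero.1 (tendsto_nhds_unique h2 (h1.congr' ?_))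
  filter_upwards [self_mem_nhdsWithin] with t ht
  have ht : (t : ℂ) ≠ 0 := by exact_mod_cast ht
  exact mul_inv_cancel_left₀ (pow_ne_zero _ ht) _

lemma ofReal_add_ofReal_pencil (A : Fin (n + 1) → H →L[ℂ] H) (c t : ℝ) :
    pencil A ((c : ℂ) + t) = pencil A ((c + t : ℝ) : ℂ) := by push_cast; rfl

/-- For a fixed vector `y` the singular coefficients in the inversion formula are bounded, so `(A y,
z k)` is `O(t^{pₖ+1})` along the polynomial of `z k`: the chain equations of the adjoint pencil. -/
lemma IsAdjointSystem.seqAct_negAdjoint [CompleteSpace H]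
    (hli : LinearIndependent ℂ fun k => S.w k 0) (hadj : IsAdjointSystem A c S z)
    (k : Fin S.num) {s : ℕ} (hs : s ≤ S.p k) : seqAct (negAdjoint A) c (z k) s = 0 := by
  obtain ⟨R, R₀, hR, hev⟩ := hadj.exists_eq
  rw [← seqAct_truncSeq (N := S.p k + 1) _ _ _ (by omega)]
  refine ext_inner_right ℂ fun y => ?_
  rw [inner_zero_left]
  have hRy : Tendsto (fun t : ℝ => y - R t (pencil A (c + t) y)) (𝓝[≠] 0)
      (𝓝 (y - R₀ (pencil A c y))) := by
    refine tendsto_const_nhds.sub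
      ((isBoundedBilinearMap_apply.continuous.tendsto (R₀, _)).comp (hR.prodMk_nhds ?_))
    exact ((ContinuousLinearMap.apply ℂ H y).continuous.tendsto _).comp (tendsto_pencil_add A c)
  obtain ⟨C, hC⟩ := isBounded_coeff_of_linearIndependent hli
    (f := fun j t => seqPoly (S.p j + 1) (S.w j) t) (fun j => tendsto_seqPoly (Nat.succ_pos _) _)
    (β := fun j t => ((t : ℂ) ^ (S.p j + 1))⁻¹ *
        inner ℂ (seqPoly (S.p j + 1) (z j) t) (pencil A (c + t) y)) hRy (by
      filter_upwards [hev] with t ht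
      exact eq_sub_of_add_eq (ht y).symm)
  have h1 := (tendsto_zero_of_mul_bounded (hC.mono fun t h => h k) one_ne_zero).neg
  rw [neg_zero] at h1
  refine eq_zero_of_tendsto_seqPoly (M := S.p k + 1 + (n + 1)) (e := S.p k)
    (a := fun s => inner ℂ (seqAct (negAdjoint A) c (truncSeq (S.p k + 1) (z k)) s) y)
    (h1.congr' ?_) hs (by omega)
  filter_upwards [self_mem_nhdsWithin] with t ht
  have ht : (t : ℂ) ≠ 0 := by exact_mod_cast ht
  rw [← inner_seqPoly_left, ← pencil_seqPoly, ofReal_add_ofReal_pencil (negAdjoint A) c t,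
    inner_pencil_negAdjoint_left, ← ofReal_add_ofReal_pencil A c t, smul_eq_mul]
  have := pow_ne_zero (S.p k) ht
  rw [pow_succ]
  field_simp

end

/-! ### Expansion of annihilated pole parts in the chains of a system. -/

section Span

variable {H : Type*} [NormedAddCommGroup H] [InnerProductSpace ℂ H] {n : ℕ}
  {A : Fin (n + 1) → H →L[ℂ] H} {c : ℝ} {S : ChainSystem H} {z : Fin S.num → ℕ → H}

lemma differentiable_symbol (A : Fin (n + 1) → H →L[ℂ] H) (x : Fin n → H) :
    Differentiable ℂ (symbol A x) := by
  unfold symbol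
  refine Differentiable.fun_sum fun j _ => Differentiable.fun_sum fun i _ => ?_
  split_ifs <;> fun_prop

lemma sum_smul_polePart_revSeq {E : Type*} [AddCommGroup E] [Module ℂ E] (p : ℕ) (d : ℕ → ℂ)
    (y : ℕ → E) (μ : ℂ) {t : ℂ} (ht : t ≠ 0) {M : ℕ} (hM : p < M) :
    ∑ h ∈ Finset.range (p + 1), d (p - h) • polePart M μ (revSeq h y) (μ + t)
      = ((t ^ (p + 1))⁻¹ * seqPoly (p + 1) d t) • seqPoly (p + 1) y t
        - ∑ h ∈ Finset.range (p + 1),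
            d (p - h) • seqPoly (p + 1 - (h + 1)) (fun r => y (h + 1 + r)) t := by
  have e1 : ∀ h ∈ Finset.range (p + 1), d (p - h) • polePart M μ (revSeq h y) (μ + t)
      = (d (p - h) * (t ^ (h + 1))⁻¹) • seqPoly (p + 1) y t
        - d (p - h) • seqPoly (p + 1 - (h + 1)) (fun r => y (h + 1 + r)) t := by
    intro h hh
    have hh := Finset.mem_range.1 hh
    rw [polePart_of_vanishFrom (revSeq_vanishFrom h y) (by omega), polePart_revSeq hh μ y ht,
      smul_sub, smul_smul]
  rw [Finset.sum_congr rfl e1, Finset.sum_sub_distrib, ← Finset.sum_smul]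
  congr 2
  have e3 := Finset.sum_range_reflect (fun r => t ^ r • d r) (p + 1)
  rw [seqPoly, ← e3, Finset.mul_sum]
  refine Finset.sum_congr rfl fun h hh => ?_
  have hh := Finset.mem_range.1 hh
  have e2 : p + 1 - 1 - h = p - h := by omega
  have e4 : t ^ (p + 1) = t ^ (h + 1) * t ^ (p - h) := by rw [← pow_add]; congr 1; omega
  rw [e2, smul_eq_mul, ← mul_assoc, mul_comm, e4, mul_inv,
    inv_mul_cancel_right₀ (pow_ne_zero _ ht)]

/-- Apply the inversion formula to the pole part itself: the pencil makes it polynomial, and the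
Taylor coefficients of its pairings with the adjoint chains are the required coefficients. The
second clause reads off a vanishing coefficient from the order of that pairing. -/
lemma IsAdjointSystem.exists_eq_sum_revSeq (hadj : IsAdjointSystem A c S z) {M : ℕ} {π : ℕ → H}
    (hM : VanishFrom M π) (hπ : poleAct A c π = 0) :
    ∃ a : Fin S.num → ℕ → ℂ,
      π = ∑ k, ∑ h ∈ Finset.range (S.p k + 1), a k h • revSeq h (S.w k) ∧
      ∀ k, ∀ h ≤ S.p k, Tendsto (fun t : ℝ => ((t : ℂ) ^ (S.p k - h))⁻¹ *
        inner ℂ (seqPoly (S.p k + 1) (z k) t) (pencil A (c + t) (polePart M c π (c + t))))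
        (𝓝[≠] 0) (𝓝 0) → a k h = 0 := by
  obtain ⟨R, R₀, hR, hev⟩ := hadj.exists_eq
  set x := poleData n (c : ℂ) π
  have hsym : ∀ t : ℝ, t ≠ 0 →
      pencil A (c + t) (polePart M c π (c + t)) = symbol A x (c + t) := fun t ht =>
    pencil_polePart hM hπ (by simpa using ht)
  have han : ∀ k, AnalyticAt ℂ (fun t : ℂ => ∑ s ∈ Finset.range (S.p k + 1),
      t ^ s • innerSL ℂ (z k s) (symbol A x (c + t))) 0 := by
    intro k
    have hd := differentiable_symbol A x
    have : Differentiable ℂ (fun t : ℂ => ∑ s ∈ Finset.range (S.p k + 1),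
      t ^ s • innerSL ℂ (z k s) (symbol A x (c + t))) := by fun_prop
    exact this.analyticAt 0
  choose d ρ hρ hd using fun k => exists_taylor (han k) (S.p k + 1)
  have hθ : ∀ k, ∀ t : ℝ, inner ℂ (seqPoly (S.p k + 1) (z k) t) (symbol A x (c + t))
      = seqPoly (S.p k + 1) (d k) t + (t : ℂ) ^ (S.p k + 1) * ρ k t := fun k t => by
    rw [inner_seqPoly_left, ← smul_eq_mul, ← hd]; rfl
  have hρlim : ∀ k, Tendsto (fun t : ℝ => ρ k t) (𝓝[≠] 0) (𝓝 (ρ k 0)) := fun k => by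
    have h1 := (hρ k).continuousAt.tendsto
    exact h1.comp ((Complex.continuous_ofReal.tendsto' 0 0 (by simp)).mono_left nhdsWithin_le_nhds)
  -- The Taylor term `t^{p-h}`, divided by `t^{p+1}`, carries the pole order `h + 1`, which is that
  -- of `revSeq h`.
  refine ⟨fun k h => d k (S.p k - h), ?_, ?_⟩
  · set π' := ∑ k, ∑ h ∈ Finset.range (S.p k + 1), d k (S.p k - h) • revSeq h (S.w k) with hπ'
    set M' := M + ∑ k, (S.p k + 1) with hM'
    have hpM : ∀ k, S.p k + 1 ≤ M' := fun k =>
      (Finset.single_le_sum (f := fun k => S.p k + 1) (fun _ _ => Nat.zero_le _)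
        (Finset.mem_univ k)).trans (Nat.le_add_left _ _)
    have hv : VanishFrom M' (π - π') := fun i hi => by
      rw [Pi.sub_apply, hM i (by omega), hπ', zero_sub, neg_eq_zero]
      refine VanishFrom.sum (fun k _ => VanishFrom.sum fun h hh => VanishFrom.smul ?_ _) i hi
      have := Finset.mem_range.1 hh
      have := hpM k
      exact (revSeq_vanishFrom h _).mono (by omega)
    have hsymlim : Tendsto (fun t : ℝ => symbol A x (c + t)) (𝓝[≠] 0) (𝓝 (symbol A x c)) :=
      ((differentiable_symbol A x).continuous.tendsto _).comp
        ((tendsto_ofReal_add c).mono_right nhdsWithin_le_nhds)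
    -- This expression is the pole part of `π - π'`; having a finite limit, it must have zero
    -- coefficients.
    have hlim : Tendsto (fun t : ℝ => ∑ k, (ρ k t • seqPoly (S.p k + 1) (S.w k) (t : ℂ)
        + ∑ h ∈ Finset.range (S.p k + 1), d k (S.p k - h) •
          seqPoly (S.p k + 1 - (h + 1)) (fun r => S.w k (h + 1 + r)) (t : ℂ))
        + R t (symbol A x (c + t))) (𝓝[≠] 0) (𝓝 (∑ k, (ρ k 0 • S.w k 0
        + ∑ h ∈ Finset.range (S.p k + 1), d k (S.p k - h) •
          seqPoly (S.p k + 1 - (h + 1)) (fun r => S.w k (h + 1 + r)) ((0 : ℝ) : ℂ))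
        + R₀ (symbol A x c))) := by
      refine Tendsto.add (tendsto_finsetSum _ fun k _ => Tendsto.add
        ((hρlim k).smul (tendsto_seqPoly (Nat.succ_pos _) _))
        (tendsto_finsetSum _ fun h _ => Tendsto.const_smul ?_ _))
        ((isBoundedBilinearMap_apply.continuous.tendsto (R₀, _)).comp (hR.prodMk_nhds hsymlim))
      exact ((continuous_seqPoly _ _).tendsto 0).mono_left nhdsWithin_le_nhds
    have h0 := eq_zero_of_tendsto_sum_inv_pow (π - π') M' _ (hlim.congr' ?_)
    · ext i
      by_cases hi : i < M'
      · exact sub_eq_zero.1 (h0 i hi)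
      · exact sub_eq_zero.1 (hv i (not_lt.1 hi))
    · filter_upwards [hev, self_mem_nhdsWithin] with t ht ht0
      have ht0' : (t : ℂ) ≠ 0 := by exact_mod_cast ht0
      have h1 := ht (polePart M c π (c + t))
      rw [hsym t ht0] at h1
      have h2 : ∑ i ∈ Finset.range M', ((t : ℂ) ^ (i + 1))⁻¹ • (π - π') i
          = polePart M' c (π - π') (c + t) := by
        simp [polePart]
      rw [h2, polePart_sub, polePart_of_vanishFrom hM (by omega), h1, hπ', polePart_sum]
      have h3 : ∀ k ∈ (Finset.univ : Finset (Fin S.num)), polePart M' (c : ℂ)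
          (∑ h ∈ Finset.range (S.p k + 1), d k (S.p k - h) • revSeq h (S.w k)) (c + t) = _ :=
        fun k _ => (polePart_sum _ _ _ _ _).trans
          ((Finset.sum_congr rfl fun h _ => polePart_smul _ _ _ _ _).trans
            (sum_smul_polePart_revSeq (S.p k) (d k) (S.w k) c ht0' (hpM k)))
      rw [Finset.sum_congr rfl h3, add_sub_right_comm, ← Finset.sum_sub_distrib]
      congr 1
      refine Finset.sum_congr rfl fun k _ => ?_
      rw [hθ, mul_add, inv_mul_cancel_left₀ (pow_ne_zero _ ht0'), add_smul]
      abel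
  · intro k h hh hlim
    refine eq_zero_of_tendsto_seqPoly (M := S.p k + 1) (e := S.p k - h) ?_ le_rfl (by omega)
    have h1 := (tendsto_ofReal_pow (S.p k + 1 - (S.p k - h))).mul (hρlim k)
    rw [zero_pow (by omega), zero_mul] at h1
    have h2 := hlim.sub h1
    rw [sub_zero] at h2
    refine h2.congr' ?_
    filter_upwards [self_mem_nhdsWithin] with t ht0
    have ht0' : (t : ℂ) ≠ 0 := by exact_mod_cast ht0
    rw [hsym t ht0, hθ, ← inv_pow_mul_pow ht0' (by omega : S.p k - h ≤ S.p k + 1), smul_eq_mul]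
    ring

end Span

/-! ### Middle adjoint vectors modulo the first halves of the chains. -/

section MiddleVectors

variable {H : Type*} [NormedAddCommGroup H] [InnerProductSpace ℂ H] {n : ℕ}
  {A : Fin (n + 1) → H →L[ℂ] H} {c : ℝ} {S : ChainSystem H} {z : Fin S.num → ℕ → H}

lemma IsDissipative.inner_im_nonpos (hA : IsDissipative A) (c t : ℝ) (x : H) :
    (inner ℂ x (pencil A ((c : ℂ) + t) x)).im ≤ 0 := by
  rw [ofReal_add_ofReal_pencil]; exact hA _ _

/-- The span of the pole parts of the first halves of the chains. -/
def halfPole (S : ChainSystem H) : Submodule ℂ (ℕ → H) :=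
  Submodule.span ℂ {π | ∃ (k : Fin S.num) (h : ℕ), 2 * h + 1 ≤ S.p k ∧ π = revSeq h (S.w k)}

lemma map_poleData_halfPole (c : ℂ) (S : ChainSystem H) :
    (halfPole S).map (poleData n c) = halfSpan n c S := by
  rw [halfPole, Submodule.map_span, halfSpan]
  congr 1
  ext x
  constructor
  · rintro ⟨_, ⟨k, h, hh, rfl⟩, rfl⟩
    exact ⟨k, h, hh, (keldysh_eq _ _ _ _).symm⟩
  · rintro ⟨k, h, hh, rfl⟩
    exact ⟨_, ⟨k, h, hh, rfl⟩, (keldysh_eq _ _ _ _).symm⟩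

variable [CompleteSpace H]

/-- Along the adjoint chain, pairing a fixed vector with the pencil on the other side is still `o(t
^ m)`. Thus the first half and the middle of an adjoint chain satisfy the chain equations of the
pencil itself. -/
lemma IsAdjointSystem.seqAct_eq_zero (hA : IsDissipative A)
    (hli : LinearIndependent ℂ fun k => S.w k 0) (hadj : IsAdjointSystem A c S z)
    {k : Fin S.num} {m : ℕ} (hk : S.p k = 2 * m) {s : ℕ} (hs : s ≤ m) :
    seqAct A c (z k) s = 0 := by
  rw [← seqAct_truncSeq (N := S.p k + 1) _ _ _ (by omega)]
  refine ext_inner_right ℂ fun y => ?_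
  rw [inner_zero_left]
  have hg := isChainGerm_of_chain fun s hs => hadj.seqAct_negAdjoint hli k (s := s) hs
  have h1 := (hg.tendsto_inner_right (fun t x => hA.negAdjoint.inner_im_nonpos c t x)
    (tendsto_pencil_add _ _) (tendsto_const_nhds (x := y)) hk.ge).neg
  rw [neg_zero] at h1
  refine eq_zero_of_tendsto_seqPoly (M := S.p k + 1 + (n + 1)) (e := m)
    (a := fun s => inner ℂ (seqAct A c (truncSeq (S.p k + 1) (z k)) s) y)
    (h1.congr' ?_) hs (by omega)
  refine Eventually.of_forall fun t => ?_
  beta_reduce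
  rw [← inner_seqPoly_left, ← pencil_seqPoly, ofReal_add_ofReal_pencil (negAdjoint A) c t,
    inner_pencil_negAdjoint, ofReal_add_ofReal_pencil A c t, smul_eq_mul]
  ring

/-- Expand the initial segment of the adjoint chain in the chains of the system. The off-diagonal
estimates for the adjoint pencil kill every coefficient outside the first halves, apart from middle
vectors of chains of the same length. -/
lemma IsAdjointSystem.exists_revSeq_sub_mem (hA : IsDissipative A)
    (hli : LinearIndependent ℂ fun k => S.w k 0) (hadj : IsAdjointSystem A c S z)
    {k : Fin S.num} {m : ℕ} (hk : S.p k = 2 * m) :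
    ∃ b : Fin S.num → ℂ, (∀ j, S.p j ≠ 2 * m → b j = 0) ∧
      revSeq m (z k) - ∑ j, b j • revSeq m (S.w j) ∈ halfPole S := by
  obtain ⟨a, ha, hvan⟩ := hadj.exists_eq_sum_revSeq (revSeq_vanishFrom m (z k))
    (poleAct_revSeq fun s hs => hadj.seqAct_eq_zero hA hli hk hs)
  have hzero : ∀ j, ∀ h ≤ S.p j, ¬ 2 * h + 1 ≤ S.p j → ¬ (S.p j = 2 * m ∧ h = m) →
      a j h = 0 := by
    intro j h hh h1 h2
    refine hvan j h hh ?_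
    have hgj := isChainGerm_of_chain fun s hs => hadj.seqAct_negAdjoint hli j (s := s) hs
    have hgk := isChainGerm_of_chain fun s hs => hadj.seqAct_negAdjoint hli k (s := s) hs
    -- If `h` is not in the first half of chain `j`, then `2 * (S.p j - h) ≤ S.p j`, as the estimate
    -- requires.
    have l1 := (hgj.tendsto_inner (fun t x => hA.negAdjoint.inner_im_nonpos c t x) hgk
      (h := S.p j - h) (h' := m) (by omega) hk.ge (by omega)).star.neg
    have l2 := (tendsto_ofReal_pow (S.p j + 1 - (S.p j - h))).mul
      (hgj.lim_right.inner (((continuous_seqPoly (S.p k + 1 - (m + 1))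
        fun r => z k (m + 1 + r)).tendsto 0).mono_left nhdsWithin_le_nhds) (𝕜 := ℂ))
    rw [zero_pow (by omega), zero_mul] at l2
    have l3 := l1.add l2
    rw [star_zero, neg_zero, add_zero] at l3
    refine l3.congr' ?_
    filter_upwards [self_mem_nhdsWithin] with t ht0
    have ht0' : (t : ℂ) ≠ 0 := by exact_mod_cast ht0
    have e1 := hgj.apply_eq
    rw [polePart_revSeq (N := S.p k + 1) (by omega) _ _ ht0']
    have e2 : ∀ x, inner ℂ (seqPoly (S.p j + 1) (z j) t) (pencil A (c + t) x)
        = -inner ℂ (pencil (negAdjoint A) (c + t) (seqPoly (S.p j + 1) (z j) t)) x := fun x => by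
      rw [ofReal_add_ofReal_pencil (negAdjoint A) c t, inner_pencil_negAdjoint_left,
        ofReal_add_ofReal_pencil A c t, neg_neg]
    have e3 := pencil_seqPoly_of_chain (fun s hs => hadj.seqAct_negAdjoint hli j (s := s) hs)
      (t : ℂ)
    rw [e2, inner_sub_right, inner_smul_right, star_mul', ← starRingEnd_apply, ← starRingEnd_apply,
      inner_conj_symm]
    nth_rewrite 3 [e3]
    rw [inner_smul_left, ← inv_pow_mul_pow ht0' (by omega)]
    simp only [map_pow, map_inv₀, Complex.conj_ofReal]
    have : (t : ℂ) ^ (S.p j - h + m + 1) = (t : ℂ) ^ (S.p j - h) * (t : ℂ) ^ (m + 1) := by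
      rw [← pow_add]; rfl
    rw [this, mul_inv]
    ring
  refine ⟨fun j => if S.p j = 2 * m then a j m else 0, fun j hj => if_neg hj, ?_⟩
  rw [ha, ← Finset.sum_sub_distrib]
  refine Submodule.sum_mem _ fun j _ => ?_
  beta_reduce
  have hmem : ∀ h, 2 * h + 1 ≤ S.p j → a j h • revSeq h (S.w j) ∈ halfPole S := fun h hh =>
    Submodule.smul_mem _ _ (Submodule.subset_span ⟨j, h, hh, rfl⟩)
  by_cases hj : S.p j = 2 * m
  · rw [if_pos hj, ← Finset.sum_erase_add _ _ (Finset.mem_range.2 (by omega : m < S.p j + 1)),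
      add_sub_cancel_right]
    refine Submodule.sum_mem _ fun h hh => ?_
    obtain ⟨hne, hh⟩ := Finset.mem_erase.1 hh
    have hh := Finset.mem_range.1 hh
    by_cases h1 : 2 * h + 1 ≤ S.p j
    · exact hmem h h1
    · rw [hzero j h (by omega) h1 (by tauto), zero_smul]; exact Submodule.zero_mem _
  · rw [if_neg hj, zero_smul, sub_zero]
    refine Submodule.sum_mem _ fun h hh => ?_
    have hh := Finset.mem_range.1 hh
    by_cases h1 : 2 * h + 1 ≤ S.p j
    · exact hmem h h1
    · rw [hzero j h (by omega) h1 (by tauto), zero_smul]; exact Submodule.zero_mem _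

omit [CompleteSpace H] in
/-- Pairing of the pole part of a chain with the image of another chain. -/
lemma tendsto_inner_polePart_revSeq {y w : ℕ → H} {p h q m N : ℕ} (hN : h < N) (hp : h ≤ p)
    (hw : ∀ s ≤ q, seqAct A c w s = 0) {L : ℂ} (hmq : m ≤ q)
    (hL : Tendsto (fun t : ℝ => ((t : ℂ) ^ (m + h + 1))⁻¹ * inner ℂ (seqPoly (p + 1) y t)
      (pencil A (c + t) (seqPoly (q + 1) w t))) (𝓝[≠] 0) (𝓝 L)) :
    Tendsto (fun t : ℝ => ((t : ℂ) ^ m)⁻¹ * inner ℂ (polePart N c (revSeq h y) (c + t))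
      (pencil A (c + t) (seqPoly (q + 1) w t))) (𝓝[≠] 0) (𝓝 L) := by
  have l2 := (tendsto_ofReal_pow (q + 1 - m)).mul
      ((((continuous_seqPoly (p + 1 - (h + 1)) fun r => y (h + 1 + r)).tendsto 0).mono_left
        nhdsWithin_le_nhds).inner (tendsto_seqPoly (Nat.succ_pos n) (chainImage A c q w)) (𝕜 := ℂ))
  rw [zero_pow (by omega), zero_mul] at l2
  have l3 := hL.sub l2
  rw [sub_zero] at l3
  refine l3.congr' ?_
  filter_upwards [self_mem_nhdsWithin] with t ht0
  have ht0' : (t : ℂ) ≠ 0 := by exact_mod_cast ht0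
  rw [polePart_of_vanishFrom (revSeq_vanishFrom h y) (by omega),
    polePart_revSeq (N := p + 1) (by omega) _ _ ht0', inner_sub_left, inner_smul_left]
  simp only [map_pow, map_inv₀, Complex.conj_ofReal]
  rw [pencil_seqPoly_of_chain hw, inner_smul_right, inner_smul_right,
    ← inv_pow_mul_pow ht0' (by omega : m ≤ q + 1)]
  have : (t : ℂ) ^ (m + h + 1) = (t : ℂ) ^ m * (t : ℂ) ^ (h + 1) := by
    rw [← pow_add]; rfl
  rw [this, mul_inv]
  ring

end MiddleVectors

/-! ### The Gram matrix of chains of odd length and the sign characteristics. -/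

section Gram

variable {H : Type*} [NormedAddCommGroup H] [InnerProductSpace ℂ H] {n : ℕ}
  {A : Fin (n + 1) → H →L[ℂ] H} {c : ℝ} {S : ChainSystem H} {z : Fin S.num → ℕ → H}

/-- First halves are invisible to the leading-order pairing with a chain of length at least `2m +
1`, so relations modulo `halfPole` survive in the limit. -/
lemma tendsto_inner_halfPole (hA : IsDissipative A)
    (hch : ∀ k, ∀ s ≤ S.p k, seqAct A c (S.w k) s = 0) {N : ℕ} (hN : ∀ k, S.p k < N)
    {w : ℕ → H} {q m : ℕ} (hq : 2 * m ≤ q) (hw : ∀ s ≤ q, seqAct A c w s = 0) {π : ℕ → H}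
    (hπ : π ∈ halfPole S) :
    Tendsto (fun t : ℝ => ((t : ℂ) ^ m)⁻¹ * inner ℂ (polePart N c π (c + t))
      (pencil A (c + t) (seqPoly (q + 1) w t))) (𝓝[≠] 0) (𝓝 0) := by
  induction hπ using Submodule.span_induction with
  | mem x hx =>
    obtain ⟨j, h, hh, rfl⟩ := hx
    have := hN j
    refine tendsto_inner_polePart_revSeq (by omega) (by omega : h ≤ S.p j) hw (by omega) ?_
    exact (isChainGerm_of_chain hw).tendsto_inner (fun t x => hA.inner_im_nonpos c t x)
      (isChainGerm_of_chain (hch j)) hq (by omega) (by omega)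
  | zero => simp [polePart]
  | add x y _ _ hx hy =>
    have := hx.add hy
    rw [add_zero] at this
    refine this.congr fun t => ?_
    rw [polePart_add, inner_add_left, mul_add]
  | smul a x _ hx =>
    have := hx.const_mul (starRingEnd ℂ a)
    rw [mul_zero] at this
    refine this.congr fun t => ?_
    rw [polePart_smul, inner_smul_left, mul_left_comm]

lemma tendsto_inner_polePart_middle {y w : ℕ → H} {m N : ℕ} (hN : m < N)
    (hw : ∀ s ≤ 2 * m, seqAct A c w s = 0) :
    Tendsto (fun t : ℝ => ((t : ℂ) ^ m)⁻¹ * inner ℂ (polePart N c (revSeq m y) (c + t))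
      (pencil A (c + t) (seqPoly (2 * m + 1) w t))) (𝓝[≠] 0)
      (𝓝 (inner ℂ (y 0) (chainImage A c (2 * m) w 0))) := by
  refine tendsto_inner_polePart_revSeq hN (by omega : m ≤ 2 * m) hw (by omega) ?_
  refine ((tendsto_seqPoly (Nat.succ_pos (2 * m)) y).inner
    (tendsto_seqPoly (Nat.succ_pos n) (chainImage A c (2 * m) w))).congr' ?_
  filter_upwards [self_mem_nhdsWithin] with t ht0
  have ht0' : (t : ℂ) ≠ 0 := by exact_mod_cast ht0
  have e : m + m + 1 = 2 * m + 1 := by ring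
  rw [pencil_seqPoly_of_chain hw, inner_smul_right, e, inv_mul_cancel_left₀ (pow_ne_zero _ ht0')]

/-- Pair the relation `hb` with the image of chain `k'`. Biorthogonality evaluates the adjoint
vector, the first halves drop out, and the middle vectors produce Gram entries: the Gram matrix is
inverted by the conjugate coefficients. -/
lemma IsAdjointSystem.sum_mul_inner_chainImage (hA : IsDissipative A)
    (hch : ∀ k, ∀ s ≤ S.p k, seqAct A c (S.w k) s = 0)
    (hli : LinearIndependent ℂ fun k => S.w k 0) (hadj : IsAdjointSystem A c S z)
    {k k' : Fin S.num} {m : ℕ} (hk : S.p k = 2 * m) (hk' : S.p k' = 2 * m) {b : Fin S.num → ℂ}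
    (hb : revSeq m (z k) - ∑ j, b j • revSeq m (S.w j) ∈ halfPole S) :
    ∑ j, (starRingEnd ℂ) (b j) * inner ℂ (S.w j 0) (chainImage A c (S.p k') (S.w k') 0)
      = if k = k' then 1 else 0 := by
  set N := ∑ j, (S.p j + 1) with hNdef
  have hN : ∀ j, S.p j < N := fun j =>
    Finset.single_le_sum (f := fun k => S.p k + 1) (fun _ _ => Nat.zero_le _) (Finset.mem_univ j)
  have hw := hch k'
  have hmN : m < N := by have := hN k; omega
  have h0 := hadj.inner_chainImage hch hli k k'
  rw [hk'] at hw h0 ⊢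
  have l1 := tendsto_inner_polePart_middle hmN hw (y := z k)
  have l2 := tendsto_inner_halfPole hA hch hN le_rfl hw hb
  have l3 := tendsto_finsetSum (Finset.univ : Finset (Fin S.num)) fun j _ =>
    (tendsto_inner_polePart_middle hmN hw (y := S.w j)).const_mul ((starRingEnd ℂ) (b j))
  rw [← h0]
  refine (tendsto_nhds_unique l1 ?_).symm
  have l4 := l2.add l3
  rw [zero_add] at l4
  refine l4.congr fun t => ?_
  rw [polePart_sub, polePart_sum, inner_sub_left, sum_inner, mul_sub, Finset.mul_sum]
  simp only [polePart_smul, inner_smul_left, mul_left_comm _ ((starRingEnd ℂ) _), sub_add_cancel]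

lemma IsKernelChainSystem.seqAct_eq_zero {μ : ℂ} (h : IsKernelChainSystem A μ S) (k : Fin S.num)
    {s : ℕ} (hs : s ≤ S.p k) : seqAct A μ (S.w k) s = 0 :=
  ((isChain_iff A μ _ _).1 (h.1 k)).2 s hs


/-- The kernel of the pencil in the space of pole parts. -/
def poleKer (A : Fin (n + 1) → H →L[ℂ] H) (μ : ℂ) : Submodule ℂ (ℕ → H) where
  carrier := {π | poleAct A μ π = 0}
  zero_mem' := by ext i; simp [poleAct]
  add_mem' {x y} hx hy := by
    have hx : poleAct A μ x = 0 := hx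
    have hy : poleAct A μ y = 0 := hy
    have : poleAct A μ (x + y) = poleAct A μ x + poleAct A μ y := by
      ext i; simp [poleAct, Finset.sum_add_distrib]
    change poleAct A μ (x + y) = 0
    rw [this, hx, hy, add_zero]
  smul_mem' a x hx := by
    have hx : poleAct A μ x = 0 := hx
    have : poleAct A μ (a • x) = a • poleAct A μ x := by
      ext i; simp [poleAct, Finset.smul_sum]
    change poleAct A μ (a • x) = 0
    rw [this, hx, smul_zero]

lemma halfPole_le_poleKer {μ : ℂ} (hch : ∀ k, ∀ s ≤ S.p k, seqAct A μ (S.w k) s = 0) :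
    halfPole S ≤ poleKer A μ := by
  refine Submodule.span_le.2 ?_
  rintro _ ⟨k, h, hh, rfl⟩
  exact poleAct_revSeq fun s hs => hch k s (by omega)

/-- Relations modulo the half span between middle vectors can be read off the Keldysh chains. -/
lemma keldysh_sub_mem_halfSpan_iff [NeZero n] (hu : IsUnit (A (Fin.last n))) {μ : ℂ}
    (hch : ∀ k, ∀ s ≤ S.p k, seqAct A μ (S.w k) s = 0) {k : Fin S.num} {y : ℕ → H} {m : ℕ}
    (hk : m ≤ S.p k) (hy : ∀ s ≤ m, seqAct A μ y s = 0) (a : ℂ) :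
    keldysh n μ y m - a • keldysh n μ (S.w k) m ∈ halfSpan n μ S
      ↔ revSeq m y - a • revSeq m (S.w k) ∈ halfPole S := by
  rw [keldysh_eq, keldysh_eq, ← map_smul, ← map_sub, ← map_poleData_halfPole]
  constructor
  · rintro ⟨π, hπ, h⟩
    have h1 : poleAct A μ (revSeq m y - a • revSeq m (S.w k) - π) = 0 :=
      (poleKer A μ).sub_mem ((poleKer A μ).sub_mem (poleAct_revSeq hy)
        ((poleKer A μ).smul_mem _ (poleAct_revSeq fun s hs => hch k s (hs.trans hk))))
        (halfPole_le_poleKer hch hπ)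
    have h2 := poleData_injOn hu h1 (by rw [map_sub, h, sub_self])
    rw [sub_eq_zero.1 h2]
    exact hπ
  · exact fun h => ⟨_, h, rfl⟩

variable [CompleteSpace H]

/-- Regularity supplies the coefficients `ε k` at `k` and `0` elsewhere; since `ε k = ±1` is its own
inverse, the Gram matrix is diagonal with these entries. -/
lemma IsRegularSystem.inner_chainImage [NeZero n] (hu : IsUnit (A (Fin.last n)))
    (hA : IsDissipative A) {ε : Fin S.num → ℤ} (h : IsRegularSystem A c S ε) {k k' : Fin S.num}
    {m : ℕ} (hk : S.p k = 2 * m) (hk' : S.p k' = 2 * m) :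
    inner ℂ (S.w k 0) (chainImage A c (S.p k') (S.w k') 0) = if k = k' then (ε k : ℂ) else 0 := by
  obtain ⟨⟨hker, -⟩, ⟨z, hadj, hz⟩, -⟩ := h
  have hch := fun k s hs => hker.seqAct_eq_zero k (s := s) hs
  obtain ⟨hε, hmem⟩ := hz k m hk
  rw [keldysh_sub_mem_halfSpan_iff hu hch (by omega)
    fun s hs => hadj.seqAct_eq_zero hA hker.2.1 hk hs] at hmem
  classical
  have := hadj.sum_mul_inner_chainImage hA hch hker.2.1 hk hk'
    (b := fun j => if j = k then (ε k : ℂ) else 0) (by simpa using hmem)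
  simp only [apply_ite (starRingEnd ℂ), map_zero, ite_mul, zero_mul, Finset.sum_ite_eq',
    Finset.mem_univ, if_true] at this
  rcases hε with h | h <;> rw [h] at this ⊢
  · simpa using this
  · have : -inner ℂ (S.w k 0) (chainImage A c (S.p k') (S.w k') 0) = if k = k' then (1 : ℂ) else 0 := by
      simpa using this
    rw [neg_eq_iff_eq_neg.1 this]
    split_ifs <;> simp

end Gram

/-! ### The derived vectors of a canonical system form a basis of the root subspace. -/

section Basis

variable {H : Type*} [NormedAddCommGroup H] [InnerProductSpace ℂ H] {n : ℕ}
  {A : Fin (n + 1) → H →L[ℂ] H} {μ : ℂ} {S : ChainSystem H}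

/-- At the largest remaining index only leading vectors `w k 0` occur, and these are independent;
descend from the top. -/
lemma linearIndependent_revSeq (hli : LinearIndependent ℂ fun k => S.w k 0) :
    LinearIndependent ℂ fun x : (k : Fin S.num) × Fin (S.p k + 1) => revSeq x.2 (S.w x.1) := by
  rw [Fintype.linearIndependent_iff]
  intro a ha
  set N := ∑ j, (S.p j + 1) with hNdef
  have hN : ∀ j, S.p j < N := fun j =>
    Finset.single_le_sum (f := fun k => S.p k + 1) (fun _ _ => Nat.zero_le _) (Finset.mem_univ j)
  have key : ∀ d : ℕ, ∀ x : (k : Fin S.num) × Fin (S.p k + 1), N ≤ (x.2 : ℕ) + d → a x = 0 := by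
    intro d
    induction d with
    | zero => intro x hx; have := hN x.1; have := x.2.2; omega
    | succ d ih =>
      rintro ⟨k₀, h₀⟩ hx
      change N ≤ (h₀ : ℕ) + (d + 1) at hx
      by_cases hx' : N ≤ (h₀ : ℕ) + d
      · exact ih _ hx'
      have h1 := congrFun ha h₀
      rw [Finset.sum_apply, Fintype.sum_sigma] at h1
      have h2 : ∀ k, ∑ h : Fin (S.p k + 1), (a ⟨k, h⟩ • revSeq (h : ℕ) (S.w k)) h₀
          = (if hk : (h₀ : ℕ) < S.p k + 1 then a ⟨k, ⟨h₀, hk⟩⟩ else 0) • S.w k 0 := by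
        intro k
        split_ifs with hk
        · rw [Finset.sum_eq_single_of_mem ⟨h₀, hk⟩ (Finset.mem_univ _)]
          · simp [revSeq]
          · intro h _ hne
            have hne : (h : ℕ) ≠ h₀ := fun e => hne (Fin.ext e)
            rcases lt_or_gt_of_ne hne with hlt | hgt
            · simp only [Pi.smul_apply, revSeq, if_neg (not_le.2 hlt), smul_zero]
            · rw [ih ⟨k, h⟩ (by change N ≤ (h : ℕ) + d; omega)]; simp
        · rw [zero_smul]
          refine Finset.sum_eq_zero fun h _ => ?_
          have := h.2
          simp only [Pi.smul_apply, revSeq, if_neg (by omega : ¬ (h₀ : ℕ) ≤ h), smul_zero]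
      simp only at h1
      rw [Finset.sum_congr rfl fun k _ => h2 k] at h1
      have h3 := Fintype.linearIndependent_iff.1 hli _ h1 k₀
      rwa [dif_pos h₀.2] at h3
  exact fun x => key N x (by omega)

lemma linearIndependent_keldysh [NeZero n] (hu : IsUnit (A (Fin.last n)))
    (hch : ∀ k, ∀ s ≤ S.p k, seqAct A μ (S.w k) s = 0)
    (hli : LinearIndependent ℂ fun k => S.w k 0) :
    LinearIndependent ℂ fun x : (k : Fin S.num) × Fin (S.p k + 1) => keldysh n μ (S.w x.1) x.2 := by
  have h1 := linearIndependent_revSeq hli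
  have h2 : LinearIndependent ℂ fun x : (k : Fin S.num) × Fin (S.p k + 1) =>
      (⟨revSeq x.2 (S.w x.1), poleAct_revSeq fun s hs => hch x.1 s (by omega)⟩ : poleKer A μ) :=
    LinearIndependent.of_comp (poleKer A μ).subtype h1
  have h3 := h2.map' ((poleData n μ).domRestrict (poleKer A μ)) (by
    rw [LinearMap.ker_eq_bot']
    rintro ⟨π, hπ⟩ h
    exact Subtype.ext (poleData_injOn hu hπ h))
  simpa [Function.comp_def, ← keldysh_eq] using h3

lemma IsAdjointSystem.span_keldysh [FiniteDimensional ℂ H] [NeZero n]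
    (hu : IsUnit (A (Fin.last n))) {c : ℝ}
    (hch : ∀ k, ∀ s ≤ S.p k, seqAct A c (S.w k) s = 0) {z : Fin S.num → ℕ → H}
    (hadj : IsAdjointSystem A c S z) :
    Submodule.span ℂ (range fun x : (k : Fin S.num) × Fin (S.p k + 1) =>
      keldysh n c (S.w x.1) x.2) = Module.End.maxGenEigenspace (companion A) (c : ℂ) := by
  apply le_antisymm
  · rw [Submodule.span_le]
    rintro _ ⟨⟨k, h⟩, rfl⟩
    simp only [keldysh_eq]
    exact poleData_mem_maxGenEigenspace hu
      (poleAct_revSeq fun s hs => hch k s (by omega)) (revSeq_vanishFrom _ _)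
  · intro x hx
    have h1 := eigenPole_vanishFrom (A := A) hx
    obtain ⟨a, ha, -⟩ := hadj.exists_eq_sum_revSeq h1 (poleAct_eigenPole hu c x)
    rw [← poleData_eigenPole A c x, ha]
    simp only [map_sum, map_smul, ← keldysh_eq]
    refine Submodule.sum_mem _ fun k _ => Submodule.sum_mem _ fun h hh => ?_
    exact Submodule.smul_mem _ _
      (Submodule.subset_span ⟨⟨k, ⟨h, Finset.mem_range.1 hh⟩⟩, rfl⟩)

end Basis

/-! ### Degree and injectivity of the symbol. -/

section SymbolCoeff

variable {H : Type*} [NormedAddCommGroup H] [InnerProductSpace ℂ H] {n : ℕ}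

/-- The coefficients of the polynomial `symbol A x`. -/
def symbolCoeff (A : Fin (n + 1) → H →L[ℂ] H) (x : Fin n → H) (d : ℕ) : H :=
  ∑ j : Fin (n + 1), ∑ i : Fin n, if (i : ℕ) + 1 + d = j then A j (x i) else 0

lemma symbol_eq_seqPoly (A : Fin (n + 1) → H →L[ℂ] H) (x : Fin n → H) (lam : ℂ) :
    symbol A x lam = seqPoly n (symbolCoeff A x) lam := by
  simp only [symbol, seqPoly, symbolCoeff, Finset.smul_sum]
  rw [Finset.sum_comm (s := Finset.range n)]
  refine Finset.sum_congr rfl fun j _ => ?_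
  rw [Finset.sum_comm (s := Finset.range n)]
  refine Finset.sum_congr rfl fun i _ => ?_
  by_cases h : (i : ℕ) < j
  · rw [if_pos h, Finset.sum_eq_single_of_mem ((j : ℕ) - 1 - i) (Finset.mem_range.2 (by omega)),
      if_pos (by omega)]
    intro d _ hd
    rw [if_neg (by omega), smul_zero]
  · rw [if_neg h, Finset.sum_eq_zero]
    intro d _
    rw [if_neg (by omega), smul_zero]

/-- Only data with `i ≥ l` enter, and `j ≤ 2l`, so the exponent `j - 1 - i` is at most `l - 1`. -/
lemma symbolCoeff_eq_zero {l : ℕ} (hn : n = 2 * l) (A : Fin (n + 1) → H →L[ℂ] H) {x : Fin n → H}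
    (hx : ∀ i : Fin n, (i : ℕ) < l → x i = 0) {d : ℕ} (hd : l ≤ d) : symbolCoeff A x d = 0 := by
  refine Finset.sum_eq_zero fun j _ => Finset.sum_eq_zero fun i _ => ?_
  split_ifs with h
  · rw [hx i (by omega), map_zero]
  · rfl

/-- The coefficients form a triangular system in `x` with the invertible leading operator on the
diagonal: degree `n - 1 - i` determines `x i` from the earlier components. -/
lemma eq_zero_of_symbolCoeff_eq_zero {A : Fin (n + 1) → H →L[ℂ] H} (hu : IsUnit (A (Fin.last n)))
    {x : Fin n → H} (h : ∀ d < n, symbolCoeff A x d = 0) : x = 0 := by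
  have key : ∀ k : ℕ, ∀ i : Fin n, (i : ℕ) = k → x i = 0 := by
    intro k
    induction k using Nat.strong_induction_on with
    | _ k ih =>
      rintro i rfl
      have h1 := h (n - 1 - i) (by omega)
      rw [symbolCoeff, Finset.sum_eq_single_of_mem (Fin.last n) (Finset.mem_univ _),
        Finset.sum_eq_single_of_mem i (Finset.mem_univ _),
        if_pos (by rw [Fin.val_last]; omega)] at h1
      · obtain ⟨B, hB⟩ := hu.exists_left_inv
        have : (B * A (Fin.last n)) (x i) = 0 := by rw [mul_apply_eq_comp, h1, map_zero]
        rwa [hB] at this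
      · intro i' _ hi'
        rw [if_neg]
        rw [Fin.val_last]
        intro e
        exact hi' (Fin.ext (by omega))
      · intro j _ hj
        have hj' : (j : ℕ) ≠ n := fun e => hj (Fin.ext e)
        refine Finset.sum_eq_zero fun i' _ => ?_
        split_ifs with e
        · rw [ih i' (by omega) i' rfl, map_zero]
        · rfl
  exact funext fun i => key i i rfl

lemma eq_zero_of_symbol_eventually_eq_zero {A : Fin (n + 1) → H →L[ℂ] H}
    (hu : IsUnit (A (Fin.last n))) {x : Fin n → H} {t₀ : ℂ}
    (h : ∃ᶠ t in 𝓝[≠] t₀, symbol A x t = 0) : x = 0 := by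
  have h1 : ∀ t, symbol A x t = 0 := by
    have han : AnalyticOnNhd ℂ (symbol A x) univ := by
      intro t _
      unfold symbol
      refine Finset.analyticAt_fun_sum _ fun j _ => Finset.analyticAt_fun_sum _ fun i _ => ?_
      split_ifs
      · fun_prop
      · exact analyticAt_const
    have := han.eqOn_zero_of_preconnected_of_frequently_eq_zero isPreconnected_univ
      (mem_univ t₀) h
    exact fun t => this (mem_univ t)
  refine eq_zero_of_symbolCoeff_eq_zero hu fun d hd => ?_
  refine eq_zero_of_tendsto_seqPoly (M := n) (e := n) ?_ hd.le hd
  refine tendsto_const_nhds.congr fun t => ?_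
  rw [← symbol_eq_seqPoly, h1, smul_zero]

end SymbolCoeff

/-! ### Stability of the numerical range condition. -/

section NumericalRange

variable {H : Type*} [NormedAddCommGroup H] [InnerProductSpace ℂ H] [FiniteDimensional ℂ H] {n : ℕ}

/-- By compactness of the unit sphere the form stays nonzero on it for parameters near `t₀`. -/
lemma eventually_eq_zero_of_inner_eq_zero {A : Fin (n + 1) → H →L[ℂ] H} {t₀ : ℝ}
    (h0 : (0 : ℂ) ∉ numericalRange (pencil A (t₀ : ℂ))) :
    ∀ᶠ t : ℝ in 𝓝 0, ∀ u, inner ℂ u (pencil A (t₀ + t) u) = 0 → u = 0 := by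
  have : ProperSpace H := FiniteDimensional.proper ℂ H
  have hc : Continuous fun q : ℝ × H => inner ℂ q.2 (pencil A (t₀ + q.1) q.2) := by
    have := continuous_pencil A
    exact continuous_snd.inner (Continuous.clm_apply (this.comp (by fun_prop)) continuous_snd)
  have h1 : ∀ᶠ t : ℝ in 𝓝 0, ∀ u ∈ Metric.sphere (0 : H) 1,
      inner ℂ u (pencil A (t₀ + t) u) ≠ 0 := by
    refine (isCompact_sphere (0 : H) 1).eventually_forall_of_forall_eventually fun u hu => ?_
    refine hc.continuousAt.eventually_ne ?_
    intro h
    exact h0 ⟨u, by simpa using hu, by simpa using h⟩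
  filter_upwards [h1] with t ht u hu
  by_contra hne
  refine ht (((‖u‖ : ℂ)⁻¹) • u) ?_ ?_
  · simp [norm_smul, hne]
  · rw [map_smul, inner_smul_left, inner_smul_right, hu, mul_zero, mul_zero]

end NumericalRange

/-! ### The scalar rational function and the uniqueness argument. -/

section Uniqueness

variable {H : Type*} [NormedAddCommGroup H] [InnerProductSpace ℂ H] {n : ℕ}

lemma polePart_conj (M : ℕ) (μ : ℂ) (π : ℕ → H) (g : H) (lam : ℂ) :
    inner ℂ (polePart M μ π ((starRingEnd ℂ) lam)) g
      = polePart M ((starRingEnd ℂ) μ) (fun i => inner ℂ (π i) g) lam := by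
  simp [polePart, mul_comm]

lemma poleMul_pow_conj (μ : ℂ) (π : ℕ → H) (g : H) (j i : ℕ) :
    (poleMul ℂ ((starRingEnd ℂ) μ) ^ j) (fun i => inner ℂ (π i) g) i
      = inner ℂ ((poleMul H μ ^ j) π i) g := by
  simp [poleMul_pow_apply, mul_comm]

/-- The scalar function `(A(lam) F(lam), F(conj lam))` of `F = ∑ polePart` is a sum of pole parts
if the first half of the Cauchy data vanishes. -/
lemma inner_symbol_eq_sum_polePart {l : ℕ} (hn : n = 2 * l) (A : Fin (n + 1) → H →L[ℂ] H)
    {Q : Finset ℂ} {π : ℂ → ℕ → H} {M : ℕ} (hM : ∀ μ ∈ Q, VanishFrom M (π μ)) {x : Fin n → H}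
    (hx : ∑ μ ∈ Q, poleData n μ (π μ) = x) (hx0 : ∀ i : Fin n, (i : ℕ) < l → x i = 0) :
    ∃ Γ : ℂ → ℕ → ℂ, ∑ a ∈ Q.image (starRingEnd ℂ), Γ a 0 = 0 ∧
      ∀ lam ∉ Q.image (starRingEnd ℂ), ∑ a ∈ Q.image (starRingEnd ℂ), polePart M a (Γ a) lam
        = inner ℂ (∑ μ ∈ Q, polePart M μ (π μ) ((starRingEnd ℂ) lam)) (symbol A x lam) := by
  set g := symbolCoeff A x
  set γ : ℂ → ℕ → ℕ → ℂ := fun a d i => inner ℂ (π ((starRingEnd ℂ) a) i) (g d) with hγ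
  set Q' := Q.image (starRingEnd ℂ) with hQ'
  have hinj : Function.Injective (starRingEnd ℂ) := (starRingEnd ℂ).injective
  have hsum : ∀ (F : Type _) [AddCommMonoid F] (f : ℂ → F),
      ∑ a ∈ Q', f a = ∑ μ ∈ Q, f ((starRingEnd ℂ) μ) :=
    fun F _ f => Finset.sum_image fun _ _ _ _ h => hinj h
  -- The vanishing data are the first `l` moments of `F`, so `F = O(lam^{-l-1})`: powers of `lam`
  -- below `l` release no polynomial term.
  have hcoef : ∀ i < l, ∀ d, ∑ a ∈ Q', (poleMul ℂ a ^ i) (γ a d) 0 = 0 := by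
    intro i hi d
    rw [hsum]
    simp only [hγ, Complex.conj_conj, poleMul_pow_conj]
    rw [← sum_inner]
    have : ∑ μ ∈ Q, (poleMul H μ ^ i) (π μ) 0 = x ⟨i, by omega⟩ := by
      rw [← hx, Finset.sum_apply]; rfl
    rw [this, hx0 _ hi, inner_zero_left]
  -- Each monomial of the symbol, of degree below `l`, acts on the pole parts by `poleMul`. The
  -- residues cancel by the same moment conditions, which gives decay of order `lam⁻²`.
  refine ⟨fun a => ∑ d ∈ Finset.range l, (poleMul ℂ a ^ d) (γ a d), ?_, ?_⟩
  · simp only [Finset.sum_apply]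
    rw [Finset.sum_comm]
    exact Finset.sum_eq_zero fun d hd => hcoef d (Finset.mem_range.1 hd) d
  · intro lam hlam
    have hγM : ∀ a ∈ Q', ∀ d, VanishFrom M (γ a d) := by
      intro a ha d i hi
      obtain ⟨μ, hμ, rfl⟩ := Finset.mem_image.1 ha
      simp only [hγ, Complex.conj_conj, hM μ hμ i hi, inner_zero_left]
    have h1 : symbol A x lam = ∑ d ∈ Finset.range l, lam ^ d • g d := by
      rw [symbol_eq_seqPoly, seqPoly]
      refine (Finset.sum_subset (Finset.range_subset_range.2 (by omega)) fun d _ hd => ?_).symm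
      rw [symbolCoeff_eq_zero hn A hx0 (by simpa using hd), smul_zero]
    have h2 : ∀ d, ∑ a ∈ Q', polePart M a (γ a d) lam
        = inner ℂ (∑ μ ∈ Q, polePart M μ (π μ) ((starRingEnd ℂ) lam)) (g d) := by
      intro d
      rw [hsum, sum_inner]
      simp only [polePart_conj, hγ, Complex.conj_conj]
    rw [h1, inner_sum]
    simp only [polePart_sum]
    rw [Finset.sum_comm]
    refine Finset.sum_congr rfl fun d hd => ?_
    have hd := Finset.mem_range.1 hd
    rw [inner_smul_right, ← h2, Finset.mul_sum]
    have h3 : ∀ a ∈ Q', polePart M a ((poleMul ℂ a ^ d) (γ a d)) lam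
        = lam ^ d * polePart M a (γ a d) lam
          - ∑ i ∈ Finset.range d, lam ^ (d - 1 - i) * (poleMul ℂ a ^ i) (γ a d) 0 := by
      intro a ha
      have hne : lam ≠ a := fun e => hlam (e ▸ ha)
      have := pow_smul_polePart (hγM a ha d) hne d
      simp only [smul_eq_mul] at this
      rw [this, add_sub_cancel_right]
    rw [Finset.sum_congr rfl h3, Finset.sum_sub_distrib, sub_eq_self, Finset.sum_comm]
    refine Finset.sum_eq_zero fun i hi => ?_
    have hi := Finset.mem_range.1 hi
    rw [← Finset.mul_sum, hcoef i (by omega), mul_zero]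

variable [FiniteDimensional ℂ H]

/-- As `A F` is polynomial, the poles of `(A F, F(conj lam))` are conjugates of points of `Q`, all
in one closed half-plane. The function therefore vanishes on the real axis; near `t₀` this gives `F
= 0`, hence a zero symbol and zero data. -/
theorem sum_poleData_eq_zero_of_sign {l : ℕ} (hn : n = 2 * l) {A : Fin (n + 1) → H →L[ℂ] H}
    (hu : IsUnit (A (Fin.last n))) (hA : IsDissipative A)
    (hrange : ∃ t₀ : ℝ, (0 : ℂ) ∉ numericalRange (pencil A (t₀ : ℂ))) {s : ℝ}
    (hs : s = 1 ∨ s = -1) {Q : Finset ℂ} {π : ℂ → ℕ → H} {M : ℕ}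
    (hM : ∀ μ ∈ Q, VanishFrom M (π μ)) (hπ : ∀ μ ∈ Q, poleAct A μ (π μ) = 0)
    (hQ : ∀ μ ∈ Q, 0 ≤ s * μ.im)
    (hres : ∀ c : ℝ, (c : ℂ) ∈ Q → ∃ r : ℝ, 0 ≤ s * r ∧
      Tendsto (fun t : ℝ => (t : ℂ) * inner ℂ (∑ μ ∈ Q, polePart M μ (π μ) (c + t))
        (pencil A (c + t) (∑ μ ∈ Q, polePart M μ (π μ) (c + t)))) (𝓝[≠] 0) (𝓝 r))
    (hx : ∀ i : Fin n, (i : ℕ) < l → (∑ μ ∈ Q, poleData n μ (π μ)) i = 0) :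
    ∑ μ ∈ Q, poleData n μ (π μ) = 0 := by
  set x := ∑ μ ∈ Q, poleData n μ (π μ) with hxdef
  obtain ⟨Γ, hΓ0, hΓ⟩ := inner_symbol_eq_sum_polePart hn A hM rfl hx
  set Q' := Q.image (starRingEnd ℂ) with hQ'
  have hmem : ∀ t : ℝ, (t : ℂ) ∈ Q' ↔ (t : ℂ) ∈ Q := by
    intro t
    rw [hQ', Finset.mem_image]
    constructor
    · rintro ⟨μ, hμ, e⟩
      have : μ = t := by rw [← Complex.conj_conj μ, e, Complex.conj_ofReal]
      exact this ▸ hμ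
    · exact fun h => ⟨t, h, Complex.conj_ofReal t⟩
  have hAF : ∀ lam ∉ Q, pencil A lam (∑ μ ∈ Q, polePart M μ (π μ) lam) = symbol A x lam := by
    intro lam hlam
    rw [map_sum, hxdef, symbol_sum]
    exact Finset.sum_congr rfl fun μ hμ =>
      pencil_polePart (hM μ hμ) (hπ μ hμ) fun e => hlam (e ▸ hμ)
  have hreal : ∀ t : ℝ, (t : ℂ) ∉ Q → ∑ a ∈ Q', polePart M a (Γ a) t
      = inner ℂ (∑ μ ∈ Q, polePart M μ (π μ) t) (pencil A t (∑ μ ∈ Q, polePart M μ (π μ) t)) := by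
    intro t ht
    rw [hΓ t (by rwa [hmem]), hAF t ht, Complex.conj_ofReal]
  have hoff : ∀ c : ℝ, ∀ᶠ t : ℝ in 𝓝[≠] 0, ((c + t : ℝ) : ℂ) ∉ Q := by
    intro c
    have h1 : ∀ᶠ z in 𝓝[≠] (c : ℂ), z ∉ (Q : Set ℂ) := by
      have := (Q.finite_toSet.subset (sdiff_subset (t := {(c : ℂ)}))).isClosed.isOpen_compl.mem_nhds
        (show (c : ℂ) ∈ ((Q : Set ℂ) \ {(c : ℂ)})ᶜ by simp)
      filter_upwards [nhdsWithin_le_nhds this, self_mem_nhdsWithin] with z hz hne hzQ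
      exact hz ⟨hzQ, hne⟩
    filter_upwards [(tendsto_ofReal_add (c : ℂ)).eventually h1] with t ht
    push_cast
    exact ht
  have hzero := polePart_sum_eq_zero_of_sign hs (Q := Q') (M := M) (Γ := Γ) (fun _ => rfl) hΓ0 (by
      intro a ha
      obtain ⟨μ, hμ, rfl⟩ := Finset.mem_image.1 ha
      have := hQ μ hμ
      rw [Complex.conj_im]; linarith) (by
      intro c hc
      obtain ⟨r, hr, hlim⟩ := hres c ((hmem c).1 hc)
      refine ⟨r, hr, hlim.congr' ?_⟩
      filter_upwards [hoff c] with t ht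
      have := hreal (c + t) ht
      push_cast at this
      rw [this]) (by
      intro t ht
      rw [hreal t (by rwa [← hmem])]
      exact hA t _)
  obtain ⟨t₀, ht₀⟩ := hrange
  refine eq_zero_of_symbol_eventually_eq_zero hu (t₀ := (t₀ : ℂ)) ?_
  refine (tendsto_ofReal_add (t₀ : ℂ)).frequently (Eventually.frequently ?_)
  filter_upwards [hoff t₀, nhdsWithin_le_nhds (eventually_eq_zero_of_inner_eq_zero ht₀)] with t h1 h2
  have h3 := hzero (t₀ + t) (by rwa [hmem])
  rw [hreal _ h1] at h3
  push_cast at h1 h3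
  rw [← hAF _ h1, h2 _ h3, map_zero]

end Uniqueness

/-! ### Residues at real eigenvalues. -/

section Residue

variable {H : Type*} [NormedAddCommGroup H] [InnerProductSpace ℂ H] {n : ℕ}
  {A : Fin (n + 1) → H →L[ℂ] H} {c : ℝ}

/-- The pairing of an admitted pole part with a function regular at `c` contributes no residue,
although the pole may have high order. -/
lemma tendsto_mul_inner_polePart_left (hA : IsDissipative A) {y : ℕ → H} {p h N : ℕ} (hN : h < N)
    (hh : 2 * h ≤ p) (hy : ∀ s ≤ p, seqAct A c y s = 0) {u : ℝ → H} {u₀ : H}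
    (hu : Tendsto u (𝓝[≠] 0) (𝓝 u₀)) :
    Tendsto (fun t : ℝ => (t : ℂ) * inner ℂ (polePart N c (revSeq h y) (c + t))
      (pencil A (c + t) (u t))) (𝓝[≠] 0) (𝓝 0) := by
  have l1 := (isChainGerm_of_chain hy).tendsto_inner_right
    (fun t x => hA.inner_im_nonpos c t x) (tendsto_pencil_add A c) hu hh
  have hAu : Tendsto (fun t : ℝ => pencil A (c + t) (u t)) (𝓝[≠] 0) (𝓝 (pencil A c u₀)) :=
    (isBoundedBilinearMap_apply.continuous.tendsto (pencil A c, u₀)).comp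
      ((tendsto_pencil_add A c).prodMk_nhds hu)
  have l2 := (tendsto_ofReal_pow 1).mul
    ((((continuous_seqPoly (p + 1 - (h + 1)) fun r => y (h + 1 + r)).tendsto 0).mono_left
      nhdsWithin_le_nhds).inner hAu (𝕜 := ℂ))
  rw [zero_pow one_ne_zero, zero_mul] at l2
  have l3 := l1.sub l2
  rw [sub_zero] at l3
  refine l3.congr' ?_
  filter_upwards [self_mem_nhdsWithin] with t ht0
  have ht0' : (t : ℂ) ≠ 0 := by exact_mod_cast ht0
  rw [polePart_of_vanishFrom (revSeq_vanishFrom h y) (by omega),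
    polePart_revSeq (N := p + 1) (by omega) _ _ ht0', inner_sub_left, inner_smul_left]
  simp only [map_pow, map_inv₀, Complex.conj_ofReal]
  rw [pow_one, pow_succ]
  field_simp

lemma tendsto_mul_inner_polePart (hA : IsDissipative A) {y w : ℕ → H} {p q h h' N : ℕ}
    (hN : h < N) (hN' : h' < N) (hh : 2 * h ≤ p) (hh' : 2 * h' ≤ q)
    (hy : ∀ s ≤ p, seqAct A c y s = 0) (hw : ∀ s ≤ q, seqAct A c w s = 0) {L : ℂ}
    (hL : Tendsto (fun t : ℝ => ((t : ℂ) ^ (h' + h + 1))⁻¹ * inner ℂ (seqPoly (p + 1) y t)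
      (pencil A (c + t) (seqPoly (q + 1) w t))) (𝓝[≠] 0) (𝓝 L)) :
    Tendsto (fun t : ℝ => (t : ℂ) * inner ℂ (polePart N c (revSeq h y) (c + t))
      (pencil A (c + t) (polePart N c (revSeq h' w) (c + t)))) (𝓝[≠] 0) (𝓝 L) := by
  have l1 := tendsto_inner_polePart_revSeq hN (by omega) hw (by omega) hL
  have l2 := tendsto_mul_inner_polePart_left hA hN hh hy
    (((continuous_seqPoly (q + 1 - (h' + 1)) fun r => w (h' + 1 + r)).tendsto 0).mono_left
      nhdsWithin_le_nhds)
  have l3 := l1.sub l2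
  rw [sub_zero] at l3
  refine l3.congr' ?_
  filter_upwards [self_mem_nhdsWithin] with t ht0
  have ht0' : (t : ℂ) ≠ 0 := by exact_mod_cast ht0
  rw [polePart_of_vanishFrom (revSeq_vanishFrom h' w) (by omega),
    polePart_revSeq (N := q + 1) (by omega) (c : ℂ) w ht0', map_sub, map_smul, inner_sub_right,
    inner_smul_right, pow_succ]
  field_simp

/-- The residue of `(A F, F)` at a real eigenvalue. -/
lemma exists_residue {S : ChainSystem H} {ε : Fin S.num → ℤ} (hA : IsDissipative A)
    (hch : ∀ k, ∀ s ≤ S.p k, seqAct A c (S.w k) s = 0)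
    (hG : ∀ (k k' : Fin S.num) (m : ℕ), S.p k = 2 * m → S.p k' = 2 * m →
      inner ℂ (S.w k 0) (chainImage A c (S.p k') (S.w k') 0) = if k = k' then (ε k : ℂ) else 0)
    {s : ℤ} {a : (k : Fin S.num) × Fin (S.p k + 1) → ℂ}
    (ha : ∀ x, a x ≠ 0 → 2 * (x.2 : ℕ) ≤ S.p x.1 ∧
      (2 * (x.2 : ℕ) = S.p x.1 → 0 ≤ s * ε x.1)) {N : ℕ}
    (hN : ∀ k, S.p k < N) {π : ℕ → H} (hπ : π = ∑ x, a x • revSeq x.2 (S.w x.1))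
    {u : ℝ → H} {u₀ : H} (hu : Tendsto u (𝓝[≠] 0) (𝓝 u₀)) :
    ∃ r : ℝ, 0 ≤ s * r ∧ Tendsto (fun t : ℝ => (t : ℂ) *
      inner ℂ (polePart N c π (c + t) + u t)
        (pencil A (c + t) (polePart N c π (c + t) + u t))) (𝓝[≠] 0) (𝓝 r) := by
  classical
  have hxN : ∀ x : (k : Fin S.num) × Fin (S.p k + 1), (x.2 : ℕ) < N := fun x => by
    have := hN x.1; omega
  set P : ((k : Fin S.num) × Fin (S.p k + 1)) → ℝ → H :=
    fun x t => polePart N c (revSeq x.2 (S.w x.1)) (c + t) with hP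
  have hPsum : ∀ t : ℝ, polePart N c π (c + t) = ∑ x, a x • P x t := fun t => by
    rw [hπ, polePart_sum]; simp only [polePart_smul, hP]
  -- The limit of a double sum: only the diagonal middle vectors survive, each with its sign
  -- characteristic.
  set B : ((k : Fin S.num) × Fin (S.p k + 1)) → ℂ :=
    fun x => if 2 * (x.2 : ℕ) = S.p x.1 then (ε x.1 : ℂ) else 0 with hB
  have l1 : Tendsto (fun t : ℝ => (t : ℂ) * inner ℂ (∑ x, a x • P x t)
      (pencil A (c + t) (∑ x, a x • P x t))) (𝓝[≠] 0)
      (𝓝 (∑ x, ∑ y, (starRingEnd ℂ) (a x) * a y * if x = y then B x else 0)) := by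
    have : ∀ t : ℝ, (t : ℂ) * inner ℂ (∑ x, a x • P x t) (pencil A (c + t) (∑ x, a x • P x t))
        = ∑ x, ∑ y, (starRingEnd ℂ) (a x) * a y *
          ((t : ℂ) * inner ℂ (P x t) (pencil A (c + t) (P y t))) := by
      intro t
      rw [map_sum, sum_inner, Finset.mul_sum]
      refine Finset.sum_congr rfl fun x _ => ?_
      rw [inner_sum, Finset.mul_sum]
      refine Finset.sum_congr rfl fun y _ => ?_
      rw [map_smul, inner_smul_left, inner_smul_right]
      ring
    simp only [this]
    refine tendsto_finsetSum _ fun x _ => tendsto_finsetSum _ fun y _ => ?_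
    by_cases hx : a x = 0
    · simp [hx]
    by_cases hy : a y = 0
    · simp [hy]
    refine Tendsto.const_mul _ ?_
    refine tendsto_mul_inner_polePart hA (hxN x) (hxN y) (ha x hx).1 (ha y hy).1 (hch _) (hch _) ?_
    by_cases hxy : S.p y.1 = 2 * (y.2 : ℕ) ∧ S.p x.1 = 2 * (x.2 : ℕ) ∧ (y.2 : ℕ) = x.2
    · obtain ⟨e1, e2, e3⟩ := hxy
      have h1 := hG x.1 y.1 x.2 e2 (by omega)
      have h2 : (if x.1 = y.1 then (ε x.1 : ℂ) else 0) = if x = y then B x else 0 := by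
        have : x.1 = y.1 ↔ x = y := by
          constructor
          · obtain ⟨k, h⟩ := x
            obtain ⟨k', h'⟩ := y
            rintro rfl
            congr 1
            exact Fin.ext e3.symm
          · rintro rfl; rfl
        simp only [this, hB, e2, if_true]
      rw [← h2, ← h1]
      refine ((tendsto_seqPoly (Nat.succ_pos (S.p x.1)) (S.w x.1)).inner
        (tendsto_seqPoly (Nat.succ_pos n) (chainImage A c (S.p y.1) (S.w y.1)))).congr' ?_
      filter_upwards [self_mem_nhdsWithin] with t ht0
      have ht0' : (t : ℂ) ≠ 0 := by exact_mod_cast ht0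
      have e : (y.2 : ℕ) + x.2 + 1 = S.p y.1 + 1 := by omega
      rw [pencil_seqPoly_of_chain (hch _), inner_smul_right, e,
        inv_mul_cancel_left₀ (pow_ne_zero _ ht0')]
    · have h2 : (if x = y then B x else 0) = 0 := by
        split_ifs with h
        · subst h
          simp only [hB, ite_eq_right_iff]
          intro h
          exact absurd ⟨h.symm, h.symm, rfl⟩ hxy
        · rfl
      rw [h2]
      exact (isChainGerm_of_chain (hch y.1)).tendsto_inner (fun t x => hA.inner_im_nonpos c t x)
        (isChainGerm_of_chain (hch x.1)) (ha y hy).1 (ha x hx).1 hxy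
  have l2 : Tendsto (fun t : ℝ => (t : ℂ) * inner ℂ (∑ x, a x • P x t) (pencil A (c + t) (u t)))
      (𝓝[≠] 0) (𝓝 0) := by
    have : Tendsto (fun t : ℝ => ∑ x, (starRingEnd ℂ) (a x) *
        ((t : ℂ) * inner ℂ (P x t) (pencil A (c + t) (u t)))) (𝓝[≠] 0) (𝓝 (∑ x : (k : Fin S.num) ×
          Fin (S.p k + 1), 0)) := by
      refine tendsto_finsetSum _ fun x _ => ?_
      by_cases hx : a x = 0
      · simp [hx]
      have := (tendsto_mul_inner_polePart_left hA (hxN x) (ha x hx).1 (hch x.1) hu).const_mul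
        ((starRingEnd ℂ) (a x))
      rwa [mul_zero] at this
    rw [Finset.sum_const_zero] at this
    refine this.congr fun t => ?_
    rw [sum_inner, Finset.mul_sum]
    refine Finset.sum_congr rfl fun x _ => ?_
    rw [inner_smul_left]; ring
  -- The pencil removes the pole, so the remaining pairing of `u` with `A F` is bounded and
  -- disappears after multiplication by `t`.
  have hAF : Tendsto (fun t : ℝ => pencil A (c + t) (polePart N c π (c + t) + u t)) (𝓝[≠] 0)
      (𝓝 (symbol A (poleData n c π) c + pencil A c u₀)) := by
    have h1 : Tendsto (fun t : ℝ => symbol A (poleData n c π) (c + t)) (𝓝[≠] 0)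
        (𝓝 (symbol A (poleData n c π) c)) :=
      ((differentiable_symbol A _).continuous.tendsto _).comp
        ((tendsto_ofReal_add (c : ℂ)).mono_right nhdsWithin_le_nhds)
    have h2 : Tendsto (fun t : ℝ => pencil A (c + t) (u t)) (𝓝[≠] 0) (𝓝 (pencil A c u₀)) :=
      (isBoundedBilinearMap_apply.continuous.tendsto (pencil A c, u₀)).comp
        ((tendsto_pencil_add A c).prodMk_nhds hu)
    refine (h1.add h2).congr' ?_
    filter_upwards [self_mem_nhdsWithin] with t ht0
    have ht0' : (t : ℂ) ≠ 0 := by exact_mod_cast ht0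
    rw [map_add, pencil_polePart (hπ ▸ VanishFrom.sum fun x _ => VanishFrom.smul
      ((revSeq_vanishFrom _ _).mono (hxN x)) _) ?_ (by simpa using ht0')]
    rw [hπ]
    exact (poleKer A (c : ℂ)).sum_mem fun x _ => (poleKer A (c : ℂ)).smul_mem _
      (poleAct_revSeq fun s hs => hch x.1 s (by omega))
  have l3 := (tendsto_ofReal_pow 1).mul (hu.inner hAF (𝕜 := ℂ))
  rw [zero_pow one_ne_zero, zero_mul] at l3
  refine ⟨∑ x, ‖a x‖ ^ 2 * (if 2 * (x.2 : ℕ) = S.p x.1 then (ε x.1 : ℝ) else 0), ?_, ?_⟩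
  · rw [Finset.mul_sum]
    refine Finset.sum_nonneg fun x _ => ?_
    by_cases hx : a x = 0
    · simp [hx]
    split_ifs with h
    · have : (0 : ℝ) ≤ s * ε x.1 := by exact_mod_cast (ha x hx).2 h
      rw [mul_left_comm]
      positivity
    · simp
  · have l4 := (l1.add l2).add l3
    rw [add_zero, add_zero] at l4
    have e : ((∑ x, ‖a x‖ ^ 2 * (if 2 * (x.2 : ℕ) = S.p x.1 then (ε x.1 : ℝ) else 0) : ℝ) : ℂ)
        = ∑ x, ∑ y, (starRingEnd ℂ) (a x) * a y * if x = y then B x else 0 := by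
      push_cast
      refine Finset.sum_congr rfl fun x _ => ?_
      simp only [mul_ite, mul_zero, Finset.sum_ite_eq, Finset.mem_univ, if_true, hB]
      rw [← Complex.conj_mul']
      split_ifs <;> simp
    rw [e]
    refine l4.congr fun t => ?_
    rw [hPsum, pow_one, inner_add_left, map_add, inner_add_right, inner_add_right]
    ring

end Residue

/-! ### Dimensions of independent sums. -/

section Dimension

variable {V : Type*} [AddCommGroup V] [Module ℂ V] [FiniteDimensional ℂ V]

lemma finrank_biSup_of_iSupIndep {ι : Type*} [DecidableEq ι] {W : ι → Submodule ℂ V}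
    (h : iSupIndep W) (s : Finset ι) :
    Module.finrank ℂ (⨆ i ∈ s, W i : Submodule ℂ V) = ∑ i ∈ s, Module.finrank ℂ (W i) := by
  induction s using Finset.induction_on with
  | empty => simp
  | insert i s hi ih =>
    rw [Finset.sum_insert hi, Finset.iSup_insert, ← ih,
      ← Submodule.finrank_sup_add_finrank_inf_eq (W i) (⨆ i ∈ s, W i)]
    have : Disjoint (W i) (⨆ i ∈ s, W i) :=
      (h i).mono_right (iSup₂_mono' fun j hj => ⟨j, show j ≠ i from fun e => hi (e ▸ hj), le_rfl⟩)
    rw [this.eq_bot, finrank_bot, add_zero]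

end Dimension

/-! ### The admitted subspaces: complementary dimensions and injectivity. -/

section RadiationSpace

variable {H : Type*} [NormedAddCommGroup H] [InnerProductSpace ℂ H] {n : ℕ}
  {A : Fin (n + 1) → H →L[ℂ] H}

/-- The coefficient of the highest pole order lies in the kernel of the pencil at `μ`; strip the
orders one by one. -/
lemma eq_zero_of_poleAct_eq_zero {μ : ℂ} (hμ : ¬ IsEigenvalue A μ) {M : ℕ} {π : ℕ → H}
    (hM : VanishFrom M π) (hπ : poleAct A μ π = 0) : π = 0 := by
  induction M with
  | zero => exact funext fun i => hM i (Nat.zero_le i)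
  | succ M ih =>
    refine ih fun i hi => ?_
    rcases hi.eq_or_lt with rfl | hi
    · by_contra h
      refine hμ ⟨_, h, ?_⟩
      have h1 := congrFun hπ M
      rw [poleAct_eq A μ π M (Nat.lt_succ_self n), Finset.sum_range_succ', taylorCoeff_zero,
        Finset.sum_eq_zero, zero_add] at h1
      · exact h1
      · intro r _
        rw [hM _ (by omega), map_zero]
    · exact hM i hi

/-- The contribution of the point `μ` to the Cauchy data of the solutions that are admitted
at `+∞` (`s = 1`) or at `-∞` (`s = -1`). -/
def radiationSpace (A : Fin (n + 1) → H →L[ℂ] H) (S : ℝ → ChainSystem H)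
    (ε : (c : ℝ) → Fin (S c).num → ℤ) (s : ℤ) (μ : ℂ) : Submodule ℂ (Fin n → H) :=
  open Classical in
  if μ.im = 0 then
    if IsEigenvalue A μ then
      Submodule.span ℂ (range fun x : {x : (k : Fin (S μ.re).num) × Fin ((S μ.re).p k + 1) //
        ((x.2 : ℕ) : ℤ) ≤ ((S μ.re).p x.1 + s * ε μ.re x.1) / 2} =>
          keldysh n μ ((S μ.re).w x.1.1) x.1.2)
    else ⊥
  else if 0 < s * μ.im then Module.End.maxGenEigenspace (companion A) μ else ⊥

variable {S : ℝ → ChainSystem H} {ε : (c : ℝ) → Fin (S c).num → ℤ}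

lemma radiationSpace_ofReal {s : ℤ} {c : ℝ} (hc : IsEigenvalue A (c : ℂ)) :
    radiationSpace A S ε s c
      = Submodule.span ℂ (range fun x : {x : (k : Fin (S c).num) × Fin ((S c).p k + 1) //
        ((x.2 : ℕ) : ℤ) ≤ ((S c).p x.1 + s * ε c x.1) / 2} =>
          keldysh n c ((S c).w x.1.1) x.1.2) := by
  rw [radiationSpace, if_pos (Complex.ofReal_im c), if_pos hc]
  rfl

lemma radiationSpace_ofReal_of_not {s : ℤ} {c : ℝ} (hc : ¬ IsEigenvalue A (c : ℂ)) :
    radiationSpace A S ε s c = ⊥ := by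
  rw [radiationSpace, if_pos (Complex.ofReal_im c), if_neg hc]

lemma radiationSpace_of_im_ne_zero {s : ℤ} {μ : ℂ} (hμ : μ.im ≠ 0) :
    radiationSpace A S ε s μ
      = if 0 < s * μ.im then Module.End.maxGenEigenspace (companion A) μ else ⊥ := by
  rw [radiationSpace, if_neg hμ]

lemma eq_ofReal_re {μ : ℂ} (hμ : μ.im = 0) : μ = (μ.re : ℂ) :=
  Complex.ext rfl (by rw [hμ, Complex.ofReal_im])

lemma IsRegularSystem.even_or_odd {c : ℝ} {S : ChainSystem H} {ε : Fin S.num → ℤ}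
    (h : IsRegularSystem A c S ε) (k : Fin S.num) :
    (∃ m, S.p k = 2 * m ∧ (ε k = 1 ∨ ε k = -1)) ∨ (∃ m, S.p k = 2 * m + 1 ∧ ε k = 0) := by
  obtain ⟨-, ⟨z, -, hz⟩, h0⟩ := h
  rcases Nat.even_or_odd' (S.p k) with ⟨m, hm | hm⟩
  · exact Or.inl ⟨m, hm, (hz k m hm).1⟩
  · exact Or.inr ⟨m, hm, h0 k ⟨m, hm⟩⟩

variable [NeZero n] [FiniteDimensional ℂ H]

lemma maxGenEigenspace_eq_bot (hu : IsUnit (A (Fin.last n))) {μ : ℂ} (hμ : ¬ IsEigenvalue A μ) :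
    Module.End.maxGenEigenspace (companion A) μ = ⊥ := by
  rw [eq_bot_iff]
  intro x hx
  rw [Submodule.mem_bot, ← poleData_eigenPole A μ x,
    eq_zero_of_poleAct_eq_zero hμ (eigenPole_vanishFrom hx) (poleAct_eigenPole hu μ x), map_zero]

lemma radiationSpace_le (hu : IsUnit (A (Fin.last n))) (hreg : IsRegularFamily A S ε) (s : ℤ)
    (μ : ℂ) : radiationSpace A S ε s μ ≤ Module.End.maxGenEigenspace (companion A) μ := by
  by_cases hμ : μ.im = 0
  · rw [eq_ofReal_re hμ]
    by_cases hc : IsEigenvalue A ((μ.re : ℝ) : ℂ)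
    · obtain ⟨⟨hker, -⟩, ⟨z, hadj, -⟩, -⟩ := hreg _ hc
      rw [radiationSpace_ofReal hc,
        ← hadj.span_keldysh hu fun k s hs => hker.seqAct_eq_zero k hs]
      refine Submodule.span_mono ?_
      rintro _ ⟨x, rfl⟩
      exact ⟨x.1, rfl⟩
    · rw [radiationSpace_ofReal_of_not hc]; exact bot_le
  · rw [radiationSpace_of_im_ne_zero hμ]
    split_ifs
    · exact le_rfl
    · exact bot_le

/-- Off the real axis exactly one selection takes the whole root subspace. On it both are spanned by
parts of one basis, and the dimensions are compared by counting indices. -/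
lemma finrank_radiationSpace_add (hu : IsUnit (A (Fin.last n))) (hreg : IsRegularFamily A S ε)
    (μ : ℂ) : Module.finrank ℂ (radiationSpace A S ε 1 μ)
      + Module.finrank ℂ (radiationSpace A S ε (-1) μ)
      = Module.finrank ℂ (Module.End.maxGenEigenspace (companion A) μ) := by
  classical
  by_cases hμ : μ.im = 0
  · rw [eq_ofReal_re hμ]
    generalize μ.re = c
    by_cases hc : IsEigenvalue A (c : ℂ)
    · have hr := hreg _ hc
      have hr' := hr
      obtain ⟨⟨hker, -⟩, ⟨z, hadj, -⟩, -⟩ := hr'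
      have hch := fun k s hs => hker.seqAct_eq_zero (s := s) k hs
      have hli := linearIndependent_keldysh hu hch hker.2.1
      have hfr : ∀ s : ℤ, Module.finrank ℂ (radiationSpace A S ε s c)
          = Fintype.card {x : (k : Fin (S c).num) × Fin ((S c).p k + 1) //
            ((x.2 : ℕ) : ℤ) ≤ ((S c).p x.1 + s * ε c x.1) / 2} := fun s => by
        rw [radiationSpace_ofReal hc]
        exact finrank_span_eq_card (hli.comp _ Subtype.val_injective)
      rw [hfr, hfr, ← hadj.span_keldysh hu hch, finrank_span_eq_card hli]
      -- Reversal `h ↦ p - h` inside each chain matches the indices admitted at `-∞` with those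
      -- rejected at `+∞`; the floor is checked in the cases of odd length with sign `±1` and of
      -- even length.
      have e : {x : (k : Fin (S c).num) × Fin ((S c).p k + 1) //
            ((x.2 : ℕ) : ℤ) ≤ ((S c).p x.1 + (-1 : ℤ) * ε c x.1) / 2} ≃
          {x : (k : Fin (S c).num) × Fin ((S c).p k + 1) //
            ¬ ((x.2 : ℕ) : ℤ) ≤ ((S c).p x.1 + 1 * ε c x.1) / 2} := by
        refine (Equiv.sigmaCongrRight fun k => Fin.revPerm).subtypeEquiv ?_
        rintro ⟨k, h⟩
        have h1 : ((Fin.rev h : Fin _) : ℕ) = (S c).p k - h := by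
          rw [Fin.val_rev]; omega
        have h2 := h.2
        change ((h : ℕ) : ℤ) ≤ ((S c).p k + (-1 : ℤ) * ε c k) / 2 ↔
          ¬ ((Fin.rev h : ℕ) : ℤ) ≤ ((S c).p k + 1 * ε c k) / 2
        rw [h1]
        rcases hr.even_or_odd k with ⟨m, hm, h3 | h3⟩ | ⟨m, hm, h3⟩ <;> rw [h3] <;> omega
      rw [Fintype.card_congr e, Fintype.card_subtype_compl]
      exact Nat.add_sub_cancel' (Fintype.card_subtype_le _)
    · rw [radiationSpace_ofReal_of_not hc, radiationSpace_ofReal_of_not hc,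
        maxGenEigenspace_eq_bot hu hc]
      simp
  · rw [radiationSpace_of_im_ne_zero hμ, radiationSpace_of_im_ne_zero hμ]
    rcases lt_or_gt_of_ne hμ with h | h
    · rw [if_neg (by push_cast; linarith), if_pos (by push_cast; linarith)]
      simp
    · rw [if_pos (by push_cast; linarith), if_neg (by push_cast; linarith)]
      simp

/-- The admission rule is what the residue formula needs: only `2h ≤ p` occurs, and a middle vector
only when its sign agrees with `s`. -/
lemma eq_zero_of_mem_iSup_radiationSpace {l : ℕ} (hn : n = 2 * l) (hu : IsUnit (A (Fin.last n)))
    (hA : IsDissipative A)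
    (hrange : ∃ t₀ : ℝ, (0 : ℂ) ∉ numericalRange (pencil A (t₀ : ℂ)))
    (hreg : IsRegularFamily A S ε) {s : ℤ} (hs : s = 1 ∨ s = -1) {x : Fin n → H}
    (hx : x ∈ ⨆ μ, radiationSpace A S ε s μ) (hx0 : ∀ i : Fin n, (i : ℕ) < l → x i = 0) :
    x = 0 := by
  classical
  obtain ⟨f, hf, rfl⟩ := (Submodule.mem_iSup_iff_exists_finsupp _ _).1 hx
  have hfm : ∀ μ, f μ ∈ Module.End.maxGenEigenspace (companion A) μ := fun μ =>
    radiationSpace_le hu hreg s μ (hf μ)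
  have hfp : ∀ μ, poleData n μ (eigenPole A μ (f μ)) = f μ := fun μ => poleData_eigenPole A μ _
  have hsum : f.sum (fun _ y => y) = ∑ μ ∈ f.support, poleData n μ (eigenPole A μ (f μ)) := by
    simp only [hfp]; rfl
  rw [hsum] at hx0 ⊢
  refine sum_poleData_eq_zero_of_sign hn hu hA hrange (s := s)
    (by rcases hs with rfl | rfl <;> simp)
    (M := Module.finrank ℂ (Fin n → H)) (fun μ _ => eigenPole_vanishFrom (hfm μ))
    (fun μ _ => poleAct_eigenPole hu μ _) ?_ ?_ hx0
  · intro μ hμ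
    by_contra hneg
    have hne : f μ ≠ 0 := Finsupp.mem_support_iff.1 hμ
    have him : μ.im ≠ 0 := by rintro h; rw [h] at hneg; simp at hneg
    have := hf μ
    rw [radiationSpace_of_im_ne_zero him, if_neg (by linarith)] at this
    exact hne this
  · intro c hc
    have hne : f c ≠ 0 := Finsupp.mem_support_iff.1 hc
    have hfc := hf c
    have hev : IsEigenvalue A (c : ℂ) := by
      by_contra h
      rw [radiationSpace_ofReal_of_not h] at hfc
      exact hne hfc
    have hr := hreg c hev
    have hker := hr.1.1
    have hch := fun k s hs => hker.seqAct_eq_zero (s := s) k hs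
    rw [radiationSpace_ofReal hev, Submodule.mem_span_range_iff_exists_fun] at hfc
    obtain ⟨b, hb⟩ := hfc
    set a : (k : Fin (S c).num) × Fin ((S c).p k + 1) → ℂ := fun x =>
      if hx : ((x.2 : ℕ) : ℤ) ≤ ((S c).p x.1 + s * ε c x.1) / 2 then b ⟨x, hx⟩ else 0 with ha
    have hπ : eigenPole A c (f c) = ∑ x, a x • revSeq x.2 ((S c).w x.1) := by
      have h1 : poleAct A c (∑ x, a x • revSeq x.2 ((S c).w x.1)) = 0 :=
        (poleKer A (c : ℂ)).sum_mem fun x _ => (poleKer A (c : ℂ)).smul_mem _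
          (poleAct_revSeq fun s hs => hch x.1 s (by omega))
      refine sub_eq_zero.1 (poleData_injOn hu (μ := c)
        ((poleKer A (c : ℂ)).sub_mem (poleAct_eigenPole hu c _) h1) ?_)
      rw [map_sub, hfp, ← hb, map_sum, sub_eq_zero]
      simp only [map_smul, ← keldysh_eq]
      have h2 := Finset.sum_subtype (Finset.univ.filter fun x : (k : Fin (S c).num) ×
        Fin ((S c).p k + 1) => ((x.2 : ℕ) : ℤ) ≤ ((S c).p x.1 + s * ε c x.1) / 2)
        (p := fun x => ((x.2 : ℕ) : ℤ) ≤ ((S c).p x.1 + s * ε c x.1) / 2)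
        (F := inferInstance) (fun x => by simp) fun x => a x • keldysh n (c : ℂ) ((S c).w x.1) x.2
      rw [Finset.sum_filter] at h2
      have h3 : ∀ x : (k : Fin (S c).num) × Fin ((S c).p k + 1),
          (if ((x.2 : ℕ) : ℤ) ≤ ((S c).p x.1 + s * ε c x.1) / 2 then
            a x • keldysh n (c : ℂ) ((S c).w x.1) x.2 else 0)
          = a x • keldysh n (c : ℂ) ((S c).w x.1) x.2 := fun x => by
        split_ifs with h
        · rfl
        · simp only [ha, dif_neg h, zero_smul]
      rw [Finset.sum_congr rfl fun x _ => h3 x] at h2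
      rw [h2]
      exact Finset.sum_congr rfl fun x _ => by simp only [ha, dif_pos x.2]
    have hadm : ∀ x, a x ≠ 0 → 2 * (x.2 : ℕ) ≤ (S c).p x.1 ∧
        (2 * (x.2 : ℕ) = (S c).p x.1 → 0 ≤ s * ε c x.1) := by
      intro x hx
      have h1 : ((x.2 : ℕ) : ℤ) ≤ ((S c).p x.1 + s * ε c x.1) / 2 := by
        by_contra h
        exact hx (dif_neg h)
      rcases hs with rfl | rfl <;>
        rcases hr.even_or_odd x.1 with ⟨m, hm, h3 | h3⟩ | ⟨m, hm, h3⟩ <;> rw [h3] at h1 ⊢ <;> omega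
    -- Pole parts at other points are continuous at `c` and serve as the regular summand in
    -- `exists_residue`.
    have hu' : Tendsto (fun t : ℝ => ∑ μ ∈ f.support.erase (c : ℂ),
        polePart (Module.finrank ℂ (Fin n → H)) μ (eigenPole A μ (f μ)) (c + t)) (𝓝[≠] 0)
        (𝓝 (∑ μ ∈ f.support.erase (c : ℂ),
        polePart (Module.finrank ℂ (Fin n → H)) μ (eigenPole A μ (f μ)) (c + (0 : ℝ)))) :=
      tendsto_finsetSum _ fun μ hμ =>
        (continuousAt_polePart _ _ (Finset.ne_of_mem_erase hμ)).tendsto.mono_left nhdsWithin_le_nhds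
    obtain ⟨r, hr0, hr1⟩ := exists_residue hA hch
      (fun k k' m hk hk' => hr.inner_chainImage hu hA hk hk') hadm
      (fun k => lt_finrank_of_seqAct hu (((isChain_iff A _ _ _).1 (hker.1 k)).1) (hch k)) hπ hu'
    refine ⟨r, hr0, hr1.congr fun t => ?_⟩
    rw [Finset.add_sum_erase _ (fun μ =>
      polePart (Module.finrank ℂ (Fin n → H)) μ (eigenPole A μ (f μ)) (c + t)) hc]

end RadiationSpace

/-! ### Existence and uniqueness for the half-range problem. -/

section HalfRangeProblem

variable {H : Type*} [NormedAddCommGroup H] [InnerProductSpace ℂ H] [FiniteDimensional ℂ H] {n : ℕ}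
  [NeZero n] {A : Fin (n + 1) → H →L[ℂ] H} {S : ℝ → ChainSystem H}
  {ε : (c : ℝ) → Fin (S c).num → ℤ}

lemma finrank_iSup_radiationSpace_add (hu : IsUnit (A (Fin.last n)))
    (hreg : IsRegularFamily A S ε) :
    Module.finrank ℂ (⨆ μ, radiationSpace A S ε 1 μ : Submodule ℂ (Fin n → H))
      + Module.finrank ℂ (⨆ μ, radiationSpace A S ε (-1) μ : Submodule ℂ (Fin n → H))
      = n * Module.finrank ℂ H := by
  classical
  set W := Module.End.maxGenEigenspace (companion A) with hW
  have hind : iSupIndep W := Module.End.independent_maxGenEigenspace (companion A)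
  set Q := (WellFoundedGT.finite_ne_bot_of_iSupIndep hind).toFinset with hQ
  have hsup : ∀ U : ℂ → Submodule ℂ (Fin n → H), (∀ μ, U μ ≤ W μ) →
      ⨆ μ, U μ = ⨆ μ ∈ Q, U μ := by
    intro U hU
    refine le_antisymm (iSup_le fun μ => ?_) (iSup₂_le fun μ _ => le_iSup U μ)
    by_cases hμ : μ ∈ Q
    · exact le_biSup U hμ
    · have : W μ = ⊥ := by simpa [hQ] using hμ
      exact (hU μ).trans (this ▸ bot_le)
  have hle := radiationSpace_le hu hreg
  have htop : Module.finrank ℂ (⨆ μ, W μ : Submodule ℂ (Fin n → H)) = n * Module.finrank ℂ H := by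
    rw [hW, Module.End.iSup_maxGenEigenspace_eq_top, finrank_top, Module.finrank_pi_fintype]
    simp
  rw [← htop, hsup _ (hle 1), hsup _ (hle (-1)), hsup W fun _ => le_rfl,
    finrank_biSup_of_iSupIndep (hind.mono (hle 1)), finrank_biSup_of_iSupIndep (hind.mono (hle (-1))),
    finrank_biSup_of_iSupIndep hind, ← Finset.sum_add_distrib]
  exact Finset.sum_congr rfl fun μ _ => finrank_radiationSpace_add hu hreg μ

/-- Both radiation spaces inject into the first `l` data, of dimension `l dim H`, and their
dimensions add up to twice that. So both injections are onto, though only `s = 1` is wanted. -/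
lemma exists_mem_iSup_radiationSpace {l : ℕ} (hn : n = 2 * l) (hu : IsUnit (A (Fin.last n)))
    (hA : IsDissipative A)
    (hrange : ∃ t₀ : ℝ, (0 : ℂ) ∉ numericalRange (pencil A (t₀ : ℂ)))
    (hreg : IsRegularFamily A S ε) (φ : Fin l → H) :
    ∃ x ∈ ⨆ μ, radiationSpace A S ε 1 μ, ∀ j : Fin l, x (Fin.castLE (by omega) j) = φ j := by
  set P : (Fin n → H) →ₗ[ℂ] (Fin l → H) :=
    LinearMap.funLeft ℂ H (Fin.castLE (by omega : l ≤ n)) with hP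
  have hinj : ∀ s : ℤ, s = 1 ∨ s = -1 →
      Function.Injective (P.domRestrict (⨆ μ, radiationSpace A S ε s μ)) := by
    intro s hs
    rw [← LinearMap.ker_eq_bot, LinearMap.ker_eq_bot']
    rintro ⟨x, hx⟩ h
    refine Subtype.ext (eq_zero_of_mem_iSup_radiationSpace hn hu hA hrange hreg hs hx ?_)
    exact fun i hi => congrFun h ⟨i, hi⟩
  have hl : Module.finrank ℂ (Fin l → H) = l * Module.finrank ℂ H := by
    rw [Module.finrank_pi_fintype]; simp
  have h1 := LinearMap.finrank_le_finrank_of_injective (hinj 1 (Or.inl rfl))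
  have h2 := LinearMap.finrank_le_finrank_of_injective (hinj (-1) (Or.inr rfl))
  have h3 := finrank_iSup_radiationSpace_add hu hreg
  have h4 : n * Module.finrank ℂ H = l * Module.finrank ℂ H + l * Module.finrank ℂ H := by
    rw [hn]; ring
  obtain ⟨⟨x, hx⟩, hx'⟩ := (LinearMap.injective_iff_surjective_of_finrank_eq_finrank
    (by omega)).1 (hinj 1 (Or.inl rfl)) φ
  exact ⟨x, hx, fun j => congrFun hx' j⟩

lemma elementarySolution_eqOn {c : ℂ} (hu : IsUnit (A (Fin.last n))) {y : ℕ → H} {h : ℕ}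
    (hy : ∀ s ≤ h, seqAct A c y s = 0) :
    EqOn (elementarySolution c y h) (fun z => opFlow (companionL A) (keldysh n c y h) z 0)
      (Ici 0) := by
  intro z hz
  rw [elementarySolution_eq, keldysh_eq]
  exact (opFlow_poleData hu (revSeq_vanishFrom h y) (Nat.succ_pos h) (poleAct_revSeq hy) hz 0).symm

omit [NeZero n] in
lemma opFlow_zero_right (A : Fin (n + 1) → H →L[ℂ] H) :
    opFlow (companionL A) (0 : Fin n → H) = 0 := funext fun z => by simp [opFlow]

/-- The Cauchy data whose solution is the sum of a decaying solution and a superposition of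
admitted elementary solutions. -/
def radiatingData (A : Fin (n + 1) → H →L[ℂ] H) (S : ℝ → ChainSystem H)
    (ε : (c : ℝ) → Fin (S c).num → ℤ) : Submodule ℂ (Fin n → H) where
  carrier := {x | ∃ x₀, Tendsto (opFlow (companionL A) x₀) atTop (𝓝 0) ∧
    ∃ v₁ ∈ Submodule.span ℂ (admittedSolutions A S ε),
      EqOn (fun z => opFlow (companionL A) x z 0)
        ((fun z => opFlow (companionL A) x₀ z 0) + v₁) (Ici 0)}
  zero_mem' := by
    refine ⟨0, ?_, 0, Submodule.zero_mem _, fun z _ => by simp⟩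
    rw [opFlow_zero_right]; exact tendsto_const_nhds
  add_mem' := by
    rintro x y ⟨x₀, hx₀, v, hv, hx⟩ ⟨y₀, hy₀, w, hw, hy⟩
    refine ⟨x₀ + y₀, ?_, v + w, Submodule.add_mem _ hv hw, fun z hz => ?_⟩
    · have := hx₀.add hy₀
      rw [add_zero] at this
      exact this.congr fun z => (opFlow_add _ _ _ _).symm
    · have h1 := hx hz
      have h2 := hy hz
      simp only [Pi.add_apply, opFlow_add] at h1 h2 ⊢
      rw [h1, h2]; abel
  smul_mem' := by
    rintro a x ⟨x₀, hx₀, v, hv, hx⟩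
    refine ⟨a • x₀, ?_, a • v, Submodule.smul_mem _ _ hv, fun z hz => ?_⟩
    · have := hx₀.const_smul a
      rw [smul_zero] at this
      exact this.congr fun z => (opFlow_smul _ _ _ _).symm
    · have h1 := hx hz
      simp only [Pi.add_apply, Pi.smul_apply, opFlow_smul] at h1 ⊢
      rw [h1, smul_add]

lemma iSup_radiationSpace_le_radiatingData (hu : IsUnit (A (Fin.last n)))
    (hreg : IsRegularFamily A S ε) :
    ⨆ μ, radiationSpace A S ε 1 μ ≤ radiatingData A S ε := by
  refine iSup_le fun μ => ?_
  by_cases hμ : μ.im = 0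
  · rw [eq_ofReal_re hμ]
    by_cases hc : IsEigenvalue A ((μ.re : ℝ) : ℂ)
    · rw [radiationSpace_ofReal hc, Submodule.span_le]
      rintro _ ⟨⟨x, hx⟩, rfl⟩
      rw [one_mul] at hx
      refine ⟨0, by rw [opFlow_zero_right]; exact tendsto_const_nhds, elementarySolution μ.re
        ((S μ.re).w x.1) x.2, Submodule.subset_span ⟨μ.re, hc, x.1, x.2, hx, rfl⟩, fun z hz => ?_⟩
      have h1 := elementarySolution_eqOn hu (c := (μ.re : ℂ)) (y := (S μ.re).w x.1) (h := x.2)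
        (fun s hs => (hreg _ hc).1.1.seqAct_eq_zero x.1 (by omega)) hz
      simp only [Pi.add_apply, opFlow_zero_right, Pi.zero_apply, zero_add]
      exact h1.symm
    · rw [radiationSpace_ofReal_of_not hc]; exact bot_le
  · rw [radiationSpace_of_im_ne_zero hμ]
    split_ifs with h
    · intro x hx
      refine ⟨x, tendsto_opFlow_of_mem hu (by simpa using h) hx, 0, Submodule.zero_mem _,
        fun z _ => by simp⟩
    · exact bot_le

/-- Subtracting the superposition `v₁` shows that `v₀` is itself a companion flow; since its
derivatives below order `n` decay, its data lie in the root subspaces of the open upper half-plane.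
-/
lemma SatisfiesRadiation.mem_iSup (hu : IsUnit (A (Fin.last n))) (hreg : IsRegularFamily A S ε)
    {v : ℝ → H} (hv : SatisfiesRadiation A S ε v) {x : Fin n → H}
    (hx : EqOn v (fun z => opFlow (companionL A) x z 0) (Ici 0)) :
    x ∈ ⨆ μ, radiationSpace A S ε 1 μ := by
  obtain ⟨v₀, v₁, hvv, hv₁, -, hv₀⟩ := hv
  have h1 : ∃ x₁ ∈ ⨆ μ, radiationSpace A S ε 1 μ,
      EqOn v₁ (fun z => opFlow (companionL A) x₁ z 0) (Ici 0) := by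
    clear hvv
    induction hv₁ using Submodule.span_induction with
    | mem f hf =>
      obtain ⟨c, hc, k, h, hh, rfl⟩ := hf
      have hr := hreg c hc
      have hp : h ≤ (S c).p k := by
        rcases hr.even_or_odd k with ⟨m, hm, h3 | h3⟩ | ⟨m, hm, h3⟩ <;> rw [h3] at hh <;> omega
      refine ⟨keldysh n c ((S c).w k) h, Submodule.mem_iSup_of_mem (c : ℂ) ?_,
        elementarySolution_eqOn hu fun s hs => hr.1.1.seqAct_eq_zero k (hs.trans hp)⟩
      rw [radiationSpace_ofReal hc]
      exact Submodule.subset_span ⟨⟨⟨k, ⟨h, by omega⟩⟩, by rw [one_mul]; exact hh⟩, rfl⟩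
    | zero => exact ⟨0, Submodule.zero_mem _, fun z _ => by rw [opFlow_zero_right]; rfl⟩
    | add f g _ _ hf hg =>
      obtain ⟨x, hx, hfx⟩ := hf
      obtain ⟨y, hy, hgy⟩ := hg
      refine ⟨x + y, Submodule.add_mem _ hx hy, fun z hz => ?_⟩
      simp only [Pi.add_apply, opFlow_add, hfx hz, hgy hz]
    | smul a f _ hf =>
      obtain ⟨x, hx, hfx⟩ := hf
      refine ⟨a • x, Submodule.smul_mem _ _ hx, fun z hz => ?_⟩
      simp only [Pi.smul_apply, opFlow_smul, hfx hz]
  obtain ⟨x₁, hx₁, h1⟩ := h1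
  have h0 : EqOn v₀ (fun z => opFlow (companionL A) (x - x₁) z 0) (Ici 0) := by
    intro z hz
    have e1 := hvv hz
    have e2 := hx hz
    have e3 := h1 hz
    simp only [Pi.add_apply, opFlow_sub, Pi.sub_apply] at e1 e2 e3 ⊢
    rw [← e2, ← e3, e1, add_sub_cancel_right]
  have hlim : Tendsto (opFlow (companionL A) (x - x₁)) atTop (𝓝 0) := by
    rw [tendsto_pi_nhds]
    intro j
    have h2 := (hv₀ j j.2).const_smul ((-Complex.I) ^ (j : ℕ))
    rw [smul_zero] at h2
    refine h2.congr' ?_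
    filter_upwards [eventually_ge_atTop 0] with z hz
    exact cauchyData_of_eqOn h0 j hz
  have h3 := mem_iSup_of_tendsto_opFlow hlim
  rw [coe_companionL] at h3
  have h4 : (⨆ (μ : ℂ) (_ : 0 < μ.im), Module.End.maxGenEigenspace (companion A) μ)
      ≤ ⨆ μ, radiationSpace A S ε 1 μ := by
    refine iSup₂_le fun μ hμ => le_iSup_of_le μ ?_
    rw [radiationSpace_of_im_ne_zero hμ.ne', if_pos (by simpa using hμ)]
  rw [← sub_add_cancel x x₁]
  exact Submodule.add_mem _ (h4 h3) hx₁

theorem existsUnique_halfRangeSolution {l : ℕ} (hn : n = 2 * l) (hu : IsUnit (A (Fin.last n)))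
    (hA : IsDissipative A)
    (hrange : ∃ t₀ : ℝ, (0 : ℂ) ∉ numericalRange (pencil A (t₀ : ℂ)))
    (hreg : IsRegularFamily A S ε) (φ : Fin l → H) :
    ∃ v : ℝ → H, IsHalfRangeSolution A S ε φ v ∧
      ∀ u : ℝ → H, IsHalfRangeSolution A S ε φ u → EqOn u v (Ici 0) := by
  obtain ⟨x, hx, hxφ⟩ := exists_mem_iSup_radiationSpace hn hu hA hrange hreg φ
  set v : ℝ → H := fun z => opFlow (companionL A) x z 0 with hv
  have hvx : EqOn v (fun z => opFlow (companionL A) x z 0) (Ici 0) := fun _ _ => rfl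
  refine ⟨v, ⟨isSolution_of_eqOn hu hvx, fun j => ?_, ?_⟩, ?_⟩
  · rw [← hxφ j]
    have := cauchyData_of_eqOn hvx (Fin.castLE (by omega : l ≤ n) j) le_rfl
    rw [opFlow_zero] at this
    exact this
  · obtain ⟨x₀, hx₀, v₁, hv₁, h⟩ := iSup_radiationSpace_le_radiatingData hu hreg hx
    have hvx₀ : EqOn (fun z => opFlow (companionL A) x₀ z 0)
      (fun z => opFlow (companionL A) x₀ z 0) (Ici 0) := fun _ _ => rfl
    refine ⟨_, v₁, h, hv₁, contDiffOn_of_eqOn hvx₀ n, fun j hj => ?_⟩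
    have h1 := (tendsto_pi_nhds.1 hx₀ ⟨j, hj⟩).const_smul (Complex.I ^ j)
    rw [Pi.zero_apply, smul_zero] at h1
    refine h1.congr' ?_
    filter_upwards [eventually_ge_atTop 0] with z hz
    rw [← cauchyData_of_eqOn hvx₀ ⟨j, hj⟩ hz, smul_smul, ← mul_pow, mul_neg, Complex.I_mul_I, neg_neg,
      one_pow, one_smul]
  · rintro u ⟨hsol, hcau, hrad⟩
    obtain ⟨y, hy⟩ := hsol.exists_eqOn hu
    have hymem := hrad.mem_iSup hu hreg hy
    have hyx : y - x = 0 := by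
      refine eq_zero_of_mem_iSup_radiationSpace hn hu hA hrange hreg (Or.inl rfl)
        (Submodule.sub_mem _ hymem hx) fun i hi => ?_
      have h1 := cauchyData_of_eqOn hy i le_rfl
      have h2 := hcau ⟨i, hi⟩
      have h3 := hxφ ⟨i, hi⟩
      rw [opFlow_zero] at h1
      rw [Pi.sub_apply, ← h1, sub_eq_zero]
      exact h2.trans h3.symm
    rw [sub_eq_zero.1 hyx] at hy
    exact hy

end HalfRangeProblem

/-! ### Adapted sequences and local inversion of the pencil. -/

section Adapted

variable {H : Type*} [NormedAddCommGroup H] [InnerProductSpace ℂ H] {n : ℕ}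

/-- `seqAct` as a linear map. -/
def seqActHom (A : Fin (n + 1) → H →L[ℂ] H) (μ : ℂ) : (ℕ → H) →ₗ[ℂ] (ℕ → H) where
  toFun := seqAct A μ
  map_add' x y := by ext s; simp [seqAct, Finset.sum_add_distrib]
  map_smul' a x := by ext s; simp [seqAct, Finset.smul_sum]

@[simp] lemma seqActHom_apply (A : Fin (n + 1) → H →L[ℂ] H) (μ : ℂ) (y : ℕ → H) :
    seqActHom A μ y = seqAct A μ y := rfl

/-- The sequences whose first `q` terms form a chain or vanish at the beginning. -/
def chainSeqs (A : Fin (n + 1) → H →L[ℂ] H) (μ : ℂ) (q : ℕ) : Submodule ℂ (ℕ → H) :=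
  ⨅ s : Fin q, ((LinearMap.proj (s : ℕ)).comp (seqActHom A μ)).ker

lemma mem_chainSeqs {A : Fin (n + 1) → H →L[ℂ] H} {μ : ℂ} {q : ℕ} {y : ℕ → H} :
    y ∈ chainSeqs A μ q ↔ ∀ s < q, seqAct A μ y s = 0 := by
  simp only [chainSeqs, Submodule.mem_iInf, LinearMap.mem_ker]
  exact ⟨fun h s hs => h ⟨s, hs⟩, fun h s => h s s.2⟩

/-- The leading vectors of the chains of length at least `q`, together with `0`. -/
def chainSpace (A : Fin (n + 1) → H →L[ℂ] H) (μ : ℂ) (q : ℕ) : Submodule ℂ H :=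
  (chainSeqs A μ q).map (LinearMap.proj 0)

lemma mem_chainSpace {A : Fin (n + 1) → H →L[ℂ] H} {μ : ℂ} {q : ℕ} {x : H} :
    x ∈ chainSpace A μ q ↔ ∃ y : ℕ → H, (∀ s < q, seqAct A μ y s = 0) ∧ y 0 = x := by
  simp only [chainSpace, Submodule.mem_map, mem_chainSeqs]; rfl

lemma chainSpace_anti (A : Fin (n + 1) → H →L[ℂ] H) (μ : ℂ) : Antitone (chainSpace A μ) :=
  fun q q' h x hx => by
    rw [mem_chainSpace] at hx ⊢
    obtain ⟨y, hy, rfl⟩ := hx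
    exact ⟨y, fun s hs => hy s (by omega), rfl⟩

lemma chainSpace_zero (A : Fin (n + 1) → H →L[ℂ] H) (μ : ℂ) : chainSpace A μ 0 = ⊤ := by
  rw [eq_top_iff]
  exact fun x _ => mem_chainSpace.2 ⟨fun _ => x, fun s hs => absurd hs (Nat.not_lt_zero s), rfl⟩

lemma chainSpace_one (A : Fin (n + 1) → H →L[ℂ] H) (μ : ℂ) :
    chainSpace A μ 1 = (pencil A μ).ker := by
  have h : ∀ y : ℕ → H, seqAct A μ y 0 = pencil A μ (y 0) := fun y => by
    simp [seqAct, taylorCoeff_zero]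
  ext x
  rw [mem_chainSpace]
  constructor
  · rintro ⟨y, hy, rfl⟩
    have := hy 0 one_pos
    rwa [h] at this
  · intro hx
    refine ⟨fun _ => x, fun s hs => ?_, rfl⟩
    obtain rfl : s = 0 := by omega
    rw [h]; exact hx

lemma chainSpace_eq_bot [FiniteDimensional ℂ H] {A : Fin (n + 1) → H →L[ℂ] H}
    (hu : IsUnit (A (Fin.last n))) [NeZero n] (μ : ℂ) {q : ℕ}
    (hq : Module.finrank ℂ (Fin n → H) < q) : chainSpace A μ q = ⊥ := by
  rw [eq_bot_iff]
  intro x hx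
  obtain ⟨y, hy, rfl⟩ := mem_chainSpace.1 hx
  by_contra hne
  have := lt_finrank_of_seqAct hu hne (p := Module.finrank ℂ (Fin n → H))
    fun s hs => hy s (by omega)
  omega

/-- The Taylor polynomial of `Y` already satisfies the chain equations, since the remainder is too
small to affect them. -/
lemma mem_chainSpace_of_tendsto {A : Fin (n + 1) → H →L[ℂ] H} {μ : ℂ} {q : ℕ} {Y : ℂ → H}
    (hY : AnalyticAt ℂ Y 0)
    (h : Tendsto (fun t : ℝ => ((t : ℂ) ^ q)⁻¹ • pencil A (μ + t) (Y t)) (𝓝[≠] 0) (𝓝 0)) :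
    Y 0 ∈ chainSpace A μ (q + 1) := by
  obtain ⟨a, ρ, hρ, hY'⟩ := exists_taylor hY (q + 1)
  have h0 : a 0 = Y 0 := by
    rw [hY' 0, zero_pow (Nat.succ_ne_zero q), zero_smul, add_zero, seqPoly,
      Finset.sum_eq_single_of_mem 0 (Finset.mem_range.2 (Nat.succ_pos q))]
    · simp
    · intro i _ hi; simp [hi]
  have hρlim : Tendsto (fun t : ℝ => ρ t) (𝓝[≠] 0) (𝓝 (ρ 0)) :=
    hρ.continuousAt.tendsto.comp
      ((Complex.continuous_ofReal.tendsto' 0 0 (by simp)).mono_left nhdsWithin_le_nhds)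
  refine mem_chainSpace.2 ⟨a, fun s hs => ?_, h0⟩
  rw [← seqAct_truncSeq A μ a hs]
  refine eq_zero_of_tendsto_seqPoly (M := q + 1 + (n + 1)) (e := q) ?_ (by omega) (by omega)
  have l1 : Tendsto (fun t : ℝ => pencil A (μ + t) (ρ t)) (𝓝[≠] 0) (𝓝 (pencil A μ (ρ 0))) :=
    (isBoundedBilinearMap_apply.continuous.tendsto (pencil A μ, ρ 0)).comp
      ((tendsto_pencil_add A μ).prodMk_nhds hρlim)
  have l2 := (tendsto_ofReal_pow 1).smul l1
  rw [zero_pow one_ne_zero, zero_smul] at l2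
  have l3 := h.sub l2
  rw [sub_zero] at l3
  refine l3.congr' ?_
  filter_upwards [self_mem_nhdsWithin] with t ht
  have ht : (t : ℂ) ≠ 0 := by exact_mod_cast ht
  rw [← pencil_seqPoly, hY' t, map_add, map_smul, smul_add, smul_smul,
    inv_pow_mul_pow ht (by omega : q ≤ q + 1)]
  simp

/-- Sequences `W i` whose leading vectors form a basis of `H` that is adapted to the filtration by
the lengths of the chains; the first `κ i` terms of `W i` form a chain. -/
structure IsAdapted {ι : Type*} (A : Fin (n + 1) → H →L[ℂ] H) (μ : ℂ) (κ : ι → ℕ)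
    (W : ι → ℕ → H) : Prop where
  seqAct_eq : ∀ i, ∀ s < κ i, seqAct A μ (W i) s = 0
  linearIndependent : LinearIndependent ℂ fun i => W i 0
  le_span : ∀ q, chainSpace A μ q ≤ Submodule.span ℂ ((fun i => W i 0) '' {i | q ≤ κ i})

variable {ι : Type*} {A : Fin (n + 1) → H →L[ℂ] H} {μ : ℂ} {κ : ι → ℕ} {W : ι → ℕ → H}

lemma IsAdapted.smul (h : IsAdapted A μ κ W) {r : ι → ℂ} (hr : ∀ i, r i ≠ 0) :
    IsAdapted A μ κ fun i => r i • W i where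
  seqAct_eq i s hs := by
    have := congrFun ((seqActHom A μ).map_smul (r i) (W i)) s
    simp only [seqActHom_apply] at this
    rw [this, Pi.smul_apply, h.seqAct_eq i s hs, smul_zero]
  linearIndependent := h.linearIndependent.units_smul fun i => Units.mk0 (r i) (hr i)
  le_span q := by
    refine (h.le_span q).trans (Submodule.span_le.2 ?_)
    rintro _ ⟨i, hi, rfl⟩
    have : W i 0 = (r i)⁻¹ • (r i • W i) 0 := by
      rw [Pi.smul_apply, smul_smul, inv_mul_cancel₀ (hr i), one_smul]
    beta_reduce
    rw [this]
    exact Submodule.smul_mem _ _ (Submodule.subset_span ⟨i, hi, rfl⟩)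

lemma IsAdapted.span_eq_top (h : IsAdapted A μ κ W) :
    ⊤ ≤ Submodule.span ℂ (range fun i => W i 0) := by
  rw [← chainSpace_zero A μ]
  exact (h.le_span 0).trans (Submodule.span_mono (image_subset_range _ _))

/-- `t^{-κ i} A(μ + t) ∑_{r ≤ κ i} tʳ W i r`. -/
def adaptedImage (A : Fin (n + 1) → H →L[ℂ] H) (μ : ℂ) (k : ℕ) (w : ℕ → H) (t : ℂ) : H :=
  seqPoly (n + 2) (fun s => seqAct A μ (truncSeq (k + 1) w) (k + s)) t

lemma pencil_seqPoly_adapted {k : ℕ} {w : ℕ → H} (hw : ∀ s < k, seqAct A μ w s = 0) (t : ℂ) :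
    pencil A (μ + t) (seqPoly (k + 1) w t) = t ^ k • adaptedImage A μ k w t := by
  rw [pencil_seqPoly, show k + 1 + (n + 1) = k + (n + 2) by ring, seqPoly_shift]
  · rfl
  · intro r hr
    rw [seqAct_truncSeq _ _ _ (by omega)]
    exact hw r hr

lemma differentiable_seqPoly {E : Type*} [NormedAddCommGroup E] [NormedSpace ℂ E] (M : ℕ)
    (a : ℕ → E) : Differentiable ℂ (seqPoly M a) := by
  unfold seqPoly; fun_prop

variable [Fintype ι]

/-- In a relation among the images let `q` be the largest length that occurs. Aligning the sequences
at order `q` gives a germ whose value at `0` leads a chain of length `q + 1`, yet is a combination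
of basis vectors of length exactly `q`; adaptedness forbids this. -/
lemma IsAdapted.linearIndependent_adaptedImage [CompleteSpace H] (h : IsAdapted A μ κ W) :
    LinearIndependent ℂ fun i => adaptedImage A μ (κ i) (W i) 0 := by
  classical
  rw [Fintype.linearIndependent_iff]
  intro a ha
  have key : ∀ d : ℕ, ∀ i, (∑ j, κ j) < κ i + d → a i = 0 := by
    intro d
    induction d with
    | zero =>
      intro i hi
      have := Finset.single_le_sum (f := κ) (fun _ _ => Nat.zero_le _) (Finset.mem_univ i)
      omega
    | succ d ih =>
      intro i hi
      by_cases hid : (∑ j, κ j) < κ i + d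
      · exact ih i hid
      set q := κ i with hq
      have hz : ∀ j, q < κ j → a j = 0 := fun j hj => ih j (by omega)
      -- The powers `t^{q-κ j}` bring all images to the common order `t ^ q`, and at `t = 0` only
      -- sequences with `κ j = q` remain. For longer ones the truncated exponent is harmless, their
      -- coefficients being zero.
      set Y : ℂ → H := fun t => ∑ j, a j • t ^ (q - κ j) • seqPoly (κ j + 1) (W j) t with hY
      have hYan : AnalyticAt ℂ Y 0 := by
        have hd := fun j => differentiable_seqPoly (κ j + 1) (W j)
        have : Differentiable ℂ Y := by rw [hY]; fun_prop
        exact this.analyticAt 0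
      have hlim : Tendsto (fun t : ℝ => ((t : ℂ) ^ q)⁻¹ • pencil A (μ + t) (Y t)) (𝓝[≠] 0)
          (𝓝 0) := by
        have : Tendsto (fun t : ℝ => ∑ j, a j • adaptedImage A μ (κ j) (W j) t) (𝓝[≠] 0)
            (𝓝 0) := by
          rw [← ha]
          refine tendsto_finsetSum _ fun j _ => Tendsto.const_smul ?_ _
          exact ((continuous_seqPoly _ _).tendsto' 0 _ (by simp [adaptedImage])).mono_left
            nhdsWithin_le_nhds
        refine this.congr' ?_
        filter_upwards [self_mem_nhdsWithin] with t ht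
        have ht : (t : ℂ) ≠ 0 := by exact_mod_cast ht
        rw [hY, map_sum, Finset.smul_sum]
        refine Finset.sum_congr rfl fun j _ => ?_
        by_cases hj : a j = 0
        · simp [hj]
        have hjq : κ j ≤ q := not_lt.1 fun hlt => hj (hz j hlt)
        rw [map_smul, map_smul, pencil_seqPoly_adapted (h.seqAct_eq j), smul_comm _ (a j)]
        congr 1
        rw [smul_smul, smul_smul, mul_assoc, ← pow_add, Nat.sub_add_cancel hjq,
          inv_mul_cancel₀ (pow_ne_zero _ ht), one_smul]
      have hmem := h.le_span _ (mem_chainSpace_of_tendsto hYan hlim)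
      have hY0 : Y 0 = ∑ j, (if κ j = q then a j else 0) • W j 0 := by
        rw [hY]
        refine Finset.sum_congr rfl fun j _ => ?_
        have h0 : seqPoly (κ j + 1) (W j) 0 = W j 0 := by
          rw [seqPoly, Finset.sum_eq_single_of_mem 0 (Finset.mem_range.2 (Nat.succ_pos _))]
          · simp
          · intro i _ hi; simp [hi]
        rw [h0]
        rcases lt_trichotomy (κ j) q with hlt | heq | hgt
        · rw [zero_pow (by omega), zero_smul, smul_zero, if_neg hlt.ne, zero_smul]
        · rw [if_pos heq, heq, Nat.sub_self, pow_zero, one_smul]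
        · rw [hz j hgt, zero_smul, if_neg hgt.ne', zero_smul]
      have hr := h.linearIndependent
      by_contra hne
      have hmem2 : Y 0 ∈ Submodule.span ℂ ((fun i => W i 0) '' {i | κ i = q}) := by
        rw [hY0]
        refine Submodule.sum_mem _ fun j _ => ?_
        split_ifs with hj
        · exact Submodule.smul_mem _ _ (Submodule.subset_span ⟨j, hj, rfl⟩)
        · rw [zero_smul]; exact Submodule.zero_mem _
      have hdisj := hr.disjoint_span_image (s := {i | κ i = q}) (t := {i | q + 1 ≤ κ i})
        (disjoint_left.2 fun i (h1 : κ i = q) (h2 : q + 1 ≤ κ i) => by omega)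
      have hY00 := Submodule.disjoint_def.1 hdisj _ hmem2 hmem
      rw [hY0] at hY00
      have := Fintype.linearIndependent_iff.1 hr _ hY00 i
      rw [if_pos rfl] at this
      exact hne this
  exact fun i => key (∑ j, κ j + 1) i (by omega)

lemma analyticAt_ringInverse {R : Type*} [NormedRing R] [NormedAlgebra ℂ R] [CompleteSpace R]
    {x : R} (hx : IsUnit x) : AnalyticAt ℂ (Ring.inverse : R → R) x := by
  obtain ⟨u, rfl⟩ := hx
  exact (contDiffAt_ringInverse ℂ u (n := ⊤)).analyticAt

variable [FiniteDimensional ℂ H]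

/-- Inversion of the pencil near `μ` in terms of adapted sequences. -/
lemma IsAdapted.exists_inverse (h : IsAdapted A μ κ W) :
    ∃ ζ : ι → ℂ → H →L[ℂ] ℂ, (∀ i, AnalyticAt ℂ (ζ i) 0) ∧
      ∀ᶠ t in 𝓝[≠] (0 : ℂ), IsUnit (pencil A (μ + t)) ∧ Ring.inverse (pencil A (μ + t))
        = ∑ i, (t ^ κ i)⁻¹ • (ζ i t).smulRight (seqPoly (κ i + 1) (W i) t) := by
  have : CompleteSpace H := FiniteDimensional.complete ℂ H
  let b := Module.Basis.mk h.linearIndependent h.span_eq_top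
  set β : ι → H →L[ℂ] ℂ := fun i => LinearMap.toContinuousLinearMap (b.coord i) with hβ
  -- `G t` sends the basis of leading vectors to the adapted images and is invertible at `0`. The
  -- pencil thus factors as `G t`, diagonal powers `t^{κ i}`, and the inverse of the frame of the `W
  -- i`.
  set G : ℂ → H →L[ℂ] H := fun t => ∑ i, (β i).smulRight (adaptedImage A μ (κ i) (W i) t) with hG
  have hGd : Differentiable ℂ G := by
    have : ∀ i, Differentiable ℂ fun t => (β i).smulRight (adaptedImage A μ (κ i) (W i) t) :=
      fun i => ((ContinuousLinearMap.smulRightL ℂ H H (β i)).differentiable).comp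
        (differentiable_seqPoly _ _)
    rw [hG]
    fun_prop
  have hG0 : IsUnit (G 0) := by
    refine isUnit_of_ker_eq_bot (LinearMap.ker_eq_bot'.2 fun x hx => ?_)
    have hx : G 0 x = 0 := hx
    rw [hG, sum_apply] at hx
    have := Fintype.linearIndependent_iff.1 h.linearIndependent_adaptedImage (fun i => β i x) hx
    exact b.ext_elem fun i => by simpa [hβ] using this i
  have hinv : AnalyticAt ℂ (fun t => Ring.inverse (G t)) 0 :=
    (analyticAt_ringInverse hG0).comp (hGd.analyticAt 0)
  have hGev : ∀ᶠ t in 𝓝 (0 : ℂ), IsUnit (G t) :=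
    hGd.continuous.continuousAt.eventually (Units.isOpen.mem_nhds hG0)
  refine ⟨fun i t => (β i).comp (Ring.inverse (G t)), fun i => ?_, ?_⟩
  · exact ((ContinuousLinearMap.compL ℂ H H ℂ (β i)).analyticAt _).comp hinv
  · filter_upwards [nhdsWithin_le_nhds hGev, self_mem_nhdsWithin] with t ht ht0
    have ht0 : t ≠ 0 := ht0
    set Φ := ∑ i, (t ^ κ i)⁻¹ • ((β i).comp (Ring.inverse (G t))).smulRight
      (seqPoly (κ i + 1) (W i) t) with hΦ
    have hmul : pencil A (μ + t) * Φ = 1 := by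
      ext x
      have h1 : (G t * Ring.inverse (G t)) x = x := by rw [Ring.mul_inverse_cancel _ ht]; rfl
      rw [mul_apply_eq_comp, hΦ, sum_apply, map_sum]
      change _ = x
      conv_rhs => rw [← h1, mul_apply_eq_comp, hG, sum_apply]
      refine Finset.sum_congr rfl fun i _ => ?_
      rw [smul_apply, map_smul, ContinuousLinearMap.smulRight_apply, map_smul,
        pencil_seqPoly_adapted (h.seqAct_eq i), smul_comm,
        inv_smul_smul₀ (pow_ne_zero _ ht0)]
      rfl
    have hunit : IsUnit (pencil A (μ + t)) := by
      refine isUnit_of_ker_eq_bot (LinearMap.ker_eq_bot.2 ?_)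
      refine LinearMap.injective_iff_surjective.2 fun x => ⟨Φ x, ?_⟩
      exact congrArg (fun T : H →L[ℂ] H => T x) hmul
    refine ⟨hunit, ?_⟩
    rw [← mul_one (Ring.inverse _), ← hmul, ← mul_assoc, Ring.inverse_mul_cancel _ hunit, one_mul]

end Adapted

/-! ### From adapted sequences to canonical systems with adjoint. -/

section AdaptedSystem

variable {H : Type*} [NormedAddCommGroup H] [InnerProductSpace ℂ H] {n : ℕ} {ι : Type*} [Fintype ι]
  {A : Fin (n + 1) → H →L[ℂ] H} {μ : ℂ} {κ : ι → ℕ} {W : ι → ℕ → H}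

lemma IsAdapted.exists_principalPart [FiniteDimensional ℂ H] (h : IsAdapted A μ κ W) :
    ∃ (z : ι → ℕ → H) (R : ℂ → H →L[ℂ] H), AnalyticAt ℂ R 0 ∧
      ∀ᶠ t in 𝓝[≠] (0 : ℂ), IsUnit (pencil A (μ + t)) ∧ Ring.inverse (pencil A (μ + t))
        = (∑ i, ∑ s ∈ Finset.range (κ i), (t ^ (κ i - s))⁻¹ •
            ∑ r ∈ Finset.range (s + 1), (innerSL ℂ (z i (s - r))).smulRight (W i r)) + R t := by
  have : CompleteSpace H := FiniteDimensional.complete ℂ H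
  obtain ⟨ζ, hζ, hev⟩ := h.exists_inverse
  choose a ρ hρ ha using fun i => exists_taylor (hζ i) (κ i)
  set z : ι → ℕ → H := fun i s => (InnerProductSpace.toDual ℂ H).symm (a i s) with hz
  have hza : ∀ i s, innerSL ℂ (z i s) = a i s := fun i s =>
    (InnerProductSpace.toDual ℂ H).apply_symm_apply (a i s)
  -- The regular part collects the overflow of the convolution, the extra vector `W i (κ i)`, which
  -- lies beyond the chain, and the Taylor remainder of the functionals.
  set R : ℂ → H →L[ℂ] H := fun t => ∑ i,
    (((∑ r ∈ Finset.range (κ i), ∑ j ∈ Finset.range r,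
        t ^ j • (a i (κ i - r + j)).smulRight (W i r))
      + (seqPoly (κ i) (a i) t).smulRight (W i (κ i)))
      + (ρ i t).smulRight (seqPoly (κ i + 1) (W i) t)) with hR
  refine ⟨z, R, ?_, ?_⟩
  · refine Finset.analyticAt_fun_sum _ fun i _ => ((AnalyticAt.fun_add ?_ ?_).fun_add ?_)
    · have : Differentiable ℂ fun t : ℂ => ∑ r ∈ Finset.range (κ i), ∑ j ∈ Finset.range r,
        t ^ j • (a i (κ i - r + j)).smulRight (W i r) := by fun_prop
      exact this.analyticAt 0
    · have h1 := ((ContinuousLinearMap.smulRightL ℂ H H).flip (W i (κ i))).differentiable.comp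
        (differentiable_seqPoly (κ i) (a i))
      exact h1.analyticAt 0
    · exact ((ContinuousLinearMap.smulRightL ℂ H H).analyticAt_bilinear
        (ρ i 0, seqPoly (κ i + 1) (W i) 0)).comp₂ (hρ i)
        ((differentiable_seqPoly (κ i + 1) (W i)).analyticAt 0)
  · filter_upwards [hev, self_mem_nhdsWithin] with t ht ht0
    have ht0 : t ≠ 0 := ht0
    refine ⟨ht.1, ?_⟩
    rw [ht.2, hR, ← Finset.sum_add_distrib]
    refine Finset.sum_congr rfl fun i _ => ?_
    ext x
    have h1 := inv_pow_mul_seqPoly_smul (fun s => a i s x) (W i) (κ i) ht0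
    have h2 : seqPoly (κ i) (fun s => a i s x) t = seqPoly (κ i) (a i) t x := by
      simp [seqPoly]
    have h3 : seqPoly (κ i + 1) (W i) t = seqPoly (κ i) (W i) t + t ^ κ i • W i (κ i) :=
      Finset.sum_range_succ _ _
    rw [h2] at h1
    have h4 : ((∑ s ∈ Finset.range (κ i), (t ^ (κ i - s))⁻¹ •
            ∑ r ∈ Finset.range (s + 1), (innerSL ℂ (z i (s - r))).smulRight (W i r) : H →L[ℂ] H)) x
        = ∑ s ∈ Finset.range (κ i), (t ^ (κ i - s))⁻¹ • ∑ r ∈ Finset.range (s + 1),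
          a i (s - r) x • W i r := by
      simp only [hza, sum_apply, smul_apply, ContinuousLinearMap.smulRight_apply]
    have h5 : (∑ r ∈ Finset.range (κ i), ∑ j ∈ Finset.range r,
        t ^ j • (a i (κ i - r + j)).smulRight (W i r) : H →L[ℂ] H) x
        = ∑ r ∈ Finset.range (κ i), ∑ j ∈ Finset.range r, t ^ j • a i (κ i - r + j) x • W i r := by
      simp only [sum_apply, smul_apply, ContinuousLinearMap.smulRight_apply]
    rw [add_apply, add_apply, add_apply, h4, h5, smul_apply,
      ContinuousLinearMap.smulRight_apply, ContinuousLinearMap.smulRight_apply,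
      ContinuousLinearMap.smulRight_apply, ha, ← add_assoc, ← add_assoc, ← h1, add_apply, smul_apply,
      add_smul, smul_add]
    congr 1
    · rw [h3, smul_add, smul_add, smul_smul, smul_comm _ (t ^ κ i),
        inv_smul_smul₀ (pow_ne_zero _ ht0)]
    · rw [smul_assoc, inv_smul_smul₀ (pow_ne_zero _ ht0)]

/-- The chains of positive length among adapted sequences. -/
def adaptedSystem (κ : ι → ℕ) (W : ι → ℕ → H) : ChainSystem H where
  num := Fintype.card {i // κ i ≠ 0}
  p k := κ ((Fintype.equivFin {i // κ i ≠ 0}).symm k) - 1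
  w k := W ((Fintype.equivFin {i // κ i ≠ 0}).symm k)

/-- The adapted sequence that underlies a chain of the system. -/
def adaptedIndex (κ : ι → ℕ) (k : Fin (Fintype.card {i // κ i ≠ 0})) : ι :=
  (Fintype.equivFin {i // κ i ≠ 0}).symm k

lemma adaptedIndex_injective (κ : ι → ℕ) : Function.Injective (adaptedIndex κ) :=
  Subtype.val_injective.comp (Equiv.injective _)

omit [NormedAddCommGroup H] [InnerProductSpace ℂ H] in
lemma adaptedSystem_p (k : Fin (adaptedSystem κ W).num) :
    (adaptedSystem κ W).p k + 1 = κ (adaptedIndex κ k) :=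
  Nat.sub_add_cancel (Nat.pos_of_ne_zero ((Fintype.equivFin {i // κ i ≠ 0}).symm k).2)

lemma exists_adaptedIndex {i : ι} (hi : κ i ≠ 0) : ∃ k, adaptedIndex κ k = i :=
  ⟨Fintype.equivFin {i // κ i ≠ 0} ⟨i, hi⟩, by simp [adaptedIndex]⟩

lemma sum_adaptedIndex {M : Type*} [AddCommMonoid M] (f : ι → M) (hf : ∀ i, κ i = 0 → f i = 0) :
    ∑ k, f (adaptedIndex κ k) = ∑ i, f i := by
  classical
  have h1 : ∑ k, f (adaptedIndex κ k) = ∑ i : {i // κ i ≠ 0}, f i :=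
    (Fintype.equivFin {i // κ i ≠ 0}).symm.sum_comp fun i : {i // κ i ≠ 0} => f i
  rw [h1, ← Finset.sum_subtype (Finset.univ.filter fun i => κ i ≠ 0) (by simp), Finset.sum_filter]
  refine Finset.sum_congr rfl fun i _ => ?_
  split_ifs with h
  · rfl
  · exact (hf i (not_not.1 h)).symm

lemma IsAdapted.exists_isAdjointSystem [FiniteDimensional ℂ H] (h : IsAdapted A μ κ W) :
    ∃ z, IsAdjointSystem A μ (adaptedSystem κ W) z := by
  obtain ⟨z, R, hR, hev⟩ := h.exists_principalPart
  refine ⟨fun k => z (adaptedIndex κ k), fun lam => R (lam - μ), ?_, ?_⟩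
  · have h1 : AnalyticAt ℂ (fun lam : ℂ => lam - μ) μ := by fun_prop
    exact AnalyticAt.fun_comp (by rwa [sub_self]) h1
  · have hlim : Tendsto (fun lam : ℂ => lam - μ) (𝓝[≠] μ) (𝓝[≠] 0) := by
      refine tendsto_nhdsWithin_iff.2 ⟨?_, ?_⟩
      · have : Continuous fun lam : ℂ => lam - μ := by fun_prop
        exact (this.tendsto' μ 0 (sub_self μ)).mono_left nhdsWithin_le_nhds
      · filter_upwards [self_mem_nhdsWithin] with lam hl
        exact sub_ne_zero.2 hl
    filter_upwards [hlim.eventually hev] with lam hl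
    rw [add_sub_cancel] at hl
    refine ⟨hl.1, hl.2.trans ?_⟩
    congr 1
    rw [← sum_adaptedIndex (κ := κ)]
    · refine Finset.sum_congr rfl fun k _ => ?_
      exact (congrArg (fun N => ∑ s ∈ Finset.range N, ((lam - μ) ^ (N - s))⁻¹ •
        ∑ r ∈ Finset.range (s + 1), (innerSL ℂ (z (adaptedIndex κ k) (s - r))).smulRight
          (W (adaptedIndex κ k) r)) (adaptedSystem_p (W := W) k)).symm
    · intro i hi
      rw [hi]; rfl

lemma IsAdapted.isKernelChainSystem (h : IsAdapted A μ κ W) :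
    IsKernelChainSystem A μ (adaptedSystem κ W) := by
  refine ⟨fun k => (isChain_iff A μ _ _).2 ⟨h.linearIndependent.ne_zero _, fun s hs => ?_⟩,
    h.linearIndependent.comp _ (adaptedIndex_injective κ), le_antisymm ?_ ?_⟩
  · have := adaptedSystem_p (W := W) k
    exact h.seqAct_eq (adaptedIndex κ k) s (by omega)
  · rw [← chainSpace_one, Submodule.span_le]
    rintro _ ⟨k, rfl⟩
    have := adaptedSystem_p (W := W) k
    exact mem_chainSpace.2 ⟨W (adaptedIndex κ k), fun s hs =>
      h.seqAct_eq (adaptedIndex κ k) s (by omega), rfl⟩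
  · rw [← chainSpace_one]
    refine (h.le_span 1).trans (Submodule.span_mono ?_)
    rintro _ ⟨i, hi, rfl⟩
    obtain ⟨k, rfl⟩ := exists_adaptedIndex (κ := κ) (i := i) (by have : 1 ≤ κ i := hi; omega)
    exact ⟨k, rfl⟩

lemma sum_eq_sum_card_filter {α : Type*} [Fintype α] {f : α → ℕ} {K : ℕ} (hf : ∀ a, f a ≤ K) :
    ∑ a, f a = ∑ q ∈ Finset.range K, (Finset.univ.filter fun a => q < f a).card := by
  simp only [Finset.card_filter]
  rw [Finset.sum_comm]
  refine Finset.sum_congr rfl fun a _ => ?_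
  have : (Finset.range K).filter (fun q => q < f a) = Finset.range (f a) := by
    ext q
    have := hf a
    simp only [Finset.mem_filter, Finset.mem_range]
    omega
  rw [← Finset.card_filter, this, Finset.card_range]

/-- Count totals layer by layer. In any competing system the chains longer than `q` have independent
leading vectors in `chainSpace A μ (q + 1)`, whose dimension is at most the number of adapted
sequences with `q < κ i`. -/
lemma IsAdapted.isCanonicalSystem [FiniteDimensional ℂ H] (h : IsAdapted A μ κ W) :
    IsCanonicalSystem A μ (adaptedSystem κ W) := by
  classical
  refine ⟨h.isKernelChainSystem, fun S' hS' => ?_⟩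
  set K := ∑ k, (S'.p k + 1) + ∑ i, κ i with hK
  have h1 : S'.total = ∑ q ∈ Finset.range K, (Finset.univ.filter fun k => q < S'.p k + 1).card :=
    sum_eq_sum_card_filter fun k => (Finset.single_le_sum (f := fun k => S'.p k + 1)
      (fun _ _ => Nat.zero_le _) (Finset.mem_univ k)).trans (Nat.le_add_right _ _)
  have h2 : ∑ i, κ i = ∑ q ∈ Finset.range K, (Finset.univ.filter fun i => q < κ i).card :=
    sum_eq_sum_card_filter fun i => (Finset.single_le_sum (f := κ)
      (fun _ _ => Nat.zero_le _) (Finset.mem_univ i)).trans (Nat.le_add_left _ _)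
  have h3 : (adaptedSystem κ W).total = ∑ i, κ i := by
    rw [← sum_adaptedIndex κ (κ := κ) fun _ h => h]
    exact Finset.sum_congr rfl fun k _ => adaptedSystem_p (W := W) k
  rw [h1, h3, h2]
  refine Finset.sum_le_sum fun q _ => ?_
  have hli : LinearIndependent ℂ fun k : {k // q < S'.p k + 1} => S'.w k 0 :=
    hS'.2.1.comp _ Subtype.val_injective
  rw [← Fintype.card_subtype, ← finrank_span_eq_card hli]
  refine (Submodule.finrank_mono (t := Submodule.span ℂ
    (((Finset.univ.filter fun i => q < κ i).image fun i => W i 0 : Finset H) : Set H)) ?_).trans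
    ((finrank_span_finset_le_card _).trans Finset.card_image_le)
  rw [Submodule.span_le]
  rintro _ ⟨⟨k, hk⟩, rfl⟩
  have hmem : S'.w k 0 ∈ chainSpace A μ (q + 1) :=
    mem_chainSpace.2 ⟨S'.w k, fun s hs => hS'.seqAct_eq_zero k (by omega), rfl⟩
  refine Submodule.span_mono ?_ (h.le_span _ hmem)
  rintro _ ⟨i, hi, rfl⟩
  exact Finset.mem_coe.2 (Finset.mem_image.2 ⟨i, by
    simpa using Nat.lt_of_succ_le hi, rfl⟩)

end AdaptedSystem

/-! ### Diagonalization of the Gram form and existence of regular systems. -/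

section DiagonalGram

variable {H : Type*} [NormedAddCommGroup H] [InnerProductSpace ℂ H] {n : ℕ}
  {A : Fin (n + 1) → H →L[ℂ] H} {c : ℝ}

/-- The transition coefficients invert the Gram matrix. If that matrix is diagonal, its entries
cannot vanish and the coefficients are their reciprocals. -/
lemma IsAdjointSystem.revSeq_sub_mem_of_diagonal [CompleteSpace H] {S : ChainSystem H}
    {z : Fin S.num → ℕ → H} (hA : IsDissipative A) (hker : IsKernelChainSystem A c S)
    (hadj : IsAdjointSystem A c S z) {d : Fin S.num → ℝ}
    (hd : ∀ j k m, S.p j = 2 * m → S.p k = 2 * m →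
      inner ℂ (S.w j 0) (chainImage A c (S.p k) (S.w k) 0) = if j = k then (d j : ℂ) else 0)
    {k : Fin S.num} {m : ℕ} (hk : S.p k = 2 * m) :
    d k ≠ 0 ∧ revSeq m (z k) - (d k : ℂ)⁻¹ • revSeq m (S.w k) ∈ halfPole S := by
  have hch := fun k s hs => hker.seqAct_eq_zero (s := s) k hs
  have key : ∀ k, S.p k = 2 * m → ∀ b : Fin S.num → ℂ, (∀ j, S.p j ≠ 2 * m → b j = 0) →
      revSeq m (z k) - ∑ j, b j • revSeq m (S.w j) ∈ halfPole S → ∀ k', S.p k' = 2 * m →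
      (starRingEnd ℂ) (b k') * d k' = if k = k' then 1 else 0 := by
    intro k hk b hb hmem k' hk'
    rw [← hadj.sum_mul_inner_chainImage hA hch hker.2.1 hk hk' hmem,
      Finset.sum_eq_single_of_mem k' (Finset.mem_univ _), hd k' k' m hk' hk', if_pos rfl]
    intro j _ hj
    by_cases hjm : S.p j = 2 * m
    · rw [hd j k' m hjm hk', if_neg hj, mul_zero]
    · rw [hb j hjm, map_zero, zero_mul]
  have hne : ∀ k, S.p k = 2 * m → d k ≠ 0 := by
    intro k hk h0
    obtain ⟨b, hb, hmem⟩ := hadj.exists_revSeq_sub_mem hA hker.2.1 hk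
    have := key k hk b hb hmem k hk
    rw [if_pos rfl, h0, Complex.ofReal_zero, mul_zero] at this
    exact zero_ne_one this
  refine ⟨hne k hk, ?_⟩
  obtain ⟨b, hb, hmem⟩ := hadj.exists_revSeq_sub_mem hA hker.2.1 hk
  have hbk : ∀ j, j ≠ k → b j = 0 := by
    intro j hj
    by_cases hjm : S.p j = 2 * m
    · have := key k hk b hb hmem j hjm
      rw [if_neg hj.symm] at this
      have hdj : (d j : ℂ) ≠ 0 := by exact_mod_cast hne j hjm
      simpa [hdj] using this
    · exact hb j hjm
  have hb' : b k = (d k : ℂ)⁻¹ := by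
    have := key k hk b hb hmem k hk
    rw [if_pos rfl] at this
    have := eq_inv_of_mul_eq_one_left this
    rw [← Complex.conj_conj (b k), this, map_inv₀, Complex.conj_ofReal]
  rw [Finset.sum_eq_single_of_mem k (Finset.mem_univ _) fun j _ hj => by rw [hbk j hj, zero_smul],
    hb'] at hmem
  exact hmem

/-- The leading coefficient of the image of a sequence, as a linear map. -/
def chainImageHom (A : Fin (n + 1) → H →L[ℂ] H) (μ : ℂ) (p : ℕ) : (ℕ → H) →ₗ[ℂ] H where
  toFun y := chainImage A μ p y 0
  map_add' x y := by
    have h : truncSeq (p + 1) (x + y) = truncSeq (p + 1) x + truncSeq (p + 1) y := by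
      ext i; simp only [truncSeq, Pi.add_apply]; split_ifs <;> simp
    simp only [chainImage, ← seqActHom_apply, h, map_add, Pi.add_apply]
  map_smul' a x := by
    have h : truncSeq (p + 1) (a • x) = a • truncSeq (p + 1) x := by
      ext i; simp only [truncSeq, Pi.smul_apply]; split_ifs <;> simp
    simp only [chainImage, ← seqActHom_apply, h, map_smul, Pi.smul_apply, RingHom.id_apply]

/-- The leading vectors of the chains of length exactly `q`. -/
def chainLayer (A : Fin (n + 1) → H →L[ℂ] H) (μ : ℂ) (q : ℕ) : Submodule ℂ H :=
  (chainSpace A μ (q + 1))ᗮ ⊓ chainSpace A μ q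

variable [FiniteDimensional ℂ H]

/-- A linear lift from leading vectors to chains turns the Gram form into an operator on the layer;
it is symmetric by `IsChainGerm.inner_symm`, and the spectral theorem applies. -/
lemma exists_diagonal_basis (hA : IsDissipative A) (c : ℝ) (q : ℕ) :
    ∃ (β : OrthonormalBasis (Fin (Module.finrank ℂ (chainLayer A c q))) ℂ (chainLayer A c q))
      (W : Fin (Module.finrank ℂ (chainLayer A c q)) → ℕ → H)
      (d : Fin (Module.finrank ℂ (chainLayer A c q)) → ℝ),
      (∀ i, W i 0 = β i) ∧ (∀ i, ∀ s < q, seqAct A c (W i) s = 0) ∧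
      ∀ m, q = 2 * m + 1 → ∀ i j, inner ℂ (W i 0) (chainImage A c (2 * m) (W j) 0)
        = if i = j then (d i : ℂ) else 0 := by
  obtain ⟨g, hg⟩ := LinearMap.exists_rightInverse_of_surjective _
    (LinearMap.range_eq_top.2 ((LinearMap.proj (R := ℂ) (φ := fun _ : ℕ => H) 0).submoduleMap_surjective
      (chainSeqs A (c : ℂ) q)))
  set C := chainLayer A (c : ℂ) q
  set Λ : C →ₗ[ℂ] (ℕ → H) := (chainSeqs A (c : ℂ) q).subtype ∘ₗ g ∘ₗ
    Submodule.inclusion (inf_le_right : C ≤ chainSpace A c q) with hΛ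
  have hΛ0 : ∀ x, Λ x 0 = x := fun x =>
    congrArg Subtype.val (LinearMap.congr_fun hg
      (Submodule.inclusion (inf_le_right : C ≤ chainSpace A c q) x))
  have hΛs : ∀ x, ∀ s < q, seqAct A c (Λ x) s = 0 := fun x =>
    mem_chainSeqs.1 (g (Submodule.inclusion (inf_le_right : C ≤ chainSpace A c q) x)).2
  by_cases hq : ∃ m, q = 2 * m + 1
  · obtain ⟨m, hm⟩ := hq
    set T : C →ₗ[ℂ] C := (C.orthogonalProjectionOnto : H →ₗ[ℂ] C) ∘ₗ chainImageHom A c (2 * m) ∘ₗ Λ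
      with hT
    have hTr : ∀ x y : C, inner ℂ x (T y) = inner ℂ (Λ x 0) (chainImage A c (2 * m) (Λ y) 0) := by
      intro x y
      rw [hΛ0]
      exact Submodule.inner_orthogonalProjectionOnto_eq_of_mem_left x _
    have hTl : ∀ x y : C, inner ℂ (T x) y = inner ℂ (chainImage A c (2 * m) (Λ x) 0) (Λ y 0) := by
      intro x y
      rw [hΛ0]
      exact Submodule.inner_orthogonalProjectionOnto_eq_of_mem_right y _
    have hsymm : T.IsSymmetric := by
      intro x y
      rw [hTl, hTr]
      exact ((isChainGerm_of_chain fun s hs => hΛs y s (by omega)).inner_symm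
        (fun t x => hA.inner_im_nonpos c t x)
        (isChainGerm_of_chain fun s hs => hΛs x s (by omega))).symm
    refine ⟨hsymm.eigenvectorBasis rfl, fun i => Λ (hsymm.eigenvectorBasis rfl i),
      hsymm.eigenvalues rfl, fun i => hΛ0 _, fun i => hΛs _, ?_⟩
    intro m' hm' i j
    obtain rfl : m' = m := by omega
    rw [← hTr, hsymm.apply_eigenvectorBasis, inner_smul_right,
      orthonormal_iff_ite.1 (hsymm.eigenvectorBasis rfl).orthonormal]
    split_ifs with h
    · rw [h, mul_one]; rfl
    · rw [mul_zero]
  · exact ⟨stdOrthonormalBasis ℂ C, fun i => Λ (stdOrthonormalBasis ℂ C i), 0, fun i => hΛ0 _,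
      fun i => hΛs _, fun m hm => absurd ⟨m, hm⟩ hq⟩

/-- The layers are pairwise orthogonal and exhaust the filtration from the top, so diagonal bases of
the layers combine into one adapted basis. -/
lemma exists_isAdapted_diagonal [NeZero n] (hu : IsUnit (A (Fin.last n))) (hA : IsDissipative A)
    (c : ℝ) : ∃ (ι : Type) (_ : Fintype ι) (κ : ι → ℕ) (W : ι → ℕ → H) (d : ι → ℝ),
      IsAdapted A c κ W ∧ ∀ i j m, κ i = 2 * m + 1 → κ j = 2 * m + 1 →
        inner ℂ (W i 0) (chainImage A c (2 * m) (W j) 0)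
          = open Classical in if i = j then (d i : ℂ) else 0 := by
  choose β W d hβ hs hd using exists_diagonal_basis hA c
  set K := Module.finrank ℂ (Fin n → H) + 1 with hK
  refine ⟨(q : Fin K) × Fin (Module.finrank ℂ (chainLayer A c q)), inferInstance, fun i => i.1,
    fun i => W i.1 i.2, fun i => d i.1 i.2, ⟨fun i s h => hs _ _ s h, ?_, ?_⟩, ?_⟩
  · have horth : OrthogonalFamily ℂ (fun q : Fin K => chainLayer A c q)
        fun q => (chainLayer A c q).subtypeₗᵢ := by
      refine OrthogonalFamily.of_pairwise ?_
      have : ∀ q q' : ℕ, q < q' → chainLayer A (c : ℂ) q ⟂ chainLayer A c q' := by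
        intro q q' h
        refine Submodule.isOrtho_iff_le.2 fun x hx => ?_
        exact Submodule.orthogonal_le (inf_le_right.trans (chainSpace_anti A c h)) hx.1
      intro q q' hne
      rcases lt_or_gt_of_ne hne with h | h
      · exact this q q' h
      · exact (this q' q h).symm
    have := (horth.orthonormal_sigma_orthonormal fun q => (β q).orthonormal).linearIndependent
    simp only [hβ]
    exact this
  · have key : ∀ e q : ℕ, K ≤ q + e → chainSpace A c q ≤ Submodule.span ℂ
        ((fun i : (q : Fin K) × Fin (Module.finrank ℂ (chainLayer A c q)) => W i.1 i.2 0) ''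
          {i | q ≤ i.1}) := by
      intro e
      induction e with
      | zero =>
        intro q hq
        rw [chainSpace_eq_bot hu c (by omega)]; exact bot_le
      | succ e ih =>
        intro q hq
        by_cases hqK : K ≤ q
        · rw [chainSpace_eq_bot hu c (by omega)]; exact bot_le
        rw [← Submodule.sup_orthogonal_inf_of_hasOrthogonalProjection
          (chainSpace_anti A c (Nat.le_succ q))]
        refine sup_le ((ih (q + 1) (by omega)).trans (Submodule.span_mono (image_mono fun i hi => ?_)))
          fun x hx => ?_
        · have hi : q + 1 ≤ i.1 := hi
          change q ≤ i.1
          omega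
        · have hx' := congrArg Subtype.val ((β q).sum_repr ⟨x, hx⟩)
          change _ = x at hx'
          rw [← hx', Submodule.coe_sum]
          refine Submodule.sum_mem _ fun i _ => Submodule.smul_mem _ _ ?_
          rw [← hβ]
          exact Submodule.subset_span ⟨⟨⟨q, by omega⟩, i⟩, le_refl q, rfl⟩
    exact fun q => key K q (by omega)
  · rintro ⟨q, i⟩ ⟨q', j⟩ m h1 h2
    obtain rfl : q = q' := Fin.ext (h1.trans h2.symm)
    beta_reduce
    rw [hd q m h1 i j]
    simp

theorem exists_isRegularSystem [NeZero n] (hu : IsUnit (A (Fin.last n))) (hA : IsDissipative A)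
    (c : ℝ) : ∃ (S : ChainSystem H) (ε : Fin S.num → ℤ), IsRegularSystem A c S ε := by
  classical
  obtain ⟨ι, _, κ, W, d, had, hd⟩ := exists_isAdapted_diagonal hu hA c
  -- Nondegeneracy is derived from the unnormalized system; it is available only for odd lengths.
  have hdne : ∀ i m, κ i = 2 * m + 1 → d i ≠ 0 := by
    intro i m hi
    obtain ⟨z, hz⟩ := had.exists_isAdjointSystem
    obtain ⟨k, rfl⟩ := exists_adaptedIndex (κ := κ) (i := i) (by omega)
    refine (hz.revSeq_sub_mem_of_diagonal hA had.isKernelChainSystem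
      (d := fun k => d (adaptedIndex κ k)) ?_ (k := k) (m := m) ?_).1
    · intro j k m hj hk
      have h1 := adaptedSystem_p (W := W) j
      have h2 := adaptedSystem_p (W := W) k
      rw [hk]
      refine (hd (adaptedIndex κ j) (adaptedIndex κ k) m (by omega) (by omega)).trans ?_
      by_cases h : j = k
      · subst h
        rw [if_pos rfl, if_pos rfl]
      · rw [if_neg h, if_neg fun h' => h (adaptedIndex_injective κ h')]
    · have := adaptedSystem_p (W := W) k
      omega
  -- Scaling by `|d|^{-1/2}` turns a Gram entry into its sign; the value `1` keeps the factor
  -- nonzero where `d i = 0`, which odd lengths exclude.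
  set r : ι → ℂ := fun i => if d i = 0 then 1 else ((Real.sqrt |d i|)⁻¹ : ℝ) with hr
  have hr0 : ∀ i, r i ≠ 0 := fun i => by
    simp only [hr]
    split_ifs with h
    · exact one_ne_zero
    · have : Real.sqrt |d i| ≠ 0 := by positivity
      exact_mod_cast inv_ne_zero this
  set σ : ι → ℤ := fun i => if 0 < d i then 1 else -1 with hσ
  have hrd : ∀ i, d i ≠ 0 → (starRingEnd ℂ) (r i) * r i * d i = ((σ i : ℝ) : ℂ) := by
    intro i hi
    simp only [hr, hσ, if_neg hi, Complex.conj_ofReal]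
    norm_cast
    have h1 : (Real.sqrt |d i|)⁻¹ * (Real.sqrt |d i|)⁻¹ = |d i|⁻¹ := by
      rw [← mul_inv, Real.mul_self_sqrt (abs_nonneg _)]
    rw [h1]
    rcases lt_or_gt_of_ne hi with h | h
    · rw [abs_of_neg h, if_neg (not_lt.2 h.le)]
      push_cast
      field_simp
    · rw [abs_of_pos h, if_pos h]
      push_cast
      field_simp
  set W' : ι → ℕ → H := fun i => r i • W i with hW'
  have had' : IsAdapted A c κ W' := had.smul hr0
  obtain ⟨z, hz⟩ := had'.exists_isAdjointSystem
  have hdiag : ∀ j k m, (adaptedSystem κ W').p j = 2 * m → (adaptedSystem κ W').p k = 2 * m →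
      inner ℂ ((adaptedSystem κ W').w j 0)
        (chainImage A c ((adaptedSystem κ W').p k) ((adaptedSystem κ W').w k) 0)
      = if j = k then (((σ (adaptedIndex κ j) : ℤ) : ℝ) : ℂ) else 0 := by
    intro j k m hj hk
    have h1 := adaptedSystem_p (W := W') j
    have h2 := adaptedSystem_p (W := W') k
    rw [hk]
    have h3 := hd (adaptedIndex κ j) (adaptedIndex κ k) m (by omega) (by omega)
    have h4 : chainImage A c (2 * m) (W' (adaptedIndex κ k)) 0
        = r (adaptedIndex κ k) • chainImage A c (2 * m) (W (adaptedIndex κ k)) 0 :=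
      (chainImageHom A c (2 * m)).map_smul _ _
    change inner ℂ (r (adaptedIndex κ j) • W (adaptedIndex κ j) 0)
      (chainImage A c (2 * m) (W' (adaptedIndex κ k)) 0) = _
    rw [h4, inner_smul_left, inner_smul_right, h3]
    by_cases h : j = k
    · subst h
      rw [if_pos rfl, if_pos rfl, ← mul_assoc, hrd _ (hdne _ m (by omega))]
    · rw [if_neg h, if_neg fun h' => h (adaptedIndex_injective κ h'), mul_zero, mul_zero]
  refine ⟨adaptedSystem κ W', fun k => if Odd ((adaptedSystem κ W').p k) then 0 else
    σ (adaptedIndex κ k), had'.isCanonicalSystem, ⟨z, hz, fun k m hk => ?_⟩, fun k hk => if_pos hk⟩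
  have hodd : ¬ Odd ((adaptedSystem κ W').p k) := by
    rw [hk]; simp
  obtain ⟨-, hmem⟩ := hz.revSeq_sub_mem_of_diagonal hA had'.isKernelChainSystem
    (d := fun k => ((σ (adaptedIndex κ k) : ℤ) : ℝ)) hdiag hk
  beta_reduce
  rw [if_neg hodd]
  have hσ' : σ (adaptedIndex κ k) = 1 ∨ σ (adaptedIndex κ k) = -1 := by
    simp only [hσ]
    split_ifs <;> simp
  refine ⟨hσ', ?_⟩
  have hinv : (((σ (adaptedIndex κ k) : ℤ) : ℝ) : ℂ)⁻¹ = (σ (adaptedIndex κ k) : ℂ) := by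
    rcases hσ' with h | h <;> rw [h] <;> simp
  rw [hinv] at hmem
  rw [keldysh_eq, keldysh_eq, ← map_smul, ← map_sub, ← map_poleData_halfPole]
  exact ⟨_, hmem, rfl⟩

end DiagonalGram

end HalfRange

end

/-! ### The theorem. -/

theorem mainTheorem10 {H : Type*} [NormedAddCommGroup H] [InnerProductSpace ℂ H]
    [FiniteDimensional ℂ H] (n l : ℕ) (hn : n = 2 * l) (A : Fin (n + 1) → H →L[ℂ] H)
    (hker : (A (Fin.last n)).ker = ⊥)
    (hdiss : HalfRange.IsDissipative A)
    (hrange : ∃ t₀ : ℝ, (0 : ℂ) ∉ HalfRange.numericalRange (HalfRange.pencil A (t₀ : ℂ))) :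
    (∃ (S : ℝ → HalfRange.ChainSystem H) (ε : (c : ℝ) → Fin (S c).num → ℤ),
      HalfRange.IsRegularFamily A S ε) ∧
    ∀ (S : ℝ → HalfRange.ChainSystem H) (ε : (c : ℝ) → Fin (S c).num → ℤ),
      HalfRange.IsRegularFamily A S ε →
      ∀ φ : Fin l → H,
        ∃ v : ℝ → H, HalfRange.IsHalfRangeSolution A S ε φ v ∧
          ∀ u : ℝ → H, HalfRange.IsHalfRangeSolution A S ε φ u → EqOn u v (Ici 0) := by
  have hu : IsUnit (A (Fin.last n)) := HalfRange.isUnit_of_ker_eq_bot hker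
  -- For `n = 0` there is no companion space: the pencil is a constant injective operator, so there
  -- are no eigenvalues and the only solution is zero.
  rcases Nat.eq_zero_or_pos n with rfl | hn0
  · obtain rfl : l = 0 := by omega
    have hA0 : ∀ x, A 0 x = 0 → x = 0 := fun x hx => by
      have : x ∈ (A (Fin.last 0)).ker := hx
      rwa [hker] at this
    refine ⟨⟨fun _ => ⟨0, fun _ => 0, fun _ _ => 0⟩, fun _ _ => 0, ?_⟩,
      fun S ε _ φ => ⟨0, ⟨⟨contDiffOn_const, ?_⟩, fun j => j.elim0,
        0, 0, fun _ _ => by simp, Submodule.zero_mem _, contDiffOn_const,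
        fun j hj => absurd hj (Nat.not_lt_zero j)⟩, ?_⟩⟩
    · rintro c ⟨y, hy, hy0⟩
      exact absurd (hA0 y (by simpa [HalfRange.pencil] using hy0)) hy
    · intro z _
      simp
    · rintro u ⟨⟨-, hu⟩, -⟩ z hz
      exact hA0 _ (by simpa [iteratedDerivWithin_zero] using hu z hz)
  · have : NeZero n := ⟨hn0.ne'⟩
    choose S ε hS using fun c => HalfRange.exists_isRegularSystem hu hdiss c
    exact ⟨⟨S, ε, fun c _ => hS c⟩, fun S ε hreg φ =>
      HalfRange.existsUnique_halfRangeSolution hn hu hdiss hrange hreg φ⟩
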